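/- Fix a constant $c$ with $0<c\le e$; implicit constants may depend on $c$, and all asymptotics are as $\delta\to0^+$. Here $f=O(g)$ means $|f|\le C|g|$ for some constant $C$, and $f=\Theta(g)$ means that also $f\ge a|g|$ for some constant $a>0$, for all sufficiently small $\delta>0$. **Rates and drift.** For $x\in\mathbb R^4$ with $x_2>0$ and $2x_3\ge x_1+2x_2$, let $z(x)\ge0$ be the unique solution of $$\frac{z(e^z-1)}{e^z-z-1}=\frac{2x_3-x_1}{x_2}$$ (the left side is read as $2$ at $z=0$), and write $z=z(x)$. For integers $k_1\ge1$, $k_2,k_3\ge0$ with $k_1+k_2+k_3\ge2$ and $l=(-k_1+k_2,\,-1-k_2,\,-k_1-k_2-k_3,\,1)$ let $$\beta_l(x)=\frac1{(k_1-1)!\,k_2!\,k_3!}\cdot\frac{x_2}{2x_3}\cdot\frac{z}{e^z-z-1}\Big(\frac{x_1}{2x_3}z\Big)^{k_1-1}\Big(\frac{x_2z^2}{2x_3(e^z-z-1)}z\Big)^{k_2}\Big(\frac{x_2z}{2x_3}z\Big)^{k_3};$$ let $\beta_{(-2,0,-1,1)}(x)=x_1/(2x_3)$, and $\beta_l=0$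 for all other $l\in\mathbb Z^4$. Let $F(x)=\sum_{l\in\mathbb Z^4}\beta_l(x)\,l$ and $(\partial F)_{i,j}=\partial F_i/\partial x_j$. **Fluid limit.** Let $\beta(u)$ be the unique solution of $\beta(u)e^{c\beta(u)}=e^u$. For $0\le s\le 1-\beta(0)-\frac1{2c}\log^2\beta(0)$ let $\vartheta=\vartheta(s)\ge0$ be the unique nonnegative solution of $s=\frac1c\big(c(1-\beta(\vartheta))-\frac12\log^2\beta(\vartheta)\big)$, and let $\chi(s)=(\chi_1(s),\dots,\chi_4(s))$ with $$\chi_1=\tfrac1c\big(\vartheta^2-c\,\vartheta\,\beta(\vartheta)(1-e^{-\vartheta})\big),\quad \chi_2=e^{-\vartheta}(e^\vartheta-\vartheta-1)\beta(\vartheta),\quad \chi_3=\tfrac1{2c}\vartheta^2,\quad \chi_4=s.$$ Let $s^*=\inf\{s\ge0:\chi_1(s)=0\}$ and $s_\delta=\inf\{s\ge0:\chi_3(s)\le\delta\}$. **Limiting covariance.** For $0\le u\le s<s^*$ let $\Phi(s,u)\in\mathbb R^{4\times4}$ be the solution of $\frac{\partial}{\partial s}\Phi(s,u)=\partial F(\chi(s))\,\Phi(s,u)$,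 $\Phi(u,u)=I$. Let $W_l$ ($l\in\mathbb Z^4$) be independent standard Brownian motions, and let $V(0)$ be a centred Gaussian vector in $\mathbb R^4$, independent of $(W_l)_l$, whose covariance matrix $\Sigma$ is symmetric and is one of the following two matrices; all entries of $\Sigma$ not listed, up to symmetry, are $0$. - ($\lfloor cn/2\rfloor$ edges.) $\Sigma_{11}=c^2e^{-2c}+ce^{-c}-ce^{-2c}-c^3e^{-2c}$, $\Sigma_{12}=-ce^{-c}+ce^{-2c}+c^3e^{-2c}$, $\Sigma_{22}=(e^{-c}+ce^{-c})(1-e^{-c}-ce^{-c})-c^3e^{-2c}$. - ($\mathrm{Bin}(\binom n2,c/n)$ edges.) $\Sigma_{11}=(c^3-3c^2+c)e^{-2c}+ce^{-c}$, $\Sigma_{12}=(-c^3+2c^2+c)e^{-2c}-ce^{-c}$, $\Sigma_{13}=(c-c^2)e^{-c}$, $\Sigma_{22}=(c^3-c^2-2c-1)e^{-2c}+(c+1)e^{-c}$, $\Sigma_{23}=c^2e^{-c}$, $\Sigma_{33}=c/2$. Put $\mathcal W(s)=\sum_{l\in\mathbb Z^4}W_l\big(\int_0^s\beta_l(\chi(q))\,dq\big)\,l$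 and $$V(s)=\Phi(s,0)V(0)+\int_0^s\Phi(s,u)\,d\mathcal W(u),$$ where the integral is the Wiener–Itô integral of a deterministic continuous function (the $L^2$-limit of left-endpoint sums over partitions of $[0,s]$ as the mesh tends to $0$). Let $\Sigma_\delta$ be the covariance matrix of the random vector $$V(s_\delta)-\frac{V_3(s_\delta)}{F_3(\chi(s_\delta))}\,F(\chi(s_\delta)).$$ **Lemma.** For each of the two choices of $\Sigma$: 1. $\chi_1(s_\delta)=O(\delta)$, and $\chi_j(s_\delta)=\Theta(\delta)$ for $j\in\{2,3\}$; 2. $z(\chi(s_\delta))=\Theta(\sqrt\delta)$; 3. $\lim_{\delta\to0^+}(\Sigma_\delta)_{j,j}=0$ for $j\in\{1,2,3\}$; 4. $\liminf_{\delta\to0^+}(\Sigma_\delta)_{4,4}>0$. -/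

import Mathlib

open MeasureTheory ProbabilityTheory Filter Topology Asymptotics
open scoped Matrix NNReal ENNReal

namespace KarpSipser

noncomputable section

/-! Vectors in `ℝ⁴` are functions `Fin 4 → ℝ`; the coordinates `1, 2, 3, 4` of the mathematical
text are the indices `0, 1, 2, 3`. -/

/-! ### Rates and drift -/

/-- `f(z) = e^z - z - 1`. -/
def expTail (z : ℝ) : ℝ := Real.exp z - z - 1

/-- The function `z ↦ z (e^z - 1) / (e^z - z - 1)` on `[0, ∞)`, with its limiting value `2` at
`z = 0`. It is the mean of a Poisson(`z`) variable conditioned to be at least `2`. -/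
def truncMean (z : ℝ) : ℝ := if z = 0 then 2 else z * (Real.exp z - 1) / expTail z

/-- `z(x)`: the solution `z ≥ 0` of `z (e^z - 1) / (e^z - z - 1) = (2 x₃ - x₁) / x₂`. It exists and
is unique as soon as `x₂ > 0` and `2 x₃ ≥ x₁ + 2 x₂`; the value is irrelevant for other `x`. -/
def zParam (x : Fin 4 → ℝ) : ℝ :=
  Function.invFunOn truncMean (Set.Ici 0) ((2 * x 2 - x 0) / x 1)

/-- The index set `{(k₁, k₂, k₃) : k₁ ≥ 1, k₂, k₃ ≥ 0, k₁ + k₂ + k₃ ≥ 2}`. -/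
def stepIndex : Set (ℕ × ℕ × ℕ) := {k | 1 ≤ k.1 ∧ 2 ≤ k.1 + k.2.1 + k.2.2}

/-- The step `(-k₁ + k₂, -1 - k₂, -k₁ - k₂ - k₃, 1)`. -/
def step (k : ℕ × ℕ × ℕ) : Fin 4 → ℤ :=
  ![-(k.1 : ℤ) + k.2.1, -1 - (k.2.1 : ℤ), -(k.1 : ℤ) - k.2.1 - k.2.2, 1]

/-- The rate of the step with index `(k₁, k₂, k₃)`. -/
def stepRate (k : ℕ × ℕ × ℕ) (x : Fin 4 → ℝ) : ℝ :=
  1 / ((k.1 - 1).factorial * k.2.1.factorial * k.2.2.factorial : ℝ)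
    * (x 1 / (2 * x 2))
    * (zParam x / expTail (zParam x))
    * (x 0 / (2 * x 2) * zParam x) ^ (k.1 - 1)
    * (x 1 * zParam x ^ 2 / (2 * x 2 * expTail (zParam x)) * zParam x) ^ k.2.1
    * (x 1 * zParam x / (2 * x 2) * zParam x) ^ k.2.2

open Classical in
/-- The rate functions `β_l`, for `l ∈ ℤ⁴`. -/
def rate (l : Fin 4 → ℤ) (x : Fin 4 → ℝ) : ℝ :=
  if l = ![-2, 0, -1, 1] then x 0 / (2 * x 2)
  else if h : ∃ k, k ∈ stepIndex ∧ step k = l then stepRate h.choose x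
  else 0

theorem step_injective : Function.Injective step := by
  rintro ⟨a, b, d⟩ ⟨a', b', d'⟩ h
  have h0 := congrFun h 0
  have h1 := congrFun h 1
  have h2 := congrFun h 2
  simp [step] at h0 h1 h2
  simp only [Prod.mk.injEq]
  omega

/-- The choice in the definition of `rate` is harmless: `β_l` is given by `stepRate` at
`l = step k`. -/
theorem rate_step {k : ℕ × ℕ × ℕ} (hk : k ∈ stepIndex) (x : Fin 4 → ℝ) :
    rate (step k) x = stepRate k x := by
  have h1 : step k ≠ ![-2, 0, -1, 1] := by
    intro h
    have := congrFun h 1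
    simp [step] at this
    omega
  have h2 : ∃ k', k' ∈ stepIndex ∧ step k' = step k := ⟨k, hk, rfl⟩
  rw [rate, if_neg h1, dif_pos h2, step_injective h2.choose_spec.2]

/-- The drift function `F(x) = ∑_l β_l(x) l`. -/
def drift (x : Fin 4 → ℝ) : Fin 4 → ℝ :=
  fun i => ∑' l : Fin 4 → ℤ, rate l x * (l i : ℝ)

/-- The Jacobian matrix `(∂F(x))_{i,j} = ∂F_i / ∂x_j (x)`. -/
def driftJacobian (x : Fin 4 → ℝ) : Matrix (Fin 4) (Fin 4) ℝ :=
  Matrix.of fun i j => deriv (fun t : ℝ => drift (Function.update x j t) i) (x j)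

/-! ### The fluid limit -/

/-- `β(u)`: the unique real solution of `β e^{c β} = e^u`. -/
def betaFn (c u : ℝ) : ℝ := Function.invFun (fun b : ℝ => b * Real.exp (c * b)) (Real.exp u)

/-- The time at which the fluid limit has parameter `ϑ = u`:
`(c (1 - β(u)) - (1/2) log² β(u)) / c`. -/
def timeOf (c u : ℝ) : ℝ :=
  1 / c * (c * (1 - betaFn c u) - 1 / 2 * Real.log (betaFn c u) ^ 2)

/-- `ϑ(s)`: the solution `ϑ ≥ 0` of `s = timeOf c ϑ`. It exists and is unique for
`0 ≤ s ≤ timeOf c 0`; the value is irrelevant for larger `s`. -/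
def theta (c s : ℝ) : ℝ := Function.invFunOn (timeOf c) (Set.Ici 0) s

/-- The fluid limit `χ(s) = (χ₁(s), χ₂(s), χ₃(s), χ₄(s))`. -/
def fluid (c s : ℝ) : Fin 4 → ℝ :=
  ![1 / c * (theta c s ^ 2
      - theta c s * c * betaFn c (theta c s) * (1 - Real.exp (-theta c s))),
    Real.exp (-theta c s) * expTail (theta c s) * betaFn c (theta c s),
    1 / (2 * c) * theta c s ^ 2,
    s]

/-- `s^* = inf {s ≥ 0 : χ₁(s) = 0}`. -/
def sStar (c : ℝ) : ℝ := sInf {s : ℝ | 0 ≤ s ∧ fluid c s 0 = 0}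

/-- `s_δ = inf {s ≥ 0 : χ₃(s) ≤ δ}`. -/
def sDelta (c δ : ℝ) : ℝ := sInf {s : ℝ | 0 ≤ s ∧ fluid c s 2 ≤ δ}

/-! ### The correlation function -/

/-- `Φ(s, u)`, for `0 ≤ u ≤ s < s^*`, solves `∂Φ(s, u)/∂s = ∂F(χ(s)) Φ(s, u)` with
`Φ(u, u) = I` (with a one-sided derivative at `s = u`). -/
def IsCorrelationFunction (c : ℝ) (Φ : ℝ → ℝ → Matrix (Fin 4) (Fin 4) ℝ) : Prop :=
  ∀ u, 0 ≤ u → u < sStar c →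
    Φ u u = 1 ∧
    ∀ s, u ≤ s → s < sStar c → ∀ i j,
      HasDerivWithinAt (fun r => Φ r u i j) ((driftJacobian (fluid c s) * Φ s u) i j)
        (Set.Ico u (sStar c)) s

open Classical in
/-- The matrix solution `Φ` (its values are only meaningful for `0 ≤ u ≤ s < s^*`, where it is
unique). -/
def corr (c : ℝ) : ℝ → ℝ → Matrix (Fin 4) (Fin 4) ℝ :=
  if h : ∃ Φ, IsCorrelationFunction c Φ then h.choose else 0

/-! ### Initial covariance -/

/-- The two random multigraph models: a binomial number `Bin(n(n-1)/2, c/n)` of edges, or exactly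
`⌊c n / 2⌋` edges. -/
inductive EdgeModel where
  | binomialEdges
  | fixedEdges

/-- The limiting covariance matrix of the rescaled initial state. -/
def initCov (c : ℝ) : EdgeModel → Matrix (Fin 4) (Fin 4) ℝ
  | .fixedEdges =>
    !![c ^ 2 * Real.exp (-2 * c) + c * Real.exp (-c) - c * Real.exp (-2 * c)
          - c ^ 3 * Real.exp (-2 * c),
        -c * Real.exp (-c) + c * Real.exp (-2 * c) + c ^ 3 * Real.exp (-2 * c), 0, 0;
      -c * Real.exp (-c) + c * Real.exp (-2 * c) + c ^ 3 * Real.exp (-2 * c),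
        (Real.exp (-c) + c * Real.exp (-c)) * (1 - Real.exp (-c) - c * Real.exp (-c))
          - c ^ 3 * Real.exp (-2 * c), 0, 0;
      0, 0, 0, 0;
      0, 0, 0, 0]
  | .binomialEdges =>
    !![(c ^ 3 - 3 * c ^ 2 + c) * Real.exp (-2 * c) + c * Real.exp (-c),
        (-c ^ 3 + 2 * c ^ 2 + c) * Real.exp (-2 * c) - c * Real.exp (-c),
        (c - c ^ 2) * Real.exp (-c), 0;
      (-c ^ 3 + 2 * c ^ 2 + c) * Real.exp (-2 * c) - c * Real.exp (-c),
        (c ^ 3 - c ^ 2 - 2 * c - 1) * Real.exp (-2 * c) + (c + 1) * Real.exp (-c),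
        c ^ 2 * Real.exp (-c), 0;
      (c - c ^ 2) * Real.exp (-c), c ^ 2 * Real.exp (-c), c / 2, 0;
      0, 0, 0, 0]

/-! ### The Gaussian process -/

section Gauss

variable {Ω : Type*} [MeasurableSpace Ω]

/-- The random input of the Gaussian process: a centred Gaussian vector `V(0)` with the initial
covariance, and independent standard Brownian motions `W_l`, `l ∈ ℤ⁴`, that are jointly independent
of `V(0)`. -/
structure IsInput (c : ℝ) (M : EdgeModel) (P : Measure Ω) (V₀ : Ω → Fin 4 → ℝ)
    (W : (Fin 4 → ℤ) → ℝ≥0 → Ω → ℝ) : Prop where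
  gaussian : HasGaussianLaw V₀ P
  mean : ∀ i, ∫ ω, V₀ ω i ∂P = 0
  covariance : ∀ i j, cov[fun ω => V₀ ω i, fun ω => V₀ ω j; P] = initCov c M i j
  brownian : ∀ l, IsBrownianReal (W l) P
  indep : iIndepFun (fun l ω t => W l t ω) P
  indep_init : IndepFun V₀ (fun ω l t => W l t ω) P

/-- `𝒲(s) = ∑_l W_l(∫₀ˢ β_l(χ(q)) dq) l`. -/
def noise (c : ℝ) (W : (Fin 4 → ℤ) → ℝ≥0 → Ω → ℝ) (s : ℝ) (ω : Ω) : Fin 4 → ℝ :=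
  fun i => ∑' l : Fin 4 → ℤ,
    W l (∫ q in (0 : ℝ)..s, rate l (fluid c q)).toNNReal ω * (l i : ℝ)

/-- The left-endpoint sum `∑_{k < n} f(t_k) (N(t_{k+1}) - N(t_k))`. -/
def leftSum (f : ℝ → Matrix (Fin 4) (Fin 4) ℝ) (N : ℝ → Ω → Fin 4 → ℝ) (n : ℕ) (t : ℕ → ℝ)
    (ω : Ω) : Fin 4 → ℝ :=
  ∑ k ∈ Finset.range n, f (t k) *ᵥ (N (t (k + 1)) ω - N (t k) ω)

/-- `Y` is the Wiener–Itô integral `∫₀ˢ f(u) dN(u)` of the deterministic function `f`: the limit in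
`L²` of the left-endpoint sums over the partitions of `[0, s]`, as their mesh tends to `0`. (For
continuous `f`, as used here, the limit exists and is the usual integral.) -/
def IsStochIntegral (P : Measure Ω) (f : ℝ → Matrix (Fin 4) (Fin 4) ℝ) (N : ℝ → Ω → Fin 4 → ℝ)
    (s : ℝ) (Y : Ω → Fin 4 → ℝ) : Prop :=
  (∀ i, MemLp (fun ω => Y ω i) 2 P) ∧
  ∀ ε : ℝ, 0 < ε → ∃ η : ℝ, 0 < η ∧
    ∀ (n : ℕ) (t : ℕ → ℝ), Monotone t → t 0 = 0 → t n = s →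
      (∀ k, k < n → t (k + 1) - t k ≤ η) →
      ∀ i, eLpNorm (fun ω => leftSum f N n t ω i - Y ω i) 2 P ≤ ENNReal.ofReal ε

open Classical in
/-- The integral `∫₀ˢ f(u) dN(u)`, a random vector that is determined up to a null set. -/
def stochIntegral (P : Measure Ω) (f : ℝ → Matrix (Fin 4) (Fin 4) ℝ) (N : ℝ → Ω → Fin 4 → ℝ)
    (s : ℝ) : Ω → Fin 4 → ℝ :=
  if h : ∃ Y, IsStochIntegral P f N s Y then h.choose else 0

/-- `V(s) = Φ(s, 0) V(0) + ∫₀ˢ Φ(s, u) d𝒲(u)`. -/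
def gaussianProcess (c : ℝ) (P : Measure Ω) (V₀ : Ω → Fin 4 → ℝ) (W : (Fin 4 → ℤ) → ℝ≥0 → Ω → ℝ)
    (s : ℝ) (ω : Ω) : Fin 4 → ℝ :=
  corr c s 0 *ᵥ V₀ ω + stochIntegral P (fun u => corr c s u) (noise c W) s ω

/-- The limiting random vector at the stopping time,
`V(s_δ) - (V₃(s_δ) / F₃(χ(s_δ))) F(χ(s_δ))`. -/
def stoppedVector (c : ℝ) (P : Measure Ω) (V₀ : Ω → Fin 4 → ℝ) (W : (Fin 4 → ℤ) → ℝ≥0 → Ω → ℝ)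
    (δ : ℝ) (ω : Ω) : Fin 4 → ℝ :=
  gaussianProcess c P V₀ W (sDelta c δ) ω
    - (gaussianProcess c P V₀ W (sDelta c δ) ω 2 / drift (fluid c (sDelta c δ)) 2)
      • drift (fluid c (sDelta c δ))

/-- `Σ_δ`: the covariance matrix of the limiting random vector at the stopping time. -/
def stoppedCov (c : ℝ) (P : Measure Ω) (V₀ : Ω → Fin 4 → ℝ) (W : (Fin 4 → ℤ) → ℝ≥0 → Ω → ℝ)
    (δ : ℝ) : Matrix (Fin 4) (Fin 4) ℝ :=
  Matrix.of fun i j =>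
    cov[fun ω => stoppedVector c P V₀ W δ ω i, fun ω => stoppedVector c P V₀ W δ ω j; P]

end Gauss

/-! ### Asymptotic notation -/

/-- `f = Ω(g)` along `l`: there is `a > 0` with `f ≥ a |g|` eventually. -/
def IsBigOmega (l : Filter ℝ) (f g : ℝ → ℝ) : Prop := ∃ a : ℝ, 0 < a ∧ ∀ᶠ x in l, a * |g x| ≤ f x

/-- `f = Θ(g)` along `l`: both `f = O(g)` and `f = Ω(g)`. -/
def IsBigTheta (l : Filter ℝ) (f g : ℝ → ℝ) : Prop := f =O[l] g ∧ IsBigOmega l f g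

end

end KarpSipser

namespace KarpSipser

/-! ### Inverse functions -/

/-! Everything is explicit in the parameters z = z(x) and b = cβ. For each x the rates are terms of
a product of three exponential series whose parameters add up to z, so the drift has a closed form
(`Regular.drift_eq`). Along the fluid limit z = ϑ(s), and z reaches 0 exactly at s*; this is where c
≤ e enters, since it keeps χ₁ positive until then (`betaFn_mul_lt`, `sStar_eq`). Items 1 and 2
follow, because χ₃ = ϑ²/(2c) makes ϑ(s_δ) equal to √(2cδ).

In the coordinates z, B (equal to β on the fluid limit) and Y = 2x₃ the flow is integrable: z²/Y and
log B + (z²/Y)B − z are constants of motion, and the elapsed time is explicit. Differentiating the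
general solution in its constants gives a fundamental matrix M, and the differentials of the
constants are the rows of its inverse. Hence Φ(s,u) = M(s)M(u)⁻¹ (`corr_eq`). The Itô isometry turns
each diagonal entry of Σ_δ into the initial quadratic form plus an integral of quadratic forms of
the covariance density (`stoppedCov_eq`).

For the first three coordinates the proof counts powers of z. Subtracting the multiple of F removes
the time direction, and only the two constants of motion remain, with coefficients O(z(s)²)
(`exists_stopRow_vecMul_corr`). Their differentials blow up like z(u)⁻³ times a seminorm, the defect
(`exists_abs_row_le`). Steps whose rate is not O(z) leave 2x₃ − x₁ − 2x₂ unchanged, so the mean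
square of the defect is O(z) and the noise intensity is O(z(s)⁴ z(u)⁻⁵) (`exists_quad_le`). As dz/du
is of order −1/z, the integral of z(u)⁻⁵ is O(z(s)⁻³) (`integral_inv_theta_pow_le`). The noise thus
contributes O(z(s)), the initial state O(z(s)⁴), and both vanish with δ.

For the fourth coordinate, the row of Φ always has last entry 1. Three steps of positive rate
combine to the fourth unit vector, so the intensity is bounded below on the first half of the time
interval, uniformly in δ (`exists_quad_ge`). -/

theorem hasStrictDerivAt_invFunOn {f : ℝ → ℝ} {S : Set ℝ} {a f' : ℝ}
    (hf : HasStrictDerivAt f f' a) (h0 : f' ≠ 0) (hS : S ∈ 𝓝 a) (hinj : Set.InjOn f S) :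
    HasStrictDerivAt (Function.invFunOn f S) f'⁻¹ (f a) := by
  -- Only a left inverse near a is required, which injectivity on the neighbourhood S supplies; no
  -- continuity of the chosen inverse has to be known beforehand.
  refine hf.to_local_left_inverse h0 ?_
  filter_upwards [hS] with x hx
  exact hinj.leftInvOn_invFunOn hx

/-! ### The truncated Poisson mean -/

/-- `(e^z - 1)² - z² e^z`, the numerator of the derivative of `truncMean`. -/
noncomputable def discr (z : ℝ) : ℝ := (Real.exp z - 1) ^ 2 - z ^ 2 * Real.exp z

/-- Since e^z − 1 = 2e^{z/2} sinh(z/2), this is a difference of squares. -/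
theorem discr_eq (z : ℝ) :
    discr z = 4 * Real.exp z * (Real.sinh (z / 2) - z / 2) * (Real.sinh (z / 2) + z / 2) := by
  have h1 : Real.exp z = Real.exp (z / 2) ^ 2 := by rw [← Real.exp_nat_mul]; congr 1; push_cast; ring
  have h2 : Real.exp (z / 2) * Real.exp (-(z / 2)) = 1 := by rw [← Real.exp_add]; simp
  rw [discr, Real.sinh_eq, h1]
  set x := Real.exp (z / 2)
  set y := Real.exp (-(z / 2))
  have : x ^ 2 - 1 = x * (x - y) := by linear_combination h2
  rw [this]; ring

/-- The difference of the two sides has derivative 2(sinh²(x/2) − (x/2)²), which is nonnegative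
because |sinh t| ≥ |t|. -/
theorem cube_le_sinh_sub {h : ℝ} (hh : 0 ≤ h) : h ^ 3 / 6 ≤ Real.sinh h - h := by
  have hd : ∀ x : ℝ, HasDerivAt (fun x => Real.sinh x - x - x ^ 3 / 6)
      (Real.cosh x - 1 - x ^ 2 / 2) x := by
    intro x
    refine (((Real.hasDerivAt_sinh x).sub (hasDerivAt_id x)).sub
      ((hasDerivAt_pow 3 x).div_const 6)).congr_deriv ?_
    norm_num; ring
  have hm : Monotone (fun x : ℝ => Real.sinh x - x - x ^ 3 / 6) := by
    refine monotone_of_deriv_nonneg (fun x => (hd x).differentiableAt) fun x => ?_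
    rw [(hd x).deriv]
    have h1 : Real.cosh x = 1 + 2 * Real.sinh (x / 2) ^ 2 := by
      have := Real.cosh_two_mul (x / 2)
      rw [Real.cosh_sq, mul_div_cancel₀ x two_ne_zero] at this
      linarith
    have h2 : (x / 2) ^ 2 ≤ Real.sinh (x / 2) ^ 2 := by
      rw [sq_le_sq, Real.abs_sinh]
      exact Real.self_le_sinh_iff.2 (abs_nonneg _)
    linarith
  have := hm hh
  simp at this
  linarith

/-- The constant is the leading coefficient at 0. This degeneracy of order four makes the
coordinates (z, B) singular at the end of the process and fixes the powers of z in the later bounds.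
-/
theorem discr_lower {z : ℝ} (hz : 0 ≤ z) : z ^ 4 / 12 ≤ discr z := by
  have h1 := cube_le_sinh_sub (h := z / 2) (by linarith)
  rw [discr_eq]
  have h2 : (1 : ℝ) ≤ Real.exp z := Real.one_le_exp hz
  have h3 : z ≤ Real.sinh (z / 2) + z / 2 := by
    have : 0 ≤ (z / 2) ^ 3 / 6 := by positivity
    linarith
  calc z ^ 4 / 12 = 4 * 1 * ((z / 2) ^ 3 / 6) * z := by ring
    _ ≤ _ := by
      have : 0 ≤ Real.sinh (z / 2) - z / 2 := le_trans (by positivity) h1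
      gcongr

theorem discr_pos {z : ℝ} (hz : 0 < z) : 0 < discr z :=
  lt_of_lt_of_le (by positivity) (discr_lower hz.le)

theorem expTail_pos {z : ℝ} (hz : 0 < z) : 0 < expTail z := by
  have := Real.add_one_lt_exp hz.ne'
  rw [expTail]; linarith

theorem hasStrictDerivAt_truncMean {z : ℝ} (hz : 0 < z) :
    HasStrictDerivAt truncMean (discr z / expTail z ^ 2) z := by
  have h1 : HasStrictDerivAt (fun z : ℝ => z * (Real.exp z - 1) / expTail z)
      (discr z / expTail z ^ 2) z := by
    have hE : HasStrictDerivAt expTail (Real.exp z - 1) z := by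
      have := ((Real.hasStrictDerivAt_exp z).sub (hasStrictDerivAt_id z)).sub_const 1
      exact this
    refine (((hasStrictDerivAt_id z).mul ((Real.hasStrictDerivAt_exp z).sub_const 1)).div hE
      (expTail_pos hz).ne').congr_deriv ?_
    simp only [id, expTail, discr, Pi.mul_apply]
    ring
  refine h1.congr_of_eventuallyEq ?_
  filter_upwards [lt_mem_nhds hz] with x hx
  simp [truncMean, hx.ne']

/-- After clearing denominators this is (z − 2)e^z + z + 2 > 0. That function vanishes at 0 and its
derivative (z − 1)e^z + 1 is positive, because 1 − z < e^{-z}. -/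
theorem two_lt_truncMean {z : ℝ} (hz : 0 < z) : 2 < truncMean z := by
  have hd : ∀ x : ℝ, HasDerivAt (fun x => (x - 2) * Real.exp x + x + 2)
      ((x - 1) * Real.exp x + 1) x := by
    intro x
    refine (((((hasDerivAt_id x).sub_const 2).mul (Real.hasDerivAt_exp x)).add
      (hasDerivAt_id x)).add_const 2).congr_deriv ?_
    simp only [id]; ring
  have hm : StrictMonoOn (fun x : ℝ => (x - 2) * Real.exp x + x + 2) (Set.Ici 0) := by
    refine strictMonoOn_of_deriv_pos (convex_Ici 0)
      (fun x _ => (hd x).continuousAt.continuousWithinAt) fun x hx => ?_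
    rw [interior_Ici] at hx
    rw [(hd x).deriv]
    have h1 := Real.add_one_lt_exp (x := -x) (by simpa using (ne_of_gt hx))
    have h2 : Real.exp (-x) * Real.exp x = 1 := by rw [← Real.exp_add]; simp
    nlinarith [Real.exp_pos x]
  have := hm Set.self_mem_Ici hz.le hz
  simp at this
  rw [truncMean, if_neg hz.ne', lt_div_iff₀ (expTail_pos hz), expTail]
  nlinarith

/-- Monotonicity is needed only on the open half-line: the value 2 at the endpoint lies strictly
below all others, so continuity at 0 plays no role. -/
theorem injOn_truncMean : Set.InjOn truncMean (Set.Ici 0) := by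
  have hm : StrictMonoOn truncMean (Set.Ioi 0) := by
    refine strictMonoOn_of_deriv_pos (convex_Ioi 0)
      (fun x hx => (hasStrictDerivAt_truncMean hx).hasDerivAt.continuousAt.continuousWithinAt)
      fun x hx => ?_
    rw [interior_Ioi] at hx
    rw [(hasStrictDerivAt_truncMean hx).hasDerivAt.deriv]
    exact div_pos (discr_pos hx) (pow_pos (expTail_pos hx) 2)
  have h0 : truncMean 0 = 2 := by simp [truncMean]
  intro x hx y hy hxy
  rcases eq_or_lt_of_le (Set.mem_Ici.1 hx) with rfl | hx'
  · rcases eq_or_lt_of_le (Set.mem_Ici.1 hy) with rfl | hy'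
    · rfl
    · have := two_lt_truncMean hy'
      linarith
  · rcases eq_or_lt_of_le (Set.mem_Ici.1 hy) with rfl | hy'
    · have := two_lt_truncMean hx'
      linarith
    · exact hm.injOn hx' hy' hxy

/-- The inverse of `truncMean`. -/
noncomputable def invMean (q : ℝ) : ℝ := Function.invFunOn truncMean (Set.Ici 0) q

theorem invMean_truncMean {z : ℝ} (hz : 0 ≤ z) : invMean (truncMean z) = z :=
  injOn_truncMean.leftInvOn_invFunOn hz

theorem hasStrictDerivAt_invMean {z : ℝ} (hz : 0 < z) :
    HasStrictDerivAt invMean (expTail z ^ 2 / discr z) (truncMean z) := by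
  have := hasStrictDerivAt_invFunOn (hasStrictDerivAt_truncMean hz)
    (div_pos (discr_pos hz) (pow_pos (expTail_pos hz) 2)).ne' (Ici_mem_nhds hz) injOn_truncMean
  rwa [inv_div] at this

/-- Every value near `truncMean z` is attained, so that `invMean` is a right inverse there. -/
theorem eventually_truncMean_invMean {z : ℝ} (hz : 0 < z) :
    ∀ᶠ q in 𝓝 (truncMean z), 0 < invMean q ∧ truncMean (invMean q) = q := by
  have hd := hasStrictDerivAt_truncMean hz
  have h0 := (div_pos (discr_pos hz) (pow_pos (expTail_pos hz) 2)).ne'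
  have hmap := hd.map_nhds_eq h0
  rw [← hmap, eventually_map]
  filter_upwards [lt_mem_nhds hz] with x hx
  rw [invMean_truncMean hx.le]
  exact ⟨hx, rfl⟩

/-! ### The function `β` -/

section Beta

variable {c : ℝ}

theorem hasStrictDerivAt_mul_exp (c b : ℝ) :
    HasStrictDerivAt (fun b : ℝ => b * Real.exp (c * b))
      (Real.exp (c * b) * (1 + c * b)) b := by
  have h := ((hasStrictDerivAt_id b).const_mul c).exp
  refine ((hasStrictDerivAt_id b).mul h).congr_deriv ?_
  simp only [id]; ring

theorem mul_exp_injOn (hc : 0 < c) :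
    Set.InjOn (fun b : ℝ => b * Real.exp (c * b)) (Set.Ioi 0) := by
  have hm : StrictMonoOn (fun b : ℝ => b * Real.exp (c * b)) (Set.Ioi 0) := by
    intro x hx y hy hxy
    have hx' : 0 < x := hx
    have : Real.exp (c * x) < Real.exp (c * y) := Real.exp_lt_exp.2 (by gcongr)
    exact mul_lt_mul'' hxy this hx'.le (Real.exp_pos _).le
  exact hm.injOn

theorem betaFn_spec (hc : 0 < c) (u : ℝ) :
    betaFn c u * Real.exp (c * betaFn c u) = Real.exp u := by
  refine Function.invFun_eq (f := fun b : ℝ => b * Real.exp (c * b)) ?_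
  have hcont : ContinuousOn (fun b : ℝ => b * Real.exp (c * b)) (Set.Icc 0 (Real.exp u)) := by
    fun_prop
  have h1 : (1 : ℝ) ≤ Real.exp (c * Real.exp u) := Real.one_le_exp (by positivity)
  have := intermediate_value_Icc (Real.exp_pos u).le hcont
    (show Real.exp u ∈ Set.Icc _ _ from ⟨by simp [(Real.exp_pos u).le], by
      nlinarith [Real.exp_pos u]⟩)
  obtain ⟨b, -, hb⟩ := this
  exact ⟨b, hb⟩

/-- `Function.invFun` chooses among all real preimages, and b e^{cb} is not injective on the
negative axis. A preimage of e^u > 0 is necessarily positive, so no ambiguity remains. -/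
theorem betaFn_pos (hc : 0 < c) (u : ℝ) : 0 < betaFn c u := by
  have := betaFn_spec hc u
  have h2 := Real.exp_pos u
  rw [← this] at h2
  exact pos_of_mul_pos_left h2 (Real.exp_pos _).le

theorem log_betaFn (hc : 0 < c) (u : ℝ) : Real.log (betaFn c u) = u - c * betaFn c u := by
  have := congrArg Real.log (betaFn_spec hc u)
  rw [Real.log_mul (betaFn_pos hc u).ne' (Real.exp_pos _).ne', Real.log_exp, Real.log_exp] at this
  linarith

theorem betaFn_eq (hc : 0 < c) {u b : ℝ} (hb : 0 < b) (h : b * Real.exp (c * b) = Real.exp u) :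
    betaFn c u = b :=
  mul_exp_injOn hc (betaFn_pos hc u) hb ((betaFn_spec hc u).trans h.symm)

theorem betaFn_self (hc : 0 < c) : betaFn c c = 1 := betaFn_eq hc one_pos (by simp)

theorem hasStrictDerivAt_betaFn (hc : 0 < c) (u : ℝ) :
    HasStrictDerivAt (betaFn c) (betaFn c u / (1 + c * betaFn c u)) u := by
  have hb := betaFn_pos hc u
  have hpos : 0 < 1 + c * betaFn c u := by positivity
  have h1 : HasStrictDerivAt (Function.invFun (fun b : ℝ => b * Real.exp (c * b)))
      (Real.exp (c * betaFn c u) * (1 + c * betaFn c u))⁻¹ (Real.exp u) := by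
    rw [← betaFn_spec hc u]
    refine (hasStrictDerivAt_mul_exp c (betaFn c u)).to_local_left_inverse (by positivity) ?_
    filter_upwards [lt_mem_nhds hb] with x hx
    have hx' : 0 < x * Real.exp (c * x) := by positivity
    have := betaFn_eq hc (u := Real.log (x * Real.exp (c * x))) hx (by rw [Real.exp_log hx'])
    rwa [betaFn, Real.exp_log hx'] at this
  have h2 := h1.comp u (Real.hasStrictDerivAt_exp u)
  have h3 : HasStrictDerivAt (betaFn c) _ u := h2
  refine h3.congr_deriv ?_
  rw [← betaFn_spec hc u]
  have := Real.exp_pos (c * betaFn c u)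
  field_simp

theorem monotone_betaFn (hc : 0 < c) : Monotone (betaFn c) := by
  refine monotone_of_deriv_nonneg
    (fun u => (hasStrictDerivAt_betaFn hc u).hasDerivAt.differentiableAt) fun u => ?_
  rw [(hasStrictDerivAt_betaFn hc u).hasDerivAt.deriv]
  have := betaFn_pos hc u
  positivity

theorem betaFn_le_one (hc : 0 < c) {u : ℝ} (hu : u ≤ c) : betaFn c u ≤ 1 :=
  (monotone_betaFn hc hu).trans_eq (betaFn_self hc)

/-! ### Time and the parameter `ϑ` -/

theorem timeOf_eq (hc : 0 < c) (u : ℝ) :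
    timeOf c u = 1 / c * (c * (1 - betaFn c u) - 1 / 2 * (u - c * betaFn c u) ^ 2) := by
  rw [timeOf, log_betaFn hc]

/-- With log β = u − cβ substituted, the terms in β cancel from the numerator. The zero at u = 0 is
why ϑ reaches 0 with infinite slope. -/
theorem hasStrictDerivAt_timeOf (hc : 0 < c) (u : ℝ) :
    HasStrictDerivAt (timeOf c) (-u / (c * (1 + c * betaFn c u))) u := by
  have h := hasStrictDerivAt_betaFn hc u
  have hb := betaFn_pos hc u
  have hpos : 0 < 1 + c * betaFn c u := by positivity
  have h1 : HasStrictDerivAt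
      (fun u => 1 / c * (c * (1 - betaFn c u) - 1 / 2 * (u - c * betaFn c u) ^ 2)) _ u :=
    (((h.const_sub 1).const_mul c).sub
      ((((hasStrictDerivAt_id u).sub (h.const_mul c)).pow 2).const_mul (1 / 2))).const_mul (1 / c)
  rw [← funext (timeOf_eq hc)] at h1
  refine h1.congr_deriv ?_
  simp only [id, Pi.sub_apply, Nat.cast_ofNat]
  field_simp
  ring

theorem timeOf_self (hc : 0 < c) : timeOf c c = 0 := by
  rw [timeOf_eq hc, betaFn_self hc]; ring

theorem continuous_timeOf (hc : 0 < c) : Continuous (timeOf c) :=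
  continuous_iff_continuousAt.2 fun u => (hasStrictDerivAt_timeOf hc u).hasDerivAt.continuousAt

theorem strictAntiOn_timeOf (hc : 0 < c) : StrictAntiOn (timeOf c) (Set.Ici 0) := by
  refine strictAntiOn_of_deriv_neg (convex_Ici 0) (continuous_timeOf hc).continuousOn fun u hu => ?_
  rw [interior_Ici] at hu
  have hu' : 0 < u := hu
  rw [(hasStrictDerivAt_timeOf hc u).hasDerivAt.deriv, neg_div, neg_lt_zero]
  have := betaFn_pos hc u
  positivity

theorem theta_timeOf (hc : 0 < c) {u : ℝ} (hu : 0 ≤ u) : theta c (timeOf c u) = u :=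
  (strictAntiOn_timeOf hc).injOn.leftInvOn_invFunOn hu

theorem timeOf_zero_pos (hc : 0 < c) : 0 < timeOf c 0 := by
  have := strictAntiOn_timeOf hc Set.self_mem_Ici hc.le hc
  rwa [timeOf_self hc] at this

theorem exists_timeOf_eq (hc : 0 < c) {s : ℝ} (h0 : 0 ≤ s) (h1 : s ≤ timeOf c 0) :
    ∃ u, 0 ≤ u ∧ u ≤ c ∧ timeOf c u = s := by
  have := intermediate_value_Icc' hc.le (continuous_timeOf hc).continuousOn
    (show s ∈ Set.Icc (timeOf c c) (timeOf c 0) from ⟨by rwa [timeOf_self hc], h1⟩)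
  obtain ⟨u, hu, h⟩ := this
  exact ⟨u, hu.1, hu.2, h⟩

theorem timeOf_theta (hc : 0 < c) {s : ℝ} (h0 : 0 ≤ s) (h1 : s ≤ timeOf c 0) :
    timeOf c (theta c s) = s := by
  obtain ⟨u, hu, -, rfl⟩ := exists_timeOf_eq hc h0 h1
  rw [theta_timeOf hc hu]

theorem theta_le (hc : 0 < c) {s : ℝ} (h0 : 0 ≤ s) (h1 : s ≤ timeOf c 0) : theta c s ≤ c := by
  obtain ⟨u, hu, hu', rfl⟩ := exists_timeOf_eq hc h0 h1
  rwa [theta_timeOf hc hu]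

theorem theta_pos (hc : 0 < c) {s : ℝ} (h0 : 0 ≤ s) (h1 : s < timeOf c 0) : 0 < theta c s := by
  obtain ⟨u, hu, hu', rfl⟩ := exists_timeOf_eq hc h0 h1.le
  rw [theta_timeOf hc hu]
  rcases hu.eq_or_lt with rfl | h
  · exact absurd h1 (lt_irrefl _)
  · exact h

theorem hasDerivAt_theta (hc : 0 < c) {s : ℝ} (h0 : 0 ≤ s) (h1 : s < timeOf c 0) :
    HasDerivAt (theta c) (-(c * (1 + c * betaFn c (theta c s))) / theta c s) s := by
  have hz := theta_pos hc h0 h1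
  have hb := betaFn_pos hc (theta c s)
  have hpos : 0 < 1 + c * betaFn c (theta c s) := by positivity
  have h := hasStrictDerivAt_invFunOn (hasStrictDerivAt_timeOf hc (theta c s))
    (by
      rw [neg_div, neg_ne_zero]
      positivity) (Ici_mem_nhds hz) (strictAntiOn_timeOf hc).injOn
  rw [timeOf_theta hc h0 h1.le] at h
  refine h.hasDerivAt.congr_deriv ?_
  rw [inv_div, neg_div, div_neg]

theorem antitone_theta (hc : 0 < c) {s t : ℝ} (h0 : 0 ≤ s) (hst : s ≤ t) (h1 : t ≤ timeOf c 0) :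
    theta c t ≤ theta c s := by
  obtain ⟨u, hu, -, rfl⟩ := exists_timeOf_eq hc h0 (hst.trans h1)
  obtain ⟨v, hv, -, rfl⟩ := exists_timeOf_eq hc (h0.trans hst) h1
  rw [theta_timeOf hc hu, theta_timeOf hc hv]
  exact (strictAntiOn_timeOf hc).le_iff_ge hu hv |>.1 hst

theorem fluid_two (c s : ℝ) : fluid c s 2 = 1 / (2 * c) * theta c s ^ 2 := rfl

/-! ### Positivity of χ₁ and the times s* and s_δ. -/

theorem tendsto_div_exp_sub_one :
    Tendsto (fun z : ℝ => z / (Real.exp z - 1)) (𝓝[>] 0) (𝓝 1) := by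
  have h := (Real.hasDerivAt_exp 0).tendsto_slope_zero_right
  simp only [zero_add, Real.exp_zero, smul_eq_mul] at h
  simpa [div_eq_mul_inv, mul_comm] using h.inv₀ one_ne_zero

/-- The right side tends to 1 at 0 and has derivative `discr x / (x * (exp x - 1) ^ 2)`, which is
positive. -/
theorem one_lt_log_add {z : ℝ} (hz : 0 < z) :
    1 < Real.log (z / (Real.exp z - 1)) + z + z / (Real.exp z - 1) := by
  set g : ℝ → ℝ := fun z => Real.log (z / (Real.exp z - 1)) + z + z / (Real.exp z - 1) with hg
  have hE : ∀ {x : ℝ}, 0 < x → 0 < Real.exp x - 1 := fun hx => by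
    have := Real.add_one_lt_exp hx.ne'
    linarith
  have hd : ∀ {x : ℝ}, 0 < x → HasDerivAt g (discr x / (x * (Real.exp x - 1) ^ 2)) x := by
    intro x hx
    have h1 := (hasDerivAt_id x).div ((Real.hasDerivAt_exp x).sub_const 1) (hE hx).ne'
    have h2 := (h1.log (div_pos hx (hE hx)).ne')
    refine ((h2.add (hasDerivAt_id x)).add h1).congr_deriv ?_
    have := (hE hx).ne'
    simp only [id, discr, Pi.div_apply]
    field_simp
    ring
  have hm : StrictMonoOn g (Set.Ioi 0) := by
    refine strictMonoOn_of_deriv_pos (convex_Ioi 0)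
      (fun x hx => (hd hx).continuousAt.continuousWithinAt) fun x hx => ?_
    rw [interior_Ioi] at hx
    rw [(hd hx).deriv]
    exact div_pos (discr_pos hx) (mul_pos hx (pow_pos (hE hx) 2))
  have hlim : Tendsto g (𝓝[>] 0) (𝓝 1) := by
    have h1 := tendsto_div_exp_sub_one
    have h2 : Tendsto (fun z : ℝ => z) (𝓝[>] 0) (𝓝 0) := tendsto_id.mono_left nhdsWithin_le_nhds
    simpa using ((h1.log one_ne_zero).add h2).add h1
  -- The limit at 0 gives only a weak inequality; strictness comes from the intermediate point z/2.
  have hhalf : 1 ≤ g (z / 2) := by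
    refine le_of_tendsto hlim ?_
    filter_upwards [Ioo_mem_nhdsGT (half_pos hz)] with x hx
    exact (hm hx.1 (half_pos hz) hx.2).le
  exact hhalf.trans_lt (hm (half_pos hz) hz (half_lt_self hz))

/-- Put m = z e^z/(e^z − 1), so that the claim is cβ < m. The quantity cβ satisfies log y + y = log
c + z ≤ 1 + z, while log m + m > 1 + z by `one_lt_log_add`; monotonicity of log y + y decides. This
is where c ≤ e is needed. -/
theorem betaFn_mul_lt (hc : 0 < c) (hce : c ≤ Real.exp 1) {z : ℝ} (hz : 0 < z) :
    c * betaFn c z * (1 - Real.exp (-z)) < z := by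
  have hE : 0 < Real.exp z - 1 := by
    have := Real.add_one_lt_exp hz.ne'
    linarith
  have hm0 : 0 < z * Real.exp z / (Real.exp z - 1) := by positivity
  have hb := betaFn_pos hc z
  have hlogc : Real.log c ≤ 1 := by
    rw [← Real.log_exp 1]; exact Real.log_le_log hc hce
  have hlb : Real.log (c * betaFn c z) + c * betaFn c z = Real.log c + z := by
    rw [Real.log_mul hc.ne' hb.ne', log_betaFn hc]; ring
  have hlm : Real.log (z * Real.exp z / (Real.exp z - 1))
      = Real.log (z / (Real.exp z - 1)) + z := by
    rw [mul_div_right_comm, Real.log_mul (by positivity) (Real.exp_pos _).ne', Real.log_exp]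
  have hm1 : z * Real.exp z / (Real.exp z - 1) = z + z / (Real.exp z - 1) := by
    field_simp; ring
  have hlt : c * betaFn c z < z * Real.exp z / (Real.exp z - 1) := by
    by_contra hcon
    push Not at hcon
    have := Real.log_le_log hm0 hcon
    have := one_lt_log_add hz
    linarith
  rw [lt_div_iff₀ hE] at hlt
  rw [Real.exp_neg]
  have := Real.exp_pos z
  have h1 : c * betaFn c z * (1 - (Real.exp z)⁻¹)
      = c * betaFn c z * (Real.exp z - 1) / Real.exp z := by field_simp
  rw [h1, div_lt_iff₀ this]
  exact hlt

theorem fluid_zero (c s : ℝ) : fluid c s 0 = 1 / c * (theta c s ^ 2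
    - theta c s * c * betaFn c (theta c s) * (1 - Real.exp (-theta c s))) := rfl

theorem fluid_one (c s : ℝ) : fluid c s 1
    = Real.exp (-theta c s) * expTail (theta c s) * betaFn c (theta c s) := rfl

theorem fluid_zero_pos (hc : 0 < c) (hce : c ≤ Real.exp 1) {s : ℝ} (h0 : 0 ≤ s)
    (h1 : s < timeOf c 0) : 0 < fluid c s 0 := by
  have hz := theta_pos hc h0 h1
  have := betaFn_mul_lt hc hce hz
  rw [fluid_zero]
  refine mul_pos (by positivity) ?_
  nlinarith

/-- χ₁ vanishes when ϑ = 0 and is positive before, so the infimum is attained; the meaningless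
values of `theta` beyond that time do not affect it. -/
theorem sStar_eq (hc : 0 < c) (hce : c ≤ Real.exp 1) : sStar c = timeOf c 0 := by
  refine IsLeast.csInf_eq ⟨⟨(timeOf_zero_pos hc).le, ?_⟩, ?_⟩
  · rw [fluid_zero, theta_timeOf hc le_rfl]; simp
  · rintro s ⟨h0, h1⟩
    by_contra hlt
    exact (fluid_zero_pos hc hce h0 (not_le.1 hlt)).ne' h1

/-- χ₃ ≤ δ means ϑ ≤ √(2cδ), and ϑ decreases in time. The condition 2δ ≤ c keeps the threshold below
c, the value of ϑ at time 0. -/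
theorem sDelta_eq (hc : 0 < c) {δ : ℝ} (hδ : 0 ≤ δ) (hδc : 2 * δ ≤ c) :
    sDelta c δ = timeOf c (Real.sqrt (2 * c * δ)) := by
  have hs := Real.sqrt_nonneg (2 * c * δ)
  have hsq : Real.sqrt (2 * c * δ) ^ 2 = 2 * c * δ := Real.sq_sqrt (by positivity)
  have hle : Real.sqrt (2 * c * δ) ≤ c := by
    rw [Real.sqrt_le_left hc.le]; nlinarith
  have hanti := (strictAntiOn_timeOf hc).antitoneOn
  refine IsLeast.csInf_eq ⟨⟨?_, ?_⟩, ?_⟩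
  · rw [← timeOf_self hc]
    exact hanti hs hc.le hle
  · rw [fluid_two, theta_timeOf hc hs, hsq]
    apply le_of_eq; field_simp
  · rintro s ⟨hs0, hs1⟩
    by_contra hlt
    push Not at hlt
    have hT : s ≤ timeOf c 0 := hlt.le.trans (hanti Set.self_mem_Ici hs hs)
    obtain ⟨u, hu, -, rfl⟩ := exists_timeOf_eq hc hs0 hT
    rw [fluid_two, theta_timeOf hc hu] at hs1
    have h2 : u ^ 2 ≤ 2 * c * δ := by
      have := mul_le_mul_of_nonneg_left hs1 (show 0 ≤ 2 * c by positivity)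
      rwa [show 2 * c * (1 / (2 * c) * u ^ 2) = u ^ 2 by field_simp] at this
    have h3 : u ≤ Real.sqrt (2 * c * δ) := Real.le_sqrt_of_sq_le h2
    exact absurd (hanti hu hs h3) (not_le.2 hlt)

end Beta

/-! ### Summation over the steps -/

/-- The special step of `β_{(-2,0,-1,1)}` is labelled by `(0, 0, 0)`, the step with indices
`(k₁, k₂, k₃)` is labelled by `(k₁ - 1, k₂, k₃)`. -/
def label (j : ℕ × ℕ × ℕ) : Fin 4 → ℤ :=
  if j = 0 then ![-2, 0, -1, 1] else step (j.1 + 1, j.2.1, j.2.2)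

theorem label_zero : label 0 = ![-2, 0, -1, 1] := if_pos rfl

theorem label_of_ne {j : ℕ × ℕ × ℕ} (hj : j ≠ 0) : label j = step (j.1 + 1, j.2.1, j.2.2) :=
  if_neg hj

theorem mem_stepIndex {j : ℕ × ℕ × ℕ} (hj : j ≠ 0) : (j.1 + 1, j.2.1, j.2.2) ∈ stepIndex := by
  obtain ⟨a, b, d⟩ := j
  simp only [ne_eq, Prod.mk_eq_zero, not_and] at hj
  simp only [stepIndex, Set.mem_ofPred_eq]
  omega

theorem step_ne_special (k : ℕ × ℕ × ℕ) : step k ≠ ![-2, 0, -1, 1] := by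
  intro h
  have := congrFun h 1
  simp [step] at this
  omega

theorem label_injective : Function.Injective label := by
  intro i j hij
  by_cases hi : i = 0 <;> by_cases hj : j = 0
  · rw [hi, hj]
  · rw [hi, label_zero, label_of_ne hj] at hij
    exact absurd hij.symm (step_ne_special _)
  · rw [hj, label_zero, label_of_ne hi] at hij
    exact absurd hij (step_ne_special _)
  · rw [label_of_ne hi, label_of_ne hj] at hij
    have := step_injective hij
    obtain ⟨a, b, d⟩ := i
    obtain ⟨a', b', d'⟩ := j
    simpa using this

theorem rate_of_notMem_range {l : Fin 4 → ℤ} (hl : l ∉ Set.range label) (x : Fin 4 → ℝ) :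
    rate l x = 0 := by
  have h1 : l ≠ ![-2, 0, -1, 1] := fun h => hl ⟨0, label_zero.trans h.symm⟩
  have h2 : ¬ ∃ k, k ∈ stepIndex ∧ step k = l := by
    rintro ⟨⟨k₁, k₂, k₃⟩, hk, rfl⟩
    refine hl ⟨(k₁ - 1, k₂, k₃), ?_⟩
    simp only [stepIndex, Set.mem_ofPred_eq] at hk
    have hne : ((k₁ - 1, k₂, k₃) : ℕ × ℕ × ℕ) ≠ 0 := by
      simp only [ne_eq, Prod.mk_eq_zero, not_and]
      omega
    rw [label_of_ne hne]
    simp only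
    rw [Nat.sub_add_cancel hk.1]
  rw [rate, if_neg h1, dif_neg h2]

theorem rate_label_zero (x : Fin 4 → ℝ) : rate (label 0) x = x 0 / (2 * x 2) := by
  rw [label_zero, rate, if_pos rfl]

theorem rate_label {j : ℕ × ℕ × ℕ} (hj : j ≠ 0) (x : Fin 4 → ℝ) :
    rate (label j) x = stepRate (j.1 + 1, j.2.1, j.2.2) x := by
  rw [label_of_ne hj, rate_step (mem_stepIndex hj)]

/-- Replaces sums over ℤ⁴, where the rates vanish off the labels, by sums over triples of naturals,
where they factorise. -/
theorem hasSum_rate_iff (x : Fin 4 → ℝ) (g : (Fin 4 → ℤ) → ℝ) (S : ℝ) :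
    HasSum (fun j => rate (label j) x * g (label j)) S ↔ HasSum (fun l => rate l x * g l) S :=
  label_injective.hasSum_iff (f := fun l => rate l x * g l) fun l hl => by
    rw [rate_of_notMem_range hl, zero_mul]

/-! ### Moments of products of exponential series -/

/-- `q₁^m q₂^{k₂} q₃^{k₃} / (m! k₂! k₃!)`. -/
noncomputable def expTerm (q₁ q₂ q₃ : ℝ) (j : ℕ × ℕ × ℕ) : ℝ :=
  q₁ ^ j.1 / j.1.factorial * (q₂ ^ j.2.1 / j.2.1.factorial * (q₃ ^ j.2.2 / j.2.2.factorial))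

theorem hasSum_triple {a b d : ℕ → ℝ} {A B D : ℝ} (ha : HasSum a A) (hb : HasSum b B)
    (hd : HasSum d D) :
    HasSum (fun j : ℕ × ℕ × ℕ => a j.1 * (b j.2.1 * d j.2.2)) (A * (B * D)) := by
  have h := hb.mul hd (summable_mul_of_summable_norm hb.summable.norm hd.summable.norm)
  exact ha.mul h (summable_mul_of_summable_norm ha.summable.norm h.summable.norm)

theorem hasSum_pow_div_factorial (q : ℝ) :
    HasSum (fun n : ℕ => q ^ n / n.factorial) (Real.exp q) := by
  have := NormedSpace.expSeries_div_hasSum_exp (q : ℝ)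
  rwa [← Real.exp_eq_exp_ℝ] at this

theorem hasSum_mul_pow_div_factorial (q : ℝ) :
    HasSum (fun n : ℕ => n * (q ^ n / n.factorial)) (q * Real.exp q) := by
  have h := (hasSum_pow_div_factorial q).mul_left q
  rw [← hasSum_nat_add_iff' 1]
  simp only [Finset.range_one, Finset.sum_singleton, Nat.cast_zero, zero_mul, sub_zero]
  refine h.congr_fun fun n => ?_
  rw [Nat.factorial_succ]
  push_cast
  field_simp
  ring

theorem hasSum_expTerm (q₁ q₂ q₃ : ℝ) :
    HasSum (expTerm q₁ q₂ q₃) (Real.exp (q₁ + q₂ + q₃)) := by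
  have := hasSum_triple (hasSum_pow_div_factorial q₁) (hasSum_pow_div_factorial q₂)
    (hasSum_pow_div_factorial q₃)
  rwa [← Real.exp_add, ← Real.exp_add, ← add_assoc] at this

theorem hasSum_fst_mul_expTerm (q₁ q₂ q₃ : ℝ) :
    HasSum (fun j => j.1 * expTerm q₁ q₂ q₃ j) (q₁ * Real.exp (q₁ + q₂ + q₃)) := by
  have := hasSum_triple (hasSum_mul_pow_div_factorial q₁) (hasSum_pow_div_factorial q₂)
    (hasSum_pow_div_factorial q₃)
  rw [← Real.exp_add, mul_assoc, ← Real.exp_add, ← add_assoc] at this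
  exact this.congr_fun fun j => by rw [expTerm]; ring

theorem hasSum_snd_mul_expTerm (q₁ q₂ q₃ : ℝ) :
    HasSum (fun j => j.2.1 * expTerm q₁ q₂ q₃ j) (q₂ * Real.exp (q₁ + q₂ + q₃)) := by
  have := hasSum_triple (hasSum_pow_div_factorial q₁) (hasSum_mul_pow_div_factorial q₂)
    (hasSum_pow_div_factorial q₃)
  rw [mul_assoc, ← Real.exp_add, mul_left_comm, ← Real.exp_add, ← add_assoc] at this
  exact this.congr_fun fun j => by rw [expTerm]; ring

theorem hasSum_trd_mul_expTerm (q₁ q₂ q₃ : ℝ) :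
    HasSum (fun j => j.2.2 * expTerm q₁ q₂ q₃ j) (q₃ * Real.exp (q₁ + q₂ + q₃)) := by
  have := hasSum_triple (hasSum_pow_div_factorial q₁) (hasSum_pow_div_factorial q₂)
    (hasSum_mul_pow_div_factorial q₃)
  rw [mul_left_comm (Real.exp q₂), ← Real.exp_add, mul_left_comm, ← Real.exp_add,
    ← add_assoc] at this
  exact this.congr_fun fun j => by rw [expTerm]; ring

/-- Sums of a linear expression in the labels against the exponential weights, with the term at
the label `0` replaced by `v`. -/
theorem hasSum_linear_update {q₁ q₂ q₃ w v α β γ κ : ℝ} {f : ℕ × ℕ × ℕ → ℝ} (h0 : f 0 = v)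
    (hf : ∀ j, j ≠ 0 → f j = w * expTerm q₁ q₂ q₃ j * (α + β * j.1 + γ * j.2.1 + κ * j.2.2)) :
    HasSum f (w * Real.exp (q₁ + q₂ + q₃) * (α + β * q₁ + γ * q₂ + κ * q₃) + (v - w * α)) := by
  -- At the label 0 the exponential weight is 1, so the series contributes w·α there; the last
  -- summand exchanges this for v.
  have h := ((((hasSum_expTerm q₁ q₂ q₃).mul_left α).add
    ((hasSum_fst_mul_expTerm q₁ q₂ q₃).mul_left β)).add
    ((hasSum_snd_mul_expTerm q₁ q₂ q₃).mul_left γ)).add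
    ((hasSum_trd_mul_expTerm q₁ q₂ q₃).mul_left κ) |>.mul_left w |>.add
    (hasSum_ite_eq (0 : ℕ × ℕ × ℕ) (v - w * α))
  have hS : w * Real.exp (q₁ + q₂ + q₃) * (α + β * q₁ + γ * q₂ + κ * q₃) + (v - w * α)
      = w * (α * Real.exp (q₁ + q₂ + q₃) + β * (q₁ * Real.exp (q₁ + q₂ + q₃))
        + γ * (q₂ * Real.exp (q₁ + q₂ + q₃)) + κ * (q₃ * Real.exp (q₁ + q₂ + q₃)))
        + (v - w * α) := by ring
  rw [hS]
  refine h.congr_fun fun j => ?_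
  by_cases hj : j = 0
  · subst hj
    simp [h0, expTerm]
  · rw [hf j hj, if_neg hj]
    ring

/-! ### The drift in closed form -/

/-- The parameter `a(x) = x₂ z e^z / (2 x₃ (e^z - z - 1))`. -/
noncomputable def aOf (x : Fin 4 → ℝ) : ℝ :=
  x 1 / (2 * x 2) * (zParam x * Real.exp (zParam x) / expTail (zParam x))

/-- The drift in terms of `z(x)` and `a(x)`. -/
noncomputable def driftForm (z a : ℝ) : Fin 4 → ℝ :=
  ![-1 - (1 + a * z) * (1 - a * (1 - Real.exp (-z))) + a ^ 2 * z ^ 2 * Real.exp (-z),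
    -(a * (1 - Real.exp (-z))) - a ^ 2 * z ^ 2 * Real.exp (-z),
    -1 - a * z,
    1]

/-- Points at which the drift is given by `driftForm`. -/
structure Regular (x : Fin 4 → ℝ) : Prop where
  pos_one : 0 < x 1
  pos_two : 0 < x 2
  zParam_pos : 0 < zParam x
  truncMean_zParam : truncMean (zParam x) = (2 * x 2 - x 0) / x 1

theorem zParam_eq (x : Fin 4 → ℝ) : zParam x = invMean ((2 * x 2 - x 0) / x 1) := rfl

/-- `x₂ / (2 x₃ (e^z - z - 1))`. -/
noncomputable def kappa (x : Fin 4 → ℝ) : ℝ := x 1 / (2 * x 2 * expTail (zParam x))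

/-- This is the defining equation of z(x) divided by 2x₃; it eliminates x₁ from the rates. -/
theorem Regular.div_eq {x : Fin 4 → ℝ} (hx : Regular x) :
    x 0 / (2 * x 2) = 1 - kappa x * zParam x * (Real.exp (zParam x) - 1) := by
  have h := hx.truncMean_zParam
  have h1 := hx.pos_one.ne'
  have h2 := hx.pos_two.ne'
  have hf := (expTail_pos hx.zParam_pos).ne'
  rw [truncMean, if_neg hx.zParam_pos.ne'] at h
  rw [kappa]
  field_simp at h ⊢
  linarith

theorem Regular.aOf_eq {x : Fin 4 → ℝ} (hx : Regular x) :
    aOf x = kappa x * zParam x * Real.exp (zParam x) := by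
  have h2 := hx.pos_two.ne'
  have hf := (expTail_pos hx.zParam_pos).ne'
  rw [aOf, kappa]
  field_simp

theorem Regular.rate_label {x : Fin 4 → ℝ} (hx : Regular x) {j : ℕ × ℕ × ℕ} (hj : j ≠ 0) :
    rate (label j) x = kappa x * zParam x * expTerm (x 0 / (2 * x 2) * zParam x)
      (kappa x * zParam x ^ 2 * zParam x)
      (kappa x * zParam x * expTail (zParam x) * zParam x) j := by
  have h2 := hx.pos_two.ne'
  have hf := (expTail_pos hx.zParam_pos).ne'
  rw [KarpSipser.rate_label hj, stepRate, expTerm]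
  have e1 : x 1 * zParam x ^ 2 / (2 * x 2 * expTail (zParam x)) = kappa x * zParam x ^ 2 := by
    rw [kappa]; ring
  have e2 : x 1 * zParam x / (2 * x 2) = kappa x * zParam x * expTail (zParam x) := by
    rw [kappa]; field_simp
  have e3 : x 1 / (2 * x 2) * (zParam x / expTail (zParam x)) = kappa x * zParam x := by
    rw [kappa]; field_simp
  simp only [Nat.add_sub_cancel]
  rw [e1, e2, mul_assoc (1 / _) (x 1 / (2 * x 2)), e3]
  have f1 : (j.1.factorial : ℝ) ≠ 0 := by positivity
  have f2 : (j.2.1.factorial : ℝ) ≠ 0 := by positivity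
  have f3 : (j.2.2.factorial : ℝ) ≠ 0 := by positivity
  field_simp

/-- The three exponential parameters add up to z, which collapses every moment sum to a multiple of
e^z. -/
theorem Regular.sum_eq {x : Fin 4 → ℝ} (hx : Regular x) :
    x 0 / (2 * x 2) * zParam x + kappa x * zParam x ^ 2 * zParam x
      + kappa x * zParam x * expTail (zParam x) * zParam x = zParam x := by
  rw [hx.div_eq, expTail]; ring

/-- The sum of a linear expression in the steps against the rates. -/
theorem Regular.hasSum_rate {x : Fin 4 → ℝ} (hx : Regular x) {g : (Fin 4 → ℤ) → ℝ}
    {α β γ κ v S : ℝ} (h0 : g (label 0) = v)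
    (hg : ∀ j, j ≠ 0 → g (label j) = α + β * j.1 + γ * j.2.1 + κ * j.2.2)
    (hS : S = kappa x * zParam x * Real.exp (zParam x) * (α + β * (x 0 / (2 * x 2) * zParam x)
      + γ * (kappa x * zParam x ^ 2 * zParam x)
      + κ * (kappa x * zParam x * expTail (zParam x) * zParam x))
      + (x 0 / (2 * x 2) * v - kappa x * zParam x * α)) :
    HasSum (fun l => rate l x * g l) S := by
  have h := hasSum_linear_update (f := fun j => rate (label j) x * g (label j))
    (q₁ := x 0 / (2 * x 2) * zParam x) (q₂ := kappa x * zParam x ^ 2 * zParam x)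
    (q₃ := kappa x * zParam x * expTail (zParam x) * zParam x) (w := kappa x * zParam x)
    (v := x 0 / (2 * x 2) * v) (α := α) (β := β) (γ := γ) (κ := κ)
    (by rw [h0, rate_label_zero])
    (fun j hj => by rw [hg j hj, hx.rate_label hj])
  rw [hx.sum_eq] at h
  rw [hS]
  exact (hasSum_rate_iff x g _).1 h

theorem Regular.hasSum_drift {x : Fin 4 → ℝ} (hx : Regular x) (i : Fin 4) :
    HasSum (fun l : Fin 4 → ℤ => rate l x * (l i : ℝ)) (driftForm (zParam x) (aOf x) i) := by
  have hE : Real.exp (zParam x) ≠ 0 := (Real.exp_pos _).ne'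
  have hl : ∀ j : ℕ × ℕ × ℕ, j ≠ 0 → label j = step (j.1 + 1, j.2.1, j.2.2) :=
    fun j hj => label_of_ne hj
  fin_cases i
  -- The value v is the coordinate of the special step; α, β, γ, κ are read off `step (j.1 + 1,
  -- j.2.1, j.2.2)`, the shift by one in k₁ going into α.
  · refine hx.hasSum_rate (g := fun l => (l 0 : ℝ)) (v := -2) (α := -1) (β := -1) (γ := 1) (κ := 0)
      (by simp [label_zero]) (fun j hj => by rw [hl j hj]; simp [step]) ?_
    simp only [driftForm, hx.aOf_eq, hx.div_eq, expTail, Real.exp_neg]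
    simp
    field_simp
    ring
  · refine hx.hasSum_rate (g := fun l => (l 1 : ℝ)) (v := 0) (α := -1) (β := 0) (γ := -1) (κ := 0)
      (by simp [label_zero]) (fun j hj => by rw [hl j hj]; simp [step]; ring) ?_
    simp only [driftForm, hx.aOf_eq, hx.div_eq, expTail, Real.exp_neg]
    simp
    field_simp
    ring
  · refine hx.hasSum_rate (g := fun l => (l 2 : ℝ)) (v := -1) (α := -1) (β := -1) (γ := -1)
      (κ := -1) (by simp [label_zero]) (fun j hj => by rw [hl j hj]; simp [step]; ring) ?_
    simp only [driftForm, hx.aOf_eq, hx.div_eq, expTail, Real.exp_neg]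
    simp
    field_simp
    ring
  · refine hx.hasSum_rate (g := fun l => (l 3 : ℝ)) (v := 1) (α := 1) (β := 0) (γ := 0)
      (κ := 0) (by simp [label_zero]) (fun j hj => by rw [hl j hj]; simp [step]) ?_
    simp only [driftForm, hx.aOf_eq, hx.div_eq, expTail, Real.exp_neg]
    simp
    ring

theorem Regular.drift_eq {x : Fin 4 → ℝ} (hx : Regular x) :
    drift x = driftForm (zParam x) (aOf x) :=
  funext fun i => (hx.hasSum_drift i).tsum_eq

/-! ### Differentiation of the drift -/

/-- The differential of `z(x)`. -/
noncomputable def dz (x v : Fin 4 → ℝ) : ℝ :=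
  expTail (zParam x) ^ 2 / discr (zParam x)
    * (((2 * v 2 - v 0) * x 1 - (2 * x 2 - x 0) * v 1) / x 1 ^ 2)

/-- The differential of `a(x)`. -/
noncomputable def da (x v : Fin 4 → ℝ) : ℝ :=
  aOf x * (v 1 / x 1 - v 2 / x 2
    + (1 / zParam x - zParam x / expTail (zParam x)) * dz x v)

/-- The partial derivative of `driftForm` in `z`. -/
noncomputable def driftFormZ (z a : ℝ) : Fin 4 → ℝ :=
  ![-(a * (1 - a * (1 - Real.exp (-z)))) + (1 + a * z) * (a * Real.exp (-z))
      + 2 * a ^ 2 * z * Real.exp (-z) - a ^ 2 * z ^ 2 * Real.exp (-z),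
    -(a * Real.exp (-z)) - 2 * a ^ 2 * z * Real.exp (-z) + a ^ 2 * z ^ 2 * Real.exp (-z),
    -a,
    0]

/-- The partial derivative of `driftForm` in `a`. -/
noncomputable def driftFormA (z a : ℝ) : Fin 4 → ℝ :=
  ![-(z * (1 - a * (1 - Real.exp (-z)))) + (1 + a * z) * (1 - Real.exp (-z))
      + 2 * a * z ^ 2 * Real.exp (-z),
    -(1 - Real.exp (-z)) - 2 * a * z ^ 2 * Real.exp (-z),
    -z,
    0]

theorem hasDerivAt_driftForm {z a : ℝ → ℝ} {z' a' t : ℝ} (hz : HasDerivAt z z' t)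
    (ha : HasDerivAt a a' t) (i : Fin 4) :
    HasDerivAt (fun t => driftForm (z t) (a t) i)
      (driftFormZ (z t) (a t) i * z' + driftFormA (z t) (a t) i * a') t := by
  have he : HasDerivAt (fun t => Real.exp (-z t)) (Real.exp (-z t) * -z') t := hz.neg.exp
  fin_cases i
  · refine ((((ha.mul hz).const_add 1).mul ((ha.mul (he.const_sub 1)).const_sub 1)).const_sub (-1)
      |>.add (((ha.pow 2).mul (hz.pow 2)).mul he)).congr_deriv ?_
    simp [driftFormZ, driftFormA]
    ring
  · refine ((ha.mul (he.const_sub 1)).neg.sub (((ha.pow 2).mul (hz.pow 2)).mul he)).congr_deriv ?_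
    simp [driftFormZ, driftFormA]
    ring
  · refine ((ha.mul hz).const_sub (-1)).congr_deriv ?_
    simp [driftFormZ, driftFormA]
    ring
  · refine (hasDerivAt_const t (1 : ℝ)).congr_deriv ?_
    simp [driftFormZ, driftFormA]

/-! ### Derivatives of z, a and the drift along a differentiable curve. -/

section Curve

variable {x v : Fin 4 → ℝ} {y : ℝ → Fin 4 → ℝ} {t₀ : ℝ}

theorem Regular.hasDerivAt_quot (hx : Regular x) (hy : ∀ i, HasDerivAt (fun t => y t i) (v i) t₀)
    (h0 : y t₀ = x) : HasDerivAt (fun t => (2 * y t 2 - y t 0) / y t 1)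
      (((2 * v 2 - v 0) * x 1 - (2 * x 2 - x 0) * v 1) / x 1 ^ 2) t₀ := by
  have h := (((hy 2).const_mul 2).sub (hy 0)).div (hy 1) (by rw [h0]; exact hx.pos_one.ne')
  simp only [Pi.sub_apply, h0] at h
  exact h

theorem Regular.hasDerivAt_zParam (hx : Regular x)
    (hy : ∀ i, HasDerivAt (fun t => y t i) (v i) t₀) (h0 : y t₀ = x) :
    HasDerivAt (fun t => zParam (y t)) (dz x v) t₀ := by
  have h := (hasStrictDerivAt_invMean hx.zParam_pos).hasDerivAt
  rw [hx.truncMean_zParam, ← h0] at h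
  exact (h.comp t₀ (hx.hasDerivAt_quot hy h0)).congr_deriv (by rw [dz, h0])

theorem Regular.eventually (hx : Regular x) (hy : ∀ i, HasDerivAt (fun t => y t i) (v i) t₀)
    (h0 : y t₀ = x) : ∀ᶠ t in 𝓝 t₀, Regular (y t) := by
  have h1 := (hy 1).continuousAt.eventually (lt_mem_nhds (show 0 < y t₀ 1 by
    rw [h0]; exact hx.pos_one))
  have h2 := (hy 2).continuousAt.eventually (lt_mem_nhds (show 0 < y t₀ 2 by
    rw [h0]; exact hx.pos_two))
  have h3 := (hx.hasDerivAt_quot hy h0).continuousAt.tendsto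
  rw [h0, ← hx.truncMean_zParam] at h3
  filter_upwards [h1, h2, h3.eventually (eventually_truncMean_invMean hx.zParam_pos)]
    with t ht1 ht2 ht3
  exact ⟨ht1, ht2, ht3.1, ht3.2⟩

theorem Regular.hasDerivAt_aOf (hx : Regular x) (hy : ∀ i, HasDerivAt (fun t => y t i) (v i) t₀)
    (h0 : y t₀ = x) : HasDerivAt (fun t => aOf (y t)) (da x v) t₀ := by
  have hz := hx.hasDerivAt_zParam hy h0
  have hf := (expTail_pos hx.zParam_pos).ne'
  have hE : HasDerivAt (fun t => expTail (zParam (y t)))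
      (Real.exp (zParam x) * dz x v - dz x v) t₀ := by
    have := (hz.exp.sub hz).sub_const 1
    rw [h0] at this
    exact this
  have h1 := (hy 1).div ((hy 2).const_mul 2) (by rw [h0]; exact (mul_pos two_pos hx.pos_two).ne')
  have h2 := (hz.mul hz.exp).div hE (by rw [h0]; exact hf)
  refine (h1.mul h2).congr_deriv ?_
  have hx1 := hx.pos_one.ne'
  have hx2 := hx.pos_two.ne'
  have hz0 := hx.zParam_pos.ne'
  simp only [Pi.mul_apply, Pi.div_apply, h0, da, aOf]
  set D := dz x v
  rw [expTail] at hf ⊢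
  field_simp
  ring

theorem Regular.hasDerivAt_drift (hx : Regular x)
    (hy : ∀ i, HasDerivAt (fun t => y t i) (v i) t₀) (h0 : y t₀ = x) (i : Fin 4) :
    HasDerivAt (fun t => drift (y t) i)
      (driftFormZ (zParam x) (aOf x) i * dz x v + driftFormA (zParam x) (aOf x) i * da x v) t₀ := by
  have h := hasDerivAt_driftForm (hx.hasDerivAt_zParam hy h0) (hx.hasDerivAt_aOf hy h0) i
  simp only [h0] at h
  refine h.congr_of_eventuallyEq ?_
  filter_upwards [hx.eventually hy h0] with t ht
  rw [ht.drift_eq]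

end Curve

/-- Each coordinate line is a curve through x with a basis vector as its velocity. -/
theorem Regular.driftJacobian_apply {x : Fin 4 → ℝ} (hx : Regular x) (i j : Fin 4) :
    driftJacobian x i j = driftFormZ (zParam x) (aOf x) i * dz x (Pi.single j 1)
      + driftFormA (zParam x) (aOf x) i * da x (Pi.single j 1) := by
  have hy : ∀ k, HasDerivAt (fun t : ℝ => Function.update x j t k)
      ((Pi.single j 1 : Fin 4 → ℝ) k) (x j) := by
    intro k
    by_cases hk : k = j
    · subst hk
      simpa using hasDerivAt_id' (x k)
    · simpa [Function.update_of_ne hk, Pi.single_eq_of_ne hk] using hasDerivAt_const (x j) (x k)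
  exact (hx.hasDerivAt_drift hy (Function.update_eq_self j x) i).deriv

theorem Regular.driftJacobian_mulVec {x : Fin 4 → ℝ} (hx : Regular x) (v : Fin 4 → ℝ) (i : Fin 4) :
    (driftJacobian x *ᵥ v) i
      = driftFormZ (zParam x) (aOf x) i * dz x v + driftFormA (zParam x) (aOf x) i * da x v := by
  have hdz : ∑ j, dz x (Pi.single j 1) * v j = dz x v := by
    simp [Fin.sum_univ_four, dz, Pi.single_apply]
    ring
  have hda : ∑ j, da x (Pi.single j 1) * v j = da x v := by
    rw [da, ← hdz]
    simp only [Fin.sum_univ_four, da, Pi.single_apply]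
    simp
    ring
  rw [← hdz, ← hda]
  simp only [Matrix.mulVec, dotProduct, hx.driftJacobian_apply, Finset.mul_sum,
    ← Finset.sum_add_distrib]
  exact Finset.sum_congr rfl fun j _ => by ring

/-! ### The state as a function of the parameters `z` and `b = c β` -/

/-- The first three coordinates of the fluid limit at the parameters `z`, `b`. -/
noncomputable def state (c z b t : ℝ) : Fin 4 → ℝ :=
  ![1 / c * (z ^ 2 - z * b * (1 - Real.exp (-z))), Real.exp (-z) * expTail z * (b / c),
    1 / (2 * c) * z ^ 2, t]

theorem fluid_eq_state {c : ℝ} (hc : 0 < c) (s : ℝ) :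
    fluid c s = state c (theta c s) (c * betaFn c (theta c s)) s := by
  rw [fluid, state]
  congr 1
  · ring
  · congr 1
    field_simp

section State

variable {c z b : ℝ}

/-- The formulas for χ are arranged so that z(χ) is the parameter ϑ itself, whatever b is. -/
theorem state_quot (hc : 0 < c) (hz : 0 < z) (hb : 0 < b) (t : ℝ) :
    (2 * state c z b t 2 - state c z b t 0) / state c z b t 1 = truncMean z := by
  have hf := (expTail_pos hz).ne'
  rw [truncMean, if_neg hz.ne']
  have hE := (Real.exp_pos z).ne'
  simp only [state, Real.exp_neg]
  simp
  field_simp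
  ring

theorem zParam_state (hc : 0 < c) (hz : 0 < z) (hb : 0 < b) (t : ℝ) :
    zParam (state c z b t) = z := by
  rw [zParam_eq, state_quot hc hz hb, invMean_truncMean hz.le]

theorem regular_state (hc : 0 < c) (hz : 0 < z) (hb : 0 < b) (t : ℝ) :
    Regular (state c z b t) := by
  refine ⟨?_, ?_, ?_, ?_⟩
  · have := expTail_pos hz
    simp only [state]
    simp
    positivity
  · simp only [state]
    simp
    positivity
  · rwa [zParam_state hc hz hb]
  · rw [zParam_state hc hz hb, state_quot hc hz hb]

theorem aOf_state (hc : 0 < c) (hz : 0 < z) (hb : 0 < b) (t : ℝ) :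
    aOf (state c z b t) = b / z := by
  have hf := (expTail_pos hz).ne'
  have hE := (Real.exp_pos z).ne'
  rw [aOf, zParam_state hc hz hb]
  simp only [state, Real.exp_neg]
  simp
  field_simp

/-! ### Tangent vectors in the coordinates `(z, B, Y)` -/

/-- The tangent vector at `state c z b t` with `δz = n₁`, `δB = n₂`, `δY = n₃`, where
`B = b / c` and `Y = 2 x₃`. -/
noncomputable def tangent (c z b n₁ n₂ n₃ : ℝ) : Fin 4 → ℝ :=
  ![-(b / c * (1 - Real.exp (-z) + z * Real.exp (-z)) * n₁) - z * (1 - Real.exp (-z)) * n₂ + n₃,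
    b / c * z * Real.exp (-z) * n₁ + (1 - Real.exp (-z) - z * Real.exp (-z)) * n₂,
    n₃ / 2, 0]

/-- The component `δz` of a vector. -/
noncomputable def coZ (c z b : ℝ) (v : Fin 4 → ℝ) : ℝ :=
  Real.exp z * c / (discr z * b) * (expTail z * (2 * v 2 - v 0) - z * (Real.exp z - 1) * v 1)

/-- The component `δB` of a vector. -/
noncomputable def coB (z : ℝ) (v : Fin 4 → ℝ) : ℝ :=
  Real.exp z / discr z * ((Real.exp z - 1 + z) * v 1 - z * (2 * v 2 - v 0))

/-- `coZ` and `coB` are Cramer's rule for the 2 × 2 system in (δz, δB) left after eliminating δY.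
Its determinant is b e^{-2z}/c times `discr z`. -/
theorem coZ_tangent (hc : 0 < c) (hz : 0 < z) (hb : 0 < b) (n₁ n₂ n₃ : ℝ) :
    coZ c z b (tangent c z b n₁ n₂ n₃) = n₁ := by
  have hD := (discr_pos hz).ne'
  have hE := (Real.exp_pos z).ne'
  simp only [coZ, tangent, Real.exp_neg]
  simp
  field_simp
  rw [discr, expTail]
  ring

theorem coB_tangent (hc : 0 < c) (hz : 0 < z) (n₁ n₂ n₃ : ℝ) :
    coB z (tangent c z b n₁ n₂ n₃) = n₂ := by
  have hD := (discr_pos hz).ne'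
  have hE := (Real.exp_pos z).ne'
  simp only [coB, tangent, Real.exp_neg]
  simp
  field_simp
  rw [discr]
  ring

theorem dz_state (hc : 0 < c) (hz : 0 < z) (hb : 0 < b) (t : ℝ) (v : Fin 4 → ℝ) :
    dz (state c z b t) v = coZ c z b v := by
  have hf := (expTail_pos hz).ne'
  have hD := (discr_pos hz).ne'
  have hE := (Real.exp_pos z).ne'
  rw [dz, zParam_state hc hz hb, coZ]
  simp only [state, Real.exp_neg]
  simp
  field_simp
  ring

/-- In the coordinates (z, B, Y) one has a = zB/Y, and this is its logarithmic differential with δY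
= 2 v₃ and Y = z²/c. -/
theorem da_state (hc : 0 < c) (hz : 0 < z) (hb : 0 < b) (t : ℝ) (v : Fin 4 → ℝ) :
    da (state c z b t) v
      = b / z * (c / b * coB z v + coZ c z b v / z - 2 * c / z ^ 2 * v 2) := by
  have hf := (expTail_pos hz).ne'
  have hD := (discr_pos hz).ne'
  have hE := (Real.exp_pos z).ne'
  have key : v 1 / (Real.exp (-z) * expTail z * (b / c)) - z / expTail z * coZ c z b v
      = c / b * coB z v := by
    rw [coZ, coB, Real.exp_neg]
    field_simp
    rw [discr, expTail]
    ring
  rw [da, aOf_state hc hz hb, dz_state hc hz hb, zParam_state hc hz hb, ← key]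
  simp only [state]
  simp
  field_simp
  left
  ring

/-- The action of the Jacobian of the drift on a tangent vector. -/
theorem driftJacobian_mulVec_tangent (hc : 0 < c) (hz : 0 < z) (hb : 0 < b) (t : ℝ)
    (n₁ n₂ n₃ : ℝ) (i : Fin 4) :
    (driftJacobian (state c z b t) *ᵥ tangent c z b n₁ n₂ n₃) i
      = driftFormZ z (b / z) i * n₁
        + driftFormA z (b / z) i * (b / z * (c / b * n₂ + n₁ / z - c / z ^ 2 * n₃)) := by
  rw [(regular_state hc hz hb t).driftJacobian_mulVec, dz_state hc hz hb, da_state hc hz hb,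
    coZ_tangent hc hz hb, coB_tangent hc hz, zParam_state hc hz hb, aOf_state hc hz hb]
  have : (tangent c z b n₁ n₂ n₃) 2 = n₃ / 2 := rfl
  rw [this]
  ring

/-! ### A fundamental matrix of the linearised equation, and its inverse -/

/-- The columns of the fundamental matrix. -/
noncomputable def fundCol (c z b : ℝ) : Fin 4 → Fin 4 → ℝ :=
  ![tangent c z b (-(c * (1 + b) / z)) (-(b / z)) (-2 - 2 * b),
    tangent c z b ((z - b) * (1 + b) / z - 1) ((z - b) / c * (b / z))
      ((z - b) / c * (2 + 2 * b) - 2 * z / c),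
    tangent c z b ((z - b) ^ 2 * (1 + b) / (2 * c * z) + b / c) ((z - b) ^ 2 / (2 * c ^ 2) * (b / z))
      ((z - b) ^ 2 / (2 * c ^ 2) * (2 + 2 * b) + (2 * b * z - z ^ 2) / c ^ 2),
    ![0, 0, 0, 1]]

/-- A fundamental matrix of the linearised equation. -/
noncomputable def fundMat (c z b : ℝ) : Matrix (Fin 4) (Fin 4) ℝ :=
  Matrix.of fun i k => fundCol c z b k i

/-- The differential of the first integral `z² / Y`. -/
noncomputable def rowC (c z b : ℝ) (v : Fin 4 → ℝ) : ℝ :=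
  2 * c / z * coZ c z b v - 2 * c ^ 2 / z ^ 2 * v 2

/-- The differential of the first integral `log B + (z² / Y) B - z`. -/
noncomputable def rowA (c z b : ℝ) (v : Fin 4 → ℝ) : ℝ :=
  c * (1 + b) / b * coB z v + b / c * rowC c z b v - coZ c z b v

/-- The differential of the time that has elapsed along the flow. -/
noncomputable def rowT (c z b : ℝ) (v : Fin 4 → ℝ) : ℝ :=
  -(z / b * coB z v) + (z - b) ^ 2 / (2 * c ^ 2) * rowC c z b v + (z - b) / c * rowA c z b v

/-- The rows of the inverse of the fundamental matrix. -/
noncomputable def fundRow (c z b : ℝ) (v : Fin 4 → ℝ) : Fin 4 → ℝ :=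
  ![rowT c z b v, rowA c z b v, rowC c z b v, v 3]

/-- The inverse of the fundamental matrix. -/
noncomputable def fundInv (c z b : ℝ) : Matrix (Fin 4) (Fin 4) ℝ :=
  Matrix.of fun k j => fundRow c z b (Pi.single j 1) k

theorem coZ_sum (v : Fin 4 → ℝ) : ∑ j, coZ c z b (Pi.single j 1) * v j = coZ c z b v := by
  simp [Fin.sum_univ_four, coZ, Pi.single_apply]
  ring

theorem coB_sum (v : Fin 4 → ℝ) : ∑ j, coB z (Pi.single j 1) * v j = coB z v := by
  simp [Fin.sum_univ_four, coB, Pi.single_apply]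
  ring

theorem rowC_sum (v : Fin 4 → ℝ) : ∑ j, rowC c z b (Pi.single j 1) * v j = rowC c z b v := by
  rw [rowC, ← coZ_sum v]
  simp only [Fin.sum_univ_four, rowC, Pi.single_apply]
  simp
  ring

theorem rowA_sum (v : Fin 4 → ℝ) : ∑ j, rowA c z b (Pi.single j 1) * v j = rowA c z b v := by
  rw [rowA, ← coZ_sum v, ← coB_sum v, ← rowC_sum v]
  simp only [Fin.sum_univ_four, rowA]
  ring

theorem rowT_sum (v : Fin 4 → ℝ) : ∑ j, rowT c z b (Pi.single j 1) * v j = rowT c z b v := by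
  rw [rowT, ← coB_sum v, ← rowC_sum v, ← rowA_sum v]
  simp only [Fin.sum_univ_four, rowT]
  ring

theorem fundInv_mulVec (v : Fin 4 → ℝ) : fundInv c z b *ᵥ v = fundRow c z b v := by
  ext k
  simp only [Matrix.mulVec, dotProduct, fundInv, Matrix.of_apply]
  fin_cases k
  · exact rowT_sum v
  · exact rowA_sum v
  · exact rowC_sum v
  · simp [fundRow, Pi.single_apply]

theorem fundRow_tangent (hc : 0 < c) (hz : 0 < z) (hb : 0 < b) (n₁ n₂ n₃ : ℝ) :
    fundRow c z b (tangent c z b n₁ n₂ n₃) =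
      ![-(z / b * n₂) + (z - b) ^ 2 / (2 * c ^ 2) * (2 * c / z * n₁ - c ^ 2 / z ^ 2 * n₃)
          + (z - b) / c * (c * (1 + b) / b * n₂ + b / c * (2 * c / z * n₁ - c ^ 2 / z ^ 2 * n₃)
            - n₁),
        c * (1 + b) / b * n₂ + b / c * (2 * c / z * n₁ - c ^ 2 / z ^ 2 * n₃) - n₁,
        2 * c / z * n₁ - c ^ 2 / z ^ 2 * n₃, 0] := by
  have hC : rowC c z b (tangent c z b n₁ n₂ n₃) = 2 * c / z * n₁ - c ^ 2 / z ^ 2 * n₃ := by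
    rw [rowC, coZ_tangent hc hz hb]
    have : (tangent c z b n₁ n₂ n₃) 2 = n₃ / 2 := rfl
    rw [this]
    ring
  simp only [fundRow, rowT, rowA, hC, coZ_tangent hc hz hb, coB_tangent hc hz]
  rfl

/-- The columns differentiate the general solution in its constants (elapsed time, the two first
integrals, x₄) and the rows are the differentials of those constants, so the two are dual. In
tangent coordinates this is a rational identity in z and b. -/
theorem fundInv_mul_fundMat (hc : 0 < c) (hz : 0 < z) (hb : 0 < b) :
    fundInv c z b * fundMat c z b = 1 := by
  ext k l
  have h : (fundInv c z b * fundMat c z b) k l = (fundInv c z b *ᵥ fundCol c z b l) k := rfl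
  rw [h, fundInv_mulVec]
  fin_cases l
  · simp only [fundCol]
    simp only [Fin.zero_eta, Matrix.cons_val_zero]
    rw [fundRow_tangent hc hz hb]
    fin_cases k <;> simp <;> field_simp <;> ring
  · simp only [fundCol]
    simp only [Fin.mk_one, Matrix.cons_val_one, Matrix.cons_val_zero]
    rw [fundRow_tangent hc hz hb]
    fin_cases k <;> simp <;> field_simp <;> ring
  · simp only [fundCol]
    simp only [Fin.reduceFinMk, Matrix.cons_val]
    rw [fundRow_tangent hc hz hb]
    fin_cases k <;> simp <;> field_simp <;> ring
  · simp only [fundCol]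
    fin_cases k <;> simp [fundRow, rowT, rowA, rowC, coZ, coB]

theorem fundMat_mul_fundInv (hc : 0 < c) (hz : 0 < z) (hb : 0 < b) :
    fundMat c z b * fundInv c z b = 1 :=
  mul_eq_one_comm.1 (fundInv_mul_fundMat hc hz hb)

end State

/-- The parameter `b = c β(ϑ(s))`. -/
noncomputable def bOf (c s : ℝ) : ℝ := c * betaFn c (theta c s)

/-! ### Motion of z, b and the fundamental matrix along the fluid limit. -/

section

variable {c : ℝ}

theorem bOf_pos (hc : 0 < c) (s : ℝ) : 0 < bOf c s := mul_pos hc (betaFn_pos hc _)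

theorem hasDerivAt_theta' (hc : 0 < c) {s : ℝ} (h0 : 0 ≤ s) (h1 : s < timeOf c 0) :
    HasDerivAt (theta c) (-(c * (1 + bOf c s) / theta c s)) s :=
  (hasDerivAt_theta hc h0 h1).congr_deriv (by rw [neg_div]; rfl)

theorem hasDerivAt_bOf (hc : 0 < c) {s : ℝ} (h0 : 0 ≤ s) (h1 : s < timeOf c 0) :
    HasDerivAt (bOf c) (-(c * bOf c s / theta c s)) s := by
  have h := ((hasStrictDerivAt_betaFn hc (theta c s)).hasDerivAt.comp s
    (hasDerivAt_theta' hc h0 h1)).const_mul c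
  refine h.congr_deriv ?_
  have hz := (theta_pos hc h0 h1).ne'
  have hb : 0 < 1 + c * betaFn c (theta c s) := by
    have := bOf_pos hc s
    rw [bOf] at this
    positivity
  simp only [bOf]
  field_simp

theorem fluid_eq (hc : 0 < c) (s : ℝ) : fluid c s = state c (theta c s) (bOf c s) s :=
  fluid_eq_state hc s

theorem hasDerivAt_tangent {z b n₁ n₂ n₃ : ℝ → ℝ} {z' b' n₁' n₂' n₃' s : ℝ}
    (hz : HasDerivAt z z' s) (hb : HasDerivAt b b' s) (h₁ : HasDerivAt n₁ n₁' s)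
    (h₂ : HasDerivAt n₂ n₂' s) (h₃ : HasDerivAt n₃ n₃' s) (i : Fin 4) :
    HasDerivAt (fun s => tangent c (z s) (b s) (n₁ s) (n₂ s) (n₃ s) i)
      ((![-(b' / c * (1 - Real.exp (-z s) + z s * Real.exp (-z s)) * n₁ s
            + b s / c * ((2 - z s) * Real.exp (-z s) * z') * n₁ s
            + b s / c * (1 - Real.exp (-z s) + z s * Real.exp (-z s)) * n₁')
          - z' * (1 - Real.exp (-z s)) * n₂ s - z s * (Real.exp (-z s) * z') * n₂ s
          - z s * (1 - Real.exp (-z s)) * n₂' + n₃',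
        b' / c * z s * Real.exp (-z s) * n₁ s
          + b s / c * ((1 - z s) * Real.exp (-z s) * z') * n₁ s
          + b s / c * z s * Real.exp (-z s) * n₁' + z s * Real.exp (-z s) * z' * n₂ s
          + (1 - Real.exp (-z s) - z s * Real.exp (-z s)) * n₂',
        n₃' / 2, 0] : Fin 4 → ℝ) i) s := by
  have he : HasDerivAt (fun t => Real.exp (-z t)) (Real.exp (-z s) * -z') s := hz.neg.exp
  fin_cases i
  · refine (((((hb.div_const c).mul ((he.const_sub 1).add (hz.mul he))).mul h₁).neg.sub
      ((hz.mul (he.const_sub 1)).mul h₂)).add h₃).congr_deriv ?_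
    simp
    ring
  · refine (((((hb.div_const c).mul hz).mul he).mul h₁).add
      (((he.const_sub 1).sub (hz.mul he)).mul h₂)).congr_deriv ?_
    simp
    ring
  · exact h₃.div_const 2
  · exact hasDerivAt_const s 0

/-- A family of solutions differentiated in a parameter solves the linearised equation. The first
column is the velocity of the flow without its constant last coordinate. The identities are checked
directly, from z' = −c(1 + b)/z and b' = −cb/z. -/
theorem hasDerivAt_fundCol (hc : 0 < c) {s : ℝ} (h0 : 0 ≤ s) (h1 : s < timeOf c 0) (l i : Fin 4) :
    HasDerivAt (fun s => fundCol c (theta c s) (bOf c s) l i)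
      ((driftJacobian (fluid c s) *ᵥ fundCol c (theta c s) (bOf c s) l) i) s := by
  have hzp := theta_pos hc h0 h1
  have hbp := bOf_pos hc s
  have hz := hasDerivAt_theta' hc h0 h1
  have hb := hasDerivAt_bOf hc h0 h1
  have hL := hz.sub hb
  have hb1 := hb.const_add 1
  have hz0 := hzp.ne'
  have hb0 := hbp.ne'
  have hc0 := hc.ne'
  rw [fluid_eq hc]
  fin_cases l
  · have n₁ := ((hb1.const_mul c).div hz hz0).neg
    have n₂ := (hb.div hz hz0).neg
    have n₃ := (hb.const_mul 2).const_sub (-2)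
    have h := hasDerivAt_tangent (c := c) hz hb n₁ n₂ n₃ i
    refine h.congr_deriv ?_
    simp only [fundCol, Fin.zero_eta, Matrix.cons_val_zero]
    rw [driftJacobian_mulVec_tangent hc hzp hbp]
    simp only [Pi.div_apply, Pi.neg_apply]
    clear h n₁ n₂ n₃
    generalize theta c s = z at *
    generalize bOf c s = b at *
    fin_cases i <;> simp [driftFormZ, driftFormA] <;> field_simp <;> ring
  · have n₁ := ((hL.mul hb1).div hz hz0).sub_const 1
    have n₂ := (hL.div_const c).mul (hb.div hz hz0)
    have n₃ := ((hL.div_const c).mul ((hb.const_mul 2).const_add 2)).sub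
      ((hz.const_mul 2).div_const c)
    have h := hasDerivAt_tangent (c := c) hz hb n₁ n₂ n₃ i
    refine h.congr_deriv ?_
    simp only [fundCol, Fin.mk_one, Matrix.cons_val_one, Matrix.cons_val_zero]
    rw [driftJacobian_mulVec_tangent hc hzp hbp]
    simp only [Pi.mul_apply, Pi.div_apply, Pi.sub_apply]
    clear h n₁ n₂ n₃
    generalize theta c s = z at *
    generalize bOf c s = b at *
    fin_cases i <;> simp [driftFormZ, driftFormA] <;> field_simp <;> ring
  · have n₁ := (((hL.pow 2).mul hb1).div (hz.const_mul (2 * c)) (by positivity)).add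
      (hb.div_const c)
    have n₂ := ((hL.pow 2).div_const (2 * c ^ 2)).mul (hb.div hz hz0)
    have n₃ := (((hL.pow 2).div_const (2 * c ^ 2)).mul ((hb.const_mul 2).const_add 2)).add
      ((((hb.const_mul 2).mul hz).sub (hz.pow 2)).div_const (c ^ 2))
    have h := hasDerivAt_tangent (c := c) hz hb n₁ n₂ n₃ i
    refine h.congr_deriv ?_
    simp only [fundCol, Fin.reduceFinMk, Matrix.cons_val]
    rw [driftJacobian_mulVec_tangent hc hzp hbp]
    simp only [Pi.mul_apply, Pi.div_apply, Pi.sub_apply, Pi.add_apply, Pi.pow_apply]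
    clear h n₁ n₂ n₃
    generalize theta c s = z at *
    generalize bOf c s = b at *
    fin_cases i <;> simp [driftFormZ, driftFormA] <;> field_simp <;> ring
  · have h4 : ∀ t, fundCol c (theta c t) (bOf c t) 3 i = (![0, 0, 0, 1] : Fin 4 → ℝ) i :=
      fun t => rfl
    -- The drift does not depend on x₄, so the fourth unit vector is a constant solution.
    have h5 : (driftJacobian (state c (theta c s) (bOf c s) s) *ᵥ ![0, 0, 0, 1]) i = 0 := by
      rw [(regular_state hc hzp hbp s).driftJacobian_mulVec, dz_state hc hzp hbp,
        da_state hc hzp hbp]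
      simp [coZ, coB]
    simp only [Fin.reduceFinMk, h4]
    exact (hasDerivAt_const s _).congr_deriv h5.symm

/-! ### The correlation function -/

theorem hasDerivAt_fundMat (hc : 0 < c) {s : ℝ} (h0 : 0 ≤ s) (h1 : s < timeOf c 0) (i l : Fin 4) :
    HasDerivAt (fun s => fundMat c (theta c s) (bOf c s) i l)
      ((driftJacobian (fluid c s) * fundMat c (theta c s) (bOf c s)) i l) s :=
  hasDerivAt_fundCol hc h0 h1 l i

theorem differentiableAt_coZ (hc : 0 < c) {s : ℝ} (h0 : 0 ≤ s) (h1 : s < timeOf c 0)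
    (v : Fin 4 → ℝ) : DifferentiableAt ℝ (fun s => coZ c (theta c s) (bOf c s) v) s := by
  have hz := (hasDerivAt_theta' hc h0 h1).differentiableAt
  have hb := (hasDerivAt_bOf hc h0 h1).differentiableAt
  have hD : discr (theta c s) * bOf c s ≠ 0 :=
    mul_ne_zero (discr_pos (theta_pos hc h0 h1)).ne' (bOf_pos hc s).ne'
  simp only [coZ, discr, expTail] at hD ⊢
  fun_prop (disch := assumption)

theorem differentiableAt_coB (hc : 0 < c) {s : ℝ} (h0 : 0 ≤ s) (h1 : s < timeOf c 0)
    (v : Fin 4 → ℝ) : DifferentiableAt ℝ (fun s => coB (theta c s) v) s := by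
  have hz := (hasDerivAt_theta' hc h0 h1).differentiableAt
  have hD : discr (theta c s) ≠ 0 := (discr_pos (theta_pos hc h0 h1)).ne'
  simp only [coB, discr] at hD ⊢
  fun_prop (disch := assumption)

theorem differentiableAt_fundInv (hc : 0 < c) {s : ℝ} (h0 : 0 ≤ s) (h1 : s < timeOf c 0)
    (k j : Fin 4) :
    DifferentiableAt ℝ (fun s => fundInv c (theta c s) (bOf c s) k j) s := by
  have hz := (hasDerivAt_theta' hc h0 h1).differentiableAt
  have hb := (hasDerivAt_bOf hc h0 h1).differentiableAt
  have hz0 := (theta_pos hc h0 h1).ne'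
  have hz2 : theta c s ^ 2 ≠ 0 := pow_ne_zero 2 hz0
  have hb0 := (bOf_pos hc s).ne'
  have d1 := differentiableAt_coZ hc h0 h1 (Pi.single j 1)
  have d2 := differentiableAt_coB hc h0 h1 (Pi.single j 1)
  have dC : DifferentiableAt ℝ (fun s => rowC c (theta c s) (bOf c s) (Pi.single j 1)) s := by
    simp only [rowC]
    fun_prop (disch := assumption)
  have dA : DifferentiableAt ℝ (fun s => rowA c (theta c s) (bOf c s) (Pi.single j 1)) s := by
    simp only [rowA]
    fun_prop (disch := assumption)
  have dT : DifferentiableAt ℝ (fun s => rowT c (theta c s) (bOf c s) (Pi.single j 1)) s := by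
    simp only [rowT]
    fun_prop (disch := assumption)
  fin_cases k
  · exact dT
  · exact dA
  · exact dC
  · exact differentiableAt_const _

/-- Differentiating QM = 1 gives Q'M + Q(∂F)M = 0, hence Q' = −Q ∂F. The explicit form of Q is
needed only for differentiability. -/
theorem hasDerivAt_fundInv (hc : 0 < c) {s : ℝ} (h0 : 0 ≤ s) (h1 : s < timeOf c 0) (k j : Fin 4) :
    HasDerivAt (fun s => fundInv c (theta c s) (bOf c s) k j)
      (-(fundInv c (theta c s) (bOf c s) * driftJacobian (fluid c s)) k j) s := by
  set P' : Matrix (Fin 4) (Fin 4) ℝ :=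
    Matrix.of fun k j => deriv (fun s => fundInv c (theta c s) (bOf c s) k j) s with hP'
  have hP : ∀ k j, HasDerivAt (fun s => fundInv c (theta c s) (bOf c s) k j) (P' k j) s :=
    fun k j => (differentiableAt_fundInv hc h0 h1 k j).hasDerivAt
  set M := fundMat c (theta c s) (bOf c s) with hM
  set Q := fundInv c (theta c s) (bOf c s) with hQ
  have hMQ : M * Q = 1 := fundMat_mul_fundInv hc (theta_pos hc h0 h1) (bOf_pos hc s)
  have hzero : P' * M + Q * (driftJacobian (fluid c s) * M) = 0 := by
    ext k l
    have hd : HasDerivAt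
        (fun s => (fundInv c (theta c s) (bOf c s) * fundMat c (theta c s) (bOf c s)) k l)
        ((P' * M + Q * (driftJacobian (fluid c s) * M)) k l) s := by
      simp only [Matrix.add_apply, Matrix.mul_apply (M := P'), Matrix.mul_apply (M := Q),
        ← Finset.sum_add_distrib]
      simp only [Matrix.mul_apply (M := fundInv _ _ _)]
      exact HasDerivAt.fun_sum fun j _ => (hP k j).mul (hasDerivAt_fundMat hc h0 h1 j l)
    have hev : (fun s => (fundInv c (theta c s) (bOf c s)
        * fundMat c (theta c s) (bOf c s)) k l) =ᶠ[𝓝 s] fun _ => (1 : Matrix _ _ ℝ) k l := by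
      filter_upwards [(hasDerivAt_theta' hc h0 h1).continuousAt.eventually
        (lt_mem_nhds (theta_pos hc h0 h1))] with t ht
      rw [fundInv_mul_fundMat hc ht (bOf_pos hc t)]
    exact hd.unique ((hasDerivAt_const s _).congr_of_eventuallyEq hev)
  have hfin : P' = -(Q * driftJacobian (fluid c s)) := by
    have := congrArg (· * Q) hzero
    simp only [add_mul, zero_mul, mul_assoc, hMQ, mul_one] at this
    exact eq_neg_of_add_eq_zero_left this
  refine (hP k j).congr_deriv ?_
  rw [hfin]
  rfl

theorem isCorrelationFunction_fund (hc : 0 < c) (hce : c ≤ Real.exp 1) :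
    IsCorrelationFunction c fun s u =>
      fundMat c (theta c s) (bOf c s) * fundInv c (theta c u) (bOf c u) := by
  intro u hu0 hu1
  rw [sStar_eq hc hce] at hu1
  refine ⟨fundMat_mul_fundInv hc (theta_pos hc hu0 hu1) (bOf_pos hc u), fun s hus hs i j => ?_⟩
  rw [sStar_eq hc hce] at hs
  refine HasDerivAt.hasDerivWithinAt ?_
  rw [← Matrix.mul_assoc]
  simp only [Matrix.mul_apply (N := fundInv _ _ _)]
  exact HasDerivAt.fun_sum fun k _ =>
    (hasDerivAt_fundMat hc (hu0.trans hus) hs i k).mul_const _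

/-- Variation of constants: M(r)⁻¹Φ(r,u) has zero right derivative, so it keeps its value M(u)⁻¹
from r = u. This identifies the chosen solution in `corr`. -/
theorem IsCorrelationFunction.eq (hc : 0 < c) (hce : c ≤ Real.exp 1)
    {Φ : ℝ → ℝ → Matrix (Fin 4) (Fin 4) ℝ} (hΦ : IsCorrelationFunction c Φ) {u s : ℝ}
    (h0 : 0 ≤ u) (hus : u ≤ s) (hs : s < timeOf c 0) :
    Φ s u = fundMat c (theta c s) (bOf c s) * fundInv c (theta c u) (bOf c u) := by
  obtain ⟨hu, hd⟩ := hΦ u h0 (by rw [sStar_eq hc hce]; exact hus.trans_lt hs)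
  rw [sStar_eq hc hce] at hd
  have hconst : fundInv c (theta c s) (bOf c s) * Φ s u = fundInv c (theta c u) (bOf c u) := by
    have hder : ∀ r, u ≤ r → r < timeOf c 0 → ∀ k j,
        HasDerivWithinAt (fun r => (fundInv c (theta c r) (bOf c r) * Φ r u) k j) 0
          (Set.Ico u (timeOf c 0)) r := by
      intro r hur hr k j
      have h : HasDerivWithinAt (fun r => (fundInv c (theta c r) (bOf c r) * Φ r u) k j)
          ((-(fundInv c (theta c r) (bOf c r) * driftJacobian (fluid c r)) * Φ r u
            + fundInv c (theta c r) (bOf c r) * (driftJacobian (fluid c r) * Φ r u)) k j)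
          (Set.Ico u (timeOf c 0)) r := by
        rw [Matrix.add_apply, Matrix.mul_apply (N := Φ r u), Matrix.mul_apply (M := fundInv _ _ _),
          ← Finset.sum_add_distrib]
        simp only [Matrix.mul_apply (N := Φ _ u)]
        refine HasDerivWithinAt.fun_sum fun l _ => ?_
        have h2 := hd r hur hr l j
        rw [Matrix.mul_apply] at h2
        exact (hasDerivAt_fundInv hc (h0.trans hur) hr k l).hasDerivWithinAt.mul h2
      refine h.congr_deriv ?_
      rw [neg_mul, mul_assoc, neg_add_cancel]
      rfl
    have key : ∀ k j, (fundInv c (theta c s) (bOf c s) * Φ s u) k j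
        = (fundInv c (theta c u) (bOf c u) * Φ u u) k j := by
      intro k j
      refine constant_of_has_deriv_right_zero (a := u) (b := s)
        (f := fun r => (fundInv c (theta c r) (bOf c r) * Φ r u) k j) ?_ ?_ s ⟨hus, le_rfl⟩
      · intro r hr
        exact (hder r hr.1 (hr.2.trans_lt hs) k j).continuousWithinAt.mono
          fun x hx => ⟨hx.1, hx.2.trans_lt hs⟩
      · intro r hr
        have hrT := hr.2.trans hs
        refine ((hder r hr.1 hrT k j).mono
          (Set.Ico_subset_Ico_left hr.1)).mono_of_mem_nhdsWithin ?_
        exact Ico_mem_nhdsGE hrT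
    ext k j
    rw [key, hu, mul_one]
  rw [← hconst, ← Matrix.mul_assoc,
    fundMat_mul_fundInv hc (theta_pos hc (h0.trans hus) hs) (bOf_pos hc s), one_mul]

theorem corr_eq (hc : 0 < c) (hce : c ≤ Real.exp 1) {u s : ℝ}
    (h0 : 0 ≤ u) (hus : u ≤ s) (hs : s < timeOf c 0) :
    corr c s u = fundMat c (theta c s) (bOf c s) * fundInv c (theta c u) (bOf c u) := by
  have hex : ∃ Φ, IsCorrelationFunction c Φ := ⟨_, isCorrelationFunction_fund hc hce⟩
  rw [corr, dif_pos hex]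
  exact IsCorrelationFunction.eq hc hce hex.choose_spec h0 hus hs

theorem continuousOn_corr (hc : 0 < c) (hce : c ≤ Real.exp 1) {s : ℝ} (hs : s < timeOf c 0)
    (i j : Fin 4) : ContinuousOn (fun u => corr c s u i j) (Set.Icc 0 s) := by
  have h : ContinuousOn (fun u => (fundMat c (theta c s) (bOf c s)
      * fundInv c (theta c u) (bOf c u)) i j) (Set.Icc 0 s) := by
    simp only [Matrix.mul_apply]
    refine continuousOn_finsetSum _ fun k _ => continuousOn_const.mul fun u hu => ?_
    exact (differentiableAt_fundInv hc hu.1 (hu.2.trans_lt hs) k j).continuousAt.continuousWithinAt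
  exact h.congr fun u hu => by rw [corr_eq hc hce hu.1 hu.2 hs]

end

/-! ### Square-integrable functions -/

section L2

variable {Ω : Type*} [MeasurableSpace Ω] {P : Measure Ω}

theorem inner_toLp {X Y : Ω → ℝ} (hX : MemLp X 2 P) (hY : MemLp Y 2 P) :
    inner ℝ (hX.toLp X) (hY.toLp Y) = ∫ ω, X ω * Y ω ∂P := by
  rw [L2.inner_def]
  refine integral_congr_ae ?_
  filter_upwards [hX.coeFn_toLp, hY.coeFn_toLp] with ω h1 h2
  rw [h1, h2]
  simp [mul_comm]

theorem norm_sq_toLp {X : Ω → ℝ} (hX : MemLp X 2 P) :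
    ‖hX.toLp X‖ ^ 2 = ∫ ω, X ω ^ 2 ∂P := by
  rw [← real_inner_self_eq_norm_sq, inner_toLp hX hX]
  simp only [sq]

theorem eLpNorm_le_iff {X : Ω → ℝ} (hX : MemLp X 2 P) {ε : ℝ} (hε : 0 ≤ ε) :
    eLpNorm X 2 P ≤ ENNReal.ofReal ε ↔ ‖hX.toLp X‖ ≤ ε := by
  rw [Lp.norm_toLp, ← ENNReal.ofReal_le_ofReal_iff hε, ENNReal.ofReal_toReal hX.2.ne]

end L2

/-! ### Stochastic integrals with respect to orthogonal increments -/

section Orthogonal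

variable {Ω : Type*}

/-- The left-endpoint sum of a row-valued function. -/
def rowSum (g : ℝ → Fin 4 → ℝ) (N : ℝ → Ω → Fin 4 → ℝ) (n : ℕ) (t : ℕ → ℝ) (ω : Ω) : ℝ :=
  ∑ k ∈ Finset.range n, ∑ j, g (t k) j * (N (t (k + 1)) ω j - N (t k) ω j)

theorem leftSum_apply (f : ℝ → Matrix (Fin 4) (Fin 4) ℝ) (N : ℝ → Ω → Fin 4 → ℝ) (n : ℕ)
    (t : ℕ → ℝ) (ω : Ω) (i : Fin 4) :
    leftSum f N n t ω i = rowSum (fun u => f u i) N n t ω := by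
  simp [leftSum, rowSum, Matrix.mulVec, dotProduct]

theorem sum_mul_leftSum (ρ : Fin 4 → ℝ) (f : ℝ → Matrix (Fin 4) (Fin 4) ℝ)
    (N : ℝ → Ω → Fin 4 → ℝ) (n : ℕ) (t : ℕ → ℝ) (ω : Ω) :
    ∑ i, ρ i * leftSum f N n t ω i = rowSum (fun u => ρ ᵥ* f u) N n t ω := by
  simp only [leftSum_apply, rowSum, Finset.mul_sum, Matrix.vecMul, dotProduct, Finset.sum_mul]
  rw [Finset.sum_comm]
  refine Finset.sum_congr rfl fun k _ => ?_
  rw [Finset.sum_comm]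
  exact Finset.sum_congr rfl fun j _ => Finset.sum_congr rfl fun i _ => by ring

variable [MeasurableSpace Ω]

/-- On `[0, s]`, the process `N` has square-integrable orthogonal increments with covariance
density `Q`. -/
structure OrthogonalIncrements (P : Measure Ω) (N : ℝ → Ω → Fin 4 → ℝ)
    (Q : ℝ → Matrix (Fin 4) (Fin 4) ℝ) (s : ℝ) : Prop where
  memLp : ∀ t ∈ Set.Icc 0 s, ∀ i, MemLp (fun ω => N t ω i) 2 P
  integrable : ∀ i j, IntegrableOn (fun u => Q u i j) (Set.Ioc 0 s)
  inner_eq : ∀ a ∈ Set.Icc 0 s, ∀ b ∈ Set.Icc 0 s, ∀ a' ∈ Set.Icc 0 s, ∀ b' ∈ Set.Icc 0 s,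
    a ≤ b → a' ≤ b' → ∀ i j,
    ∫ ω, (N b ω i - N a ω i) * (N b' ω j - N a' ω j) ∂P
      = ∫ u in Set.Ioc 0 s, (Set.Ioc a b).indicator 1 u * (Set.Ioc a' b').indicator 1 u * Q u i j

/-- `t` describes a partition of `[0, s]` into `n` intervals. -/
structure IsPartition (s : ℝ) (n : ℕ) (t : ℕ → ℝ) : Prop where
  mono : Monotone t
  zero : t 0 = 0
  last : t n = s

theorem IsPartition.mem {s : ℝ} {n : ℕ} {t : ℕ → ℝ} (h : IsPartition s n t) {k : ℕ} (hk : k ≤ n) :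
    t k ∈ Set.Icc 0 s :=
  ⟨h.zero ▸ h.mono (Nat.zero_le k), h.last ▸ h.mono hk⟩

/-- The step function that takes the left-endpoint values of `g`. -/
noncomputable def stepFn (g : ℝ → Fin 4 → ℝ) (n : ℕ) (t : ℕ → ℝ) (u : ℝ) (j : Fin 4) : ℝ :=
  ∑ k ∈ Finset.range n, g (t k) j * (Set.Ioc (t k) (t (k + 1))).indicator 1 u

/-- The interval containing u ends at the first partition point that is at least u. This point is
not t 0 because u > 0, and the choice is the same for all g. -/
theorem stepFn_eq {s : ℝ} {n : ℕ} {t : ℕ → ℝ} (ht : IsPartition s n t) {u : ℝ}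
    (hu : u ∈ Set.Ioc 0 s) :
    ∃ k < n, u ∈ Set.Ioc (t k) (t (k + 1)) ∧ ∀ g : ℝ → Fin 4 → ℝ, stepFn g n t u = g (t k) := by
  classical
  have hex : ∃ m, u ≤ t m := ⟨n, by rw [ht.last]; exact hu.2⟩
  have hm0 : Nat.find hex ≠ 0 := by
    intro h
    have := Nat.find_spec hex
    rw [h, ht.zero] at this
    exact absurd hu.1 (not_lt.2 this)
  obtain ⟨k, hk⟩ := Nat.exists_eq_succ_of_ne_zero hm0
  have h1 : u ≤ t (k + 1) := by
    have := Nat.find_spec hex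
    rwa [hk] at this
  have h2 : t k < u := not_le.1 (Nat.find_min hex (by omega))
  have hkn : k < n := by
    have : Nat.find hex ≤ n := Nat.find_min' hex (by rw [ht.last]; exact hu.2)
    omega
  refine ⟨k, hkn, ⟨h2, h1⟩, fun g => ?_⟩
  ext j
  rw [stepFn, Finset.sum_eq_single k]
  · rw [Set.indicator_of_mem (show u ∈ Set.Ioc (t k) (t (k + 1)) from ⟨h2, h1⟩)]
    simp
  · intro l _ hl
    rw [Set.indicator_of_notMem, mul_zero]
    rintro ⟨h3, h4⟩
    rcases lt_or_gt_of_ne hl with h | h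
    · exact absurd (h4.trans (ht.mono (Nat.succ_le_of_lt h))) (not_le.2 h2)
    · exact absurd (h1.trans (ht.mono (Nat.succ_le_of_lt h))) (not_le.2 h3)
  · intro h
    exact absurd (Finset.mem_range.2 hkn) h

theorem exists_mesh {s : ℝ} {g : ℝ → Fin 4 → ℝ}
    (hg : ∀ j, ContinuousOn (fun u => g u j) (Set.Icc 0 s)) {ε : ℝ} (hε : 0 < ε) :
    ∃ η : ℝ, 0 < η ∧ ∀ (n : ℕ) (t : ℕ → ℝ), IsPartition s n t →
      (∀ k, k < n → t (k + 1) - t k ≤ η) → ∀ u ∈ Set.Ioc 0 s, ∀ j,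
        |stepFn g n t u j - g u j| ≤ ε := by
  have hg' : ContinuousOn g (Set.Icc 0 s) := continuousOn_pi.2 hg
  have huc := isCompact_Icc.uniformContinuousOn_of_continuous hg'
  rw [Metric.uniformContinuousOn_iff_le] at huc
  obtain ⟨η, hη, h⟩ := huc ε hε
  refine ⟨η, hη, fun n t ht hmesh u hu j => ?_⟩
  obtain ⟨k, hk, hku, hs⟩ := stepFn_eq ht hu
  rw [hs g]
  have := h (t k) (ht.mem hk.le) u ⟨hu.1.le, hu.2⟩ (by
    rw [Real.dist_eq, abs_sub_comm, abs_of_nonneg (by linarith [hku.1])]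
    linarith [hku.2, hmesh k hk])
  exact (dist_le_pi_dist (g (t k)) (g u) j).trans this

/-- The quadratic form of a matrix. -/
def quad (A : Matrix (Fin 4) (Fin 4) ℝ) (v w : Fin 4 → ℝ) : ℝ := ∑ i, ∑ j, v i * w j * A i j

theorem abs_quad_le (A : Matrix (Fin 4) (Fin 4) ℝ) {v w : Fin 4 → ℝ} {ε K : ℝ}
    (hv : ∀ i, |v i| ≤ ε) (hw : ∀ i, |w i| ≤ K) :
    |quad A v w| ≤ ε * K * ∑ i, ∑ j, |A i j| := by
  rw [quad, Finset.mul_sum]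
  refine (Finset.abs_sum_le_sum_abs _ _).trans (Finset.sum_le_sum fun i _ => ?_)
  rw [Finset.mul_sum]
  refine (Finset.abs_sum_le_sum_abs _ _).trans (Finset.sum_le_sum fun j _ => ?_)
  rw [abs_mul, abs_mul]
  have h0 : 0 ≤ ε := (abs_nonneg _).trans (hv i)
  have := hv i
  have := hw j
  gcongr

namespace OrthogonalIncrements

variable {P : Measure Ω} {N : ℝ → Ω → Fin 4 → ℝ} {Q : ℝ → Matrix (Fin 4) (Fin 4) ℝ} {s : ℝ}

theorem memLp_rowSum (hN : OrthogonalIncrements P N Q s) {n : ℕ} {t : ℕ → ℝ}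
    (ht : IsPartition s n t) (g : ℝ → Fin 4 → ℝ) : MemLp (rowSum g N n t) 2 P := by
  refine memLp_finsetSum _ fun k hk => memLp_finsetSum _ fun j _ => MemLp.const_mul ?_ _
  have hk' := Finset.mem_range.1 hk
  exact (hN.memLp _ (ht.mem hk') j).sub (hN.memLp _ (ht.mem hk'.le) j)

/-- The isometry for step functions, allowing two different partitions: both sides are expanded
bilinearly and `inner_eq` matches them term by term. -/
theorem integral_rowSum_mul (hN : OrthogonalIncrements P N Q s) {n n' : ℕ} {t t' : ℕ → ℝ}
    (ht : IsPartition s n t) (ht' : IsPartition s n' t') (g g' : ℝ → Fin 4 → ℝ) :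
    ∫ ω, rowSum g N n t ω * rowSum g' N n' t' ω ∂P
      = ∫ u in Set.Ioc 0 s, quad (Q u) (stepFn g n t u) (stepFn g' n' t' u) := by
  have hL : ∀ ω, rowSum g N n t ω * rowSum g' N n' t' ω
      = ∑ p ∈ Finset.range n ×ˢ Finset.univ, ∑ q ∈ Finset.range n' ×ˢ Finset.univ,
        g (t p.1) p.2 * g' (t' q.1) q.2 * ((N (t (p.1 + 1)) ω p.2 - N (t p.1) ω p.2)
          * (N (t' (q.1 + 1)) ω q.2 - N (t' q.1) ω q.2)) := by
    intro ω
    rw [rowSum, rowSum, ← Finset.sum_product', ← Finset.sum_product', Finset.sum_mul_sum]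
    exact Finset.sum_congr rfl fun p _ => Finset.sum_congr rfl fun q _ => by ring
  have hR : ∀ u, quad (Q u) (stepFn g n t u) (stepFn g' n' t' u)
      = ∑ p ∈ Finset.range n ×ˢ Finset.univ, ∑ q ∈ Finset.range n' ×ˢ Finset.univ,
        g (t p.1) p.2 * g' (t' q.1) q.2 * ((Set.Ioc (t p.1) (t (p.1 + 1))).indicator 1 u
          * (Set.Ioc (t' q.1) (t' (q.1 + 1))).indicator 1 u * Q u p.2 q.2) := by
    intro u
    rw [Finset.sum_product_right]
    simp only [quad, stepFn]
    refine Finset.sum_congr rfl fun i _ => ?_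
    simp only [Finset.sum_product_right]
    rw [Finset.sum_comm (s := Finset.range n)]
    refine Finset.sum_congr rfl fun j _ => ?_
    rw [Finset.sum_mul_sum, Finset.sum_mul]
    refine Finset.sum_congr rfl fun k _ => ?_
    rw [Finset.sum_mul]
    exact Finset.sum_congr rfl fun k' _ => by ring
  have hmem : ∀ {n : ℕ} {t : ℕ → ℝ}, IsPartition s n t → ∀ p ∈ Finset.range n ×ˢ
      (Finset.univ : Finset (Fin 4)), t p.1 ∈ Set.Icc 0 s ∧ t (p.1 + 1) ∈ Set.Icc 0 s := by
    intro n t ht p hp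
    have hp' := Finset.mem_range.1 (Finset.mem_product.1 hp).1
    exact ⟨ht.mem hp'.le, ht.mem hp'⟩
  simp only [hL, hR]
  have hI1 : ∀ p ∈ Finset.range n ×ˢ (Finset.univ : Finset (Fin 4)),
      ∀ q ∈ Finset.range n' ×ˢ (Finset.univ : Finset (Fin 4)),
      Integrable (fun ω => g (t p.1) p.2 * g' (t' q.1) q.2 *
        ((N (t (p.1 + 1)) ω p.2 - N (t p.1) ω p.2)
          * (N (t' (q.1 + 1)) ω q.2 - N (t' q.1) ω q.2))) P := by
    intro p hp q hq
    obtain ⟨h1, h2⟩ := hmem ht p hp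
    obtain ⟨h3, h4⟩ := hmem ht' q hq
    exact (MemLp.integrable_mul ((hN.memLp _ h2 _).sub (hN.memLp _ h1 _))
      ((hN.memLp _ h4 _).sub (hN.memLp _ h3 _))).const_mul _
  have hI2 : ∀ p ∈ Finset.range n ×ˢ (Finset.univ : Finset (Fin 4)),
      ∀ q ∈ Finset.range n' ×ˢ (Finset.univ : Finset (Fin 4)),
      IntegrableOn (fun u => g (t p.1) p.2 * g' (t' q.1) q.2 *
        ((Set.Ioc (t p.1) (t (p.1 + 1))).indicator 1 u
          * (Set.Ioc (t' q.1) (t' (q.1 + 1))).indicator 1 u * Q u p.2 q.2)) (Set.Ioc 0 s) := by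
    intro p hp q hq
    refine Integrable.const_mul ?_ _
    have : (fun u => (Set.Ioc (t p.1) (t (p.1 + 1))).indicator (1 : ℝ → ℝ) u
        * (Set.Ioc (t' q.1) (t' (q.1 + 1))).indicator 1 u * Q u p.2 q.2)
        = (Set.Ioc (t p.1) (t (p.1 + 1)) ∩ Set.Ioc (t' q.1) (t' (q.1 + 1))).indicator
          (fun u => Q u p.2 q.2) := by
      ext u
      by_cases h1 : u ∈ Set.Ioc (t p.1) (t (p.1 + 1)) <;>
      by_cases h2 : u ∈ Set.Ioc (t' q.1) (t' (q.1 + 1)) <;>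
      simp [Set.indicator, h1, h2]
    rw [this]
    exact (hN.integrable _ _).indicator (measurableSet_Ioc.inter measurableSet_Ioc)
  rw [integral_finsetSum _ fun p hp => integrable_finsetSum _ fun q hq => hI1 p hp q hq,
    integral_finsetSum _ fun p hp => integrable_finsetSum _ fun q hq => hI2 p hp q hq]
  refine Finset.sum_congr rfl fun p hp => ?_
  rw [integral_finsetSum _ (hI1 p hp), integral_finsetSum _ (hI2 p hp)]
  refine Finset.sum_congr rfl fun q hq => ?_
  rw [integral_const_mul, integral_const_mul]
  obtain ⟨h1, h2⟩ := hmem ht p hp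
  obtain ⟨h3, h4⟩ := hmem ht' q hq
  rw [hN.inner_eq _ h1 _ h2 _ h3 _ h4 (ht.mono (Nat.le_succ _)) (ht'.mono (Nat.le_succ _))]

theorem measurable_stepFn (g : ℝ → Fin 4 → ℝ) (n : ℕ) (t : ℕ → ℝ) (j : Fin 4) :
    Measurable fun u => stepFn g n t u j :=
  Finset.measurable_fun_sum _ fun _ _ =>
    (measurable_const.indicator measurableSet_Ioc).const_mul _

theorem integrableOn_sum_abs (hN : OrthogonalIncrements P N Q s) :
    IntegrableOn (fun u => ∑ i, ∑ j, |Q u i j|) (Set.Ioc 0 s) :=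
  integrable_finsetSum _ fun i _ => integrable_finsetSum _ fun j _ => (hN.integrable i j).abs

theorem integrableOn_quad (hN : OrthogonalIncrements P N Q s) {a b : ℝ → Fin 4 → ℝ}
    (ha : ∀ i, AEStronglyMeasurable (fun u => a u i) (volume.restrict (Set.Ioc 0 s)))
    (hb : ∀ i, AEStronglyMeasurable (fun u => b u i) (volume.restrict (Set.Ioc 0 s)))
    {K L : ℝ} (hK : ∀ u ∈ Set.Ioc 0 s, ∀ i, |a u i| ≤ K)
    (hL : ∀ u ∈ Set.Ioc 0 s, ∀ i, |b u i| ≤ L) :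
    IntegrableOn (fun u => quad (Q u) (a u) (b u)) (Set.Ioc 0 s) := by
  refine integrable_finsetSum _ fun i _ => integrable_finsetSum _ fun j _ => ?_
  refine (hN.integrable i j).bdd_mul (c := K * L) ((ha i).mul (hb j)) ?_
  filter_upwards [ae_restrict_mem measurableSet_Ioc] with u hu
  rw [norm_mul, Real.norm_eq_abs, Real.norm_eq_abs]
  have h1 := hK u hu i
  have h2 := hL u hu j
  have h0 : 0 ≤ K := (abs_nonneg _).trans h1
  gcongr

theorem exists_bound {g : ℝ → Fin 4 → ℝ} (hg : ∀ j, ContinuousOn (fun u => g u j) (Set.Icc 0 s)) :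
    ∃ G : ℝ, ∀ u ∈ Set.Icc 0 s, ∀ j, |g u j| ≤ G := by
  obtain ⟨G, hG⟩ := isCompact_Icc.exists_bound_of_continuousOn (continuousOn_pi.2 hg)
  exact ⟨G, fun u hu j => (norm_le_pi_norm (g u) j).trans (hG u hu)⟩

theorem stepFn_bound {g : ℝ → Fin 4 → ℝ} {G : ℝ} (hG : ∀ u ∈ Set.Icc 0 s, ∀ j, |g u j| ≤ G)
    {n : ℕ} {t : ℕ → ℝ} (ht : IsPartition s n t) :
    ∀ u ∈ Set.Ioc 0 s, ∀ j, |stepFn g n t u j| ≤ G := by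
  intro u hu j
  obtain ⟨k, hk, -, h⟩ := stepFn_eq ht hu
  rw [h]
  exact hG _ (ht.mem hk.le) j

/-- Left-endpoint sums over fine partitions are close to each other. -/
theorem norm_sub_rowSum_le (hN : OrthogonalIncrements P N Q s) {g : ℝ → Fin 4 → ℝ}
    (hg : ∀ j, ContinuousOn (fun u => g u j) (Set.Icc 0 s))
    {n n' : ℕ} {t t' : ℕ → ℝ} (ht : IsPartition s n t) (ht' : IsPartition s n' t') {ε : ℝ}
    (h : ∀ u ∈ Set.Ioc 0 s, ∀ j, |stepFn g n t u j - g u j| ≤ ε)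
    (h' : ∀ u ∈ Set.Ioc 0 s, ∀ j, |stepFn g n' t' u j - g u j| ≤ ε) :
    ‖(hN.memLp_rowSum ht g).toLp _ - (hN.memLp_rowSum ht' g).toLp _‖ ^ 2
      ≤ (2 * ε) ^ 2 * ∫ u in Set.Ioc 0 s, ∑ i, ∑ j, |Q u i j| := by
  obtain ⟨G, hG⟩ := exists_bound hg
  have hm : ∀ (n : ℕ) (t : ℕ → ℝ) (i : Fin 4),
      AEStronglyMeasurable (fun u => stepFn g n t u i) (volume.restrict (Set.Ioc 0 s)) :=
    fun n t i => (measurable_stepFn g n t i).aestronglyMeasurable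
  have hq : ∀ {n n' : ℕ} {t t' : ℕ → ℝ}, IsPartition s n t → IsPartition s n' t' →
      IntegrableOn (fun u => quad (Q u) (stepFn g n t u) (stepFn g n' t' u)) (Set.Ioc 0 s) :=
    fun h1 h2 => hN.integrableOn_quad (hm _ _) (hm _ _) (stepFn_bound hG h1) (stepFn_bound hG h2)
  -- The two cross terms are kept apart, since Q is not assumed symmetric; the four quadratic forms
  -- then recombine into that of the difference of the step functions.
  rw [norm_sub_sq_real, ← real_inner_self_eq_norm_sq, ← real_inner_self_eq_norm_sq, two_mul]
  nth_rw 3 [real_inner_comm]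
  rw [inner_toLp, inner_toLp, inner_toLp, inner_toLp, hN.integral_rowSum_mul ht ht,
    hN.integral_rowSum_mul ht ht', hN.integral_rowSum_mul ht' ht, hN.integral_rowSum_mul ht' ht']
  have i1 := hq ht ht
  have i2 := hq ht ht'
  have i3 := hq ht' ht
  have i4 := hq ht' ht'
  have i23 : IntegrableOn (fun u => quad (Q u) (stepFn g n t u) (stepFn g n' t' u)
    + quad (Q u) (stepFn g n' t' u) (stepFn g n t u)) (Set.Ioc 0 s) := i2.add i3
  have i123 : IntegrableOn (fun u => quad (Q u) (stepFn g n t u) (stepFn g n t u)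
    - (quad (Q u) (stepFn g n t u) (stepFn g n' t' u)
      + quad (Q u) (stepFn g n' t' u) (stepFn g n t u))) (Set.Ioc 0 s) := i1.sub i23
  rw [← integral_add i2 i3, ← integral_sub i1 i23, ← integral_add i123 i4, ← integral_const_mul]
  refine setIntegral_mono_on (i123.add i4)
    (hN.integrableOn_sum_abs.const_mul _) measurableSet_Ioc fun u hu => ?_
  have hd : ∀ j, |stepFn g n t u j - stepFn g n' t' u j| ≤ 2 * ε := by
    intro j
    have h1 := abs_le.1 (h u hu j)
    have h2 := abs_le.1 (h' u hu j)
    rw [abs_le]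
    constructor <;> linarith
  have := (le_abs_self _).trans (abs_quad_le (Q u)
    (v := fun j => stepFn g n t u j - stepFn g n' t' u j)
    (w := fun j => stepFn g n t u j - stepFn g n' t' u j) hd hd)
  refine le_trans (le_of_eq ?_) (this.trans_eq (by ring))
  simp only [quad, ← Finset.sum_add_distrib, ← Finset.sum_sub_distrib]
  exact Finset.sum_congr rfl fun i _ => Finset.sum_congr rfl fun j _ => by ring

end OrthogonalIncrements

/-- The partition points of the partition of `[0, s]` into `m + 1` equal intervals. -/
noncomputable def uniform (s : ℝ) (m k : ℕ) : ℝ := s * k / (m + 1)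

theorem isPartition_uniform {s : ℝ} (hs : 0 ≤ s) (m : ℕ) : IsPartition s (m + 1) (uniform s m) := by
  refine ⟨fun k l hkl => ?_, by simp [uniform], ?_⟩
  · have : (k : ℝ) ≤ l := by exact_mod_cast hkl
    rw [uniform, uniform]
    gcongr
  · rw [uniform]
    push_cast
    field_simp

theorem uniform_succ_sub (s : ℝ) (m k : ℕ) : uniform s m (k + 1) - uniform s m k = s / (m + 1) := by
  rw [uniform, uniform]
  push_cast
  ring

theorem eventually_uniform_mesh (s : ℝ) {η : ℝ} (hη : 0 < η) :
    ∀ᶠ m : ℕ in atTop, ∀ k, k < m + 1 → uniform s m (k + 1) - uniform s m k ≤ η := by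
  have h : Tendsto (fun m : ℕ => s / ((m : ℝ) + 1)) atTop (𝓝 0) :=
    tendsto_const_div_atTop_nhds_zero_nat s |>.comp (tendsto_add_atTop_nat 1) |>.congr fun m => by
      simp
  filter_upwards [h.eventually (gt_mem_nhds hη)] with m hm k _
  rw [uniform_succ_sub]
  exact hm.le

/-! ### Existence of the integral, orthogonality and the isometry. -/

namespace OrthogonalIncrements

variable {P : Measure Ω} {N : ℝ → Ω → Fin 4 → ℝ} {Q : ℝ → Matrix (Fin 4) (Fin 4) ℝ} {s : ℝ}

theorem exists_mesh_norm (hN : OrthogonalIncrements P N Q s) {g : ℝ → Fin 4 → ℝ}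
    (hg : ∀ j, ContinuousOn (fun u => g u j) (Set.Icc 0 s)) {ε : ℝ} (hε : 0 < ε) :
    ∃ η : ℝ, 0 < η ∧ ∀ (n n' : ℕ) (t t' : ℕ → ℝ) (ht : IsPartition s n t)
      (ht' : IsPartition s n' t'), (∀ k, k < n → t (k + 1) - t k ≤ η) →
      (∀ k, k < n' → t' (k + 1) - t' k ≤ η) →
      ‖(hN.memLp_rowSum ht g).toLp _ - (hN.memLp_rowSum ht' g).toLp _‖ ≤ ε := by
  set K := ∫ u in Set.Ioc 0 s, ∑ i, ∑ j, |Q u i j| with hKdef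
  have hK : 0 ≤ K := integral_nonneg fun u =>
    Finset.sum_nonneg fun i _ => Finset.sum_nonneg fun j _ => abs_nonneg _
  -- With this tolerance the squared distance is at most ε²K/(K + 1)² ≤ ε²; the added 1 covers K =
  -- 0.
  obtain ⟨η, hη, h⟩ := exists_mesh hg (ε := ε / (2 * (K + 1))) (by positivity)
  refine ⟨η, hη, fun n n' t t' ht ht' h1 h2 => ?_⟩
  have := hN.norm_sub_rowSum_le hg ht ht' (h n t ht h1) (h n' t' ht' h2)
  refine abs_le_of_sq_le_sq' (this.trans ?_) hε.le |>.2
  rw [← hKdef, show 2 * (ε / (2 * (K + 1))) = ε / (K + 1) by field_simp, div_pow, div_mul_eq_mul_div,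
    div_le_iff₀ (by positivity)]
  have : K ≤ (K + 1) ^ 2 := by nlinarith
  gcongr

/-- Existence of the Wiener-Itô integral of a continuous function. -/
theorem exists_isStochIntegral (hN : OrthogonalIncrements P N Q s) (hs : 0 ≤ s)
    {f : ℝ → Matrix (Fin 4) (Fin 4) ℝ}
    (hf : ∀ i j, ContinuousOn (fun u => f u i j) (Set.Icc 0 s)) :
    ∃ Y, IsStochIntegral P f N s Y := by
  have hlim : ∀ i, ∃ L : Lp ℝ 2 P, Tendsto (fun m => (hN.memLp_rowSum (isPartition_uniform hs m)
      (fun u => f u i)).toLp _) atTop (𝓝 L) := by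
    intro i
    refine cauchySeq_tendsto_of_complete (Metric.cauchySeq_iff'.2 fun ε hε => ?_)
    obtain ⟨η, hη, h⟩ := hN.exists_mesh_norm (hf i) (half_pos hε)
    obtain ⟨m, hm⟩ := eventually_atTop.1 (eventually_uniform_mesh s hη)
    refine ⟨m, fun m' hm' => ?_⟩
    rw [dist_eq_norm]
    exact (h _ _ _ _ (isPartition_uniform hs m') (isPartition_uniform hs m) (hm m' hm')
      (hm m le_rfl)).trans_lt (half_lt_self hε)
  choose L hL using hlim
  refine ⟨fun ω i => L i ω, fun i => Lp.memLp (L i), fun ε hε => ?_⟩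
  have hη : ∀ i, ∃ η : ℝ, 0 < η ∧ ∀ (n : ℕ) (t : ℕ → ℝ), Monotone t → t 0 = 0 → t n = s →
      (∀ k, k < n → t (k + 1) - t k ≤ η) →
      eLpNorm (fun ω => leftSum f N n t ω i - L i ω) 2 P ≤ ENNReal.ofReal ε := by
    intro i
    obtain ⟨η, hη, h⟩ := hN.exists_mesh_norm (hf i) hε
    refine ⟨η, hη, fun n t h1 h2 h3 h4 => ?_⟩
    have ht : IsPartition s n t := ⟨h1, h2, h3⟩
    have hmem : MemLp (fun ω => leftSum f N n t ω i - L i ω) 2 P := by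
      simp only [leftSum_apply]
      exact (hN.memLp_rowSum ht fun u => f u i).sub (Lp.memLp (L i))
    rw [eLpNorm_le_iff hmem hε.le]
    have heq : hmem.toLp _ = (hN.memLp_rowSum ht fun u => f u i).toLp _ - L i := by
      conv_rhs => rw [← Lp.toLp_coeFn (L i) (Lp.memLp (L i))]
      rw [← MemLp.toLp_sub]
      exact MemLp.toLp_congr _ _ (ae_of_all _ fun ω => by simp [leftSum_apply])
    rw [heq]
    -- An arbitrary fine partition is compared with the uniform ones, whose sums define L; the bound
    -- survives the limit.
    refine le_of_tendsto (tendsto_const_nhds.sub (hL i)).norm ?_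
    filter_upwards [eventually_uniform_mesh s hη] with m hm
    exact h _ _ _ _ ht (isPartition_uniform hs m) h4 hm
  choose η hη0 hη using hη
  obtain ⟨i₀, hi₀⟩ := Finite.exists_min η
  exact ⟨η i₀, hη0 i₀, fun n t h1 h2 h3 h4 i =>
    hη i n t h1 h2 h3 fun k hk => (h4 k hk).trans (hi₀ i)⟩

theorem memLp_sum_mul {Y : Ω → Fin 4 → ℝ} (hY : ∀ i, MemLp (fun ω => Y ω i) 2 P)
    (ρ : Fin 4 → ℝ) : MemLp (fun ω => ∑ i, ρ i * Y ω i) 2 P :=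
  memLp_finsetSum _ fun i _ => (hY i).const_mul _

/-- Left-endpoint sums over uniform partitions converge to the integral. -/
theorem tendsto_toLp (hN : OrthogonalIncrements P N Q s) (hs : 0 ≤ s)
    {f : ℝ → Matrix (Fin 4) (Fin 4) ℝ} {Y : Ω → Fin 4 → ℝ} (hY : IsStochIntegral P f N s Y)
    (ρ : Fin 4 → ℝ) :
    Tendsto (fun m => (hN.memLp_rowSum (isPartition_uniform hs m) (fun u => ρ ᵥ* f u)).toLp _) atTop
      (𝓝 ((memLp_sum_mul hY.1 ρ).toLp _)) := by
  have hcomp : ∀ i, Tendsto (fun m => (hN.memLp_rowSum (isPartition_uniform hs m)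
      (fun u => f u i)).toLp _) atTop (𝓝 ((hY.1 i).toLp _)) := by
    intro i
    refine Metric.tendsto_atTop'.2 fun ε hε => ?_
    obtain ⟨η, hη, h⟩ := hY.2 (ε / 2) (half_pos hε)
    obtain ⟨m, hm⟩ := eventually_atTop.1 (eventually_uniform_mesh s hη)
    refine ⟨m, fun m' hm' => ?_⟩
    have ht := isPartition_uniform hs m'
    have := h (m' + 1) (uniform s m') ht.mono ht.zero ht.last (hm m' hm'.le) i
    simp only [leftSum_apply] at this
    have hmem := (hN.memLp_rowSum ht fun u => f u i).sub (hY.1 i)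
    rw [dist_eq_norm, ← MemLp.toLp_sub]
    exact ((eLpNorm_le_iff hmem (half_pos hε).le).1 this).trans_lt (half_lt_self hε)
  have hsum := tendsto_finsetSum Finset.univ fun i _ => (hcomp i).const_smul (ρ i)
  have e1 : ∑ i, ρ i • (hY.1 i).toLp _ = (memLp_sum_mul hY.1 ρ).toLp _ := by
    refine Lp.ext ?_
    filter_upwards [Lp.coeFn_finsetSum Finset.univ fun i => ρ i • (hY.1 i).toLp _,
      (memLp_sum_mul hY.1 ρ).coeFn_toLp, ae_all_iff.2 fun i => Lp.coeFn_smul (ρ i) ((hY.1 i).toLp _),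
      ae_all_iff.2 fun i => (hY.1 i).coeFn_toLp] with ω h1 h2 h3 h4
    rw [h1, h2, Finset.sum_apply]
    exact Finset.sum_congr rfl fun i _ => by rw [h3 i, Pi.smul_apply, h4 i, smul_eq_mul]
  rw [← e1]
  refine hsum.congr fun m => ?_
  have hm := fun i => hN.memLp_rowSum (isPartition_uniform hs m) (fun u => f u i)
  refine Lp.ext ?_
  filter_upwards [Lp.coeFn_finsetSum Finset.univ fun i => ρ i • (hm i).toLp _,
    (hN.memLp_rowSum (isPartition_uniform hs m) (fun u => ρ ᵥ* f u)).coeFn_toLp,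
    ae_all_iff.2 fun i => Lp.coeFn_smul (ρ i) ((hm i).toLp _),
    ae_all_iff.2 fun i => (hm i).coeFn_toLp] with ω h1 h2 h3 h4
  rw [h1, h2, Finset.sum_apply, ← sum_mul_leftSum]
  exact Finset.sum_congr rfl fun i _ => by
    rw [h3 i, Pi.smul_apply, h4 i, smul_eq_mul, leftSum_apply]

/-- A square-integrable variable that is orthogonal to all left-endpoint sums is orthogonal to the
integral. -/
theorem integral_mul_eq_zero (hN : OrthogonalIncrements P N Q s) (hs : 0 ≤ s)
    {f : ℝ → Matrix (Fin 4) (Fin 4) ℝ} {Y : Ω → Fin 4 → ℝ} (hY : IsStochIntegral P f N s Y)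
    (ρ : Fin 4 → ℝ) {X : Ω → ℝ} (hX : MemLp X 2 P)
    (h : ∀ t ∈ Set.Icc 0 s, ∀ i, ∫ ω, N t ω i * X ω ∂P = 0) :
    ∫ ω, (∑ i, ρ i * Y ω i) * X ω ∂P = 0 := by
  rw [← inner_toLp (memLp_sum_mul hY.1 ρ) hX]
  refine tendsto_nhds_unique ((hN.tendsto_toLp hs hY ρ).inner tendsto_const_nhds) ?_
  refine tendsto_const_nhds.congr fun m => ?_
  have ht := isPartition_uniform hs m
  rw [inner_toLp]
  simp only [rowSum, Finset.sum_mul]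
  have hI : ∀ k ∈ Finset.range (m + 1), ∀ j ∈ (Finset.univ : Finset (Fin 4)),
      Integrable (fun ω => (ρ ᵥ* f (uniform s m k)) j
        * (N (uniform s m (k + 1)) ω j - N (uniform s m k) ω j) * X ω) P := by
    intro k hk j _
    have hk' := Finset.mem_range.1 hk
    exact MemLp.integrable_mul (((hN.memLp _ (ht.mem hk') j).sub
      (hN.memLp _ (ht.mem hk'.le) j)).const_mul _) hX
  rw [integral_finsetSum _ fun k hk => integrable_finsetSum _ fun j hj => hI k hk j hj]
  refine (Finset.sum_eq_zero fun k hk => ?_).symm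
  rw [integral_finsetSum _ (hI k hk)]
  refine Finset.sum_eq_zero fun j _ => ?_
  have hk' := Finset.mem_range.1 hk
  have e : ∀ ω, (ρ ᵥ* f (uniform s m k)) j
        * (N (uniform s m (k + 1)) ω j - N (uniform s m k) ω j) * X ω
      = (ρ ᵥ* f (uniform s m k)) j * (N (uniform s m (k + 1)) ω j * X ω
        - N (uniform s m k) ω j * X ω) := fun ω => by ring
  simp only [e]
  rw [integral_const_mul, integral_sub, h _ (ht.mem hk'), h _ (ht.mem hk'.le), sub_zero, mul_zero]
  · exact MemLp.integrable_mul (hN.memLp _ (ht.mem hk') j) hX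
  · exact MemLp.integrable_mul (hN.memLp _ (ht.mem hk'.le) j) hX

/-- The Itô isometry. -/
theorem integral_sq (hN : OrthogonalIncrements P N Q s) (hs : 0 ≤ s)
    {f : ℝ → Matrix (Fin 4) (Fin 4) ℝ}
    (hf : ∀ i j, ContinuousOn (fun u => f u i j) (Set.Icc 0 s))
    {Y : Ω → Fin 4 → ℝ} (hY : IsStochIntegral P f N s Y) (ρ : Fin 4 → ℝ) :
    ∫ ω, (∑ i, ρ i * Y ω i) ^ 2 ∂P
      = ∫ u in Set.Ioc 0 s, quad (Q u) (ρ ᵥ* f u) (ρ ᵥ* f u) := by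
  rw [← norm_sq_toLp (memLp_sum_mul hY.1 ρ)]
  have hlim := ((hN.tendsto_toLp hs hY ρ).norm).pow 2
  refine tendsto_nhds_unique hlim ?_
  have hg : ∀ j, ContinuousOn (fun u => (ρ ᵥ* f u) j) (Set.Icc 0 s) := by
    intro j
    simp only [Matrix.vecMul, dotProduct]
    exact continuousOn_finsetSum _ fun i _ => continuousOn_const.mul (hf i j)
  obtain ⟨G, hG⟩ := exists_bound hg
  have hval : ∀ m, ‖(hN.memLp_rowSum (isPartition_uniform hs m) (fun u => ρ ᵥ* f u)).toLp _‖ ^ 2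
      = ∫ u in Set.Ioc 0 s, quad (Q u) (stepFn (fun u => ρ ᵥ* f u) (m + 1) (uniform s m) u)
        (stepFn (fun u => ρ ᵥ* f u) (m + 1) (uniform s m) u) := by
    intro m
    rw [← real_inner_self_eq_norm_sq, inner_toLp,
      hN.integral_rowSum_mul (isPartition_uniform hs m) (isPartition_uniform hs m)]
  simp only [hval]
  refine tendsto_integral_of_dominated_convergence
    (fun u => G * G * ∑ i, ∑ j, |Q u i j|) (fun m => ?_) (hN.integrableOn_sum_abs.const_mul _)
    (fun m => ?_) ?_
  · have hb := stepFn_bound hG (isPartition_uniform hs m)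
    have hm := fun i => (measurable_stepFn (fun u => ρ ᵥ* f u) (m + 1) (uniform s m)
      i).aestronglyMeasurable (μ := volume.restrict (Set.Ioc 0 s))
    exact (hN.integrableOn_quad hm hm hb hb).aestronglyMeasurable
  · filter_upwards [ae_restrict_mem measurableSet_Ioc] with u hu
    have hb := stepFn_bound hG (isPartition_uniform hs m) u hu
    exact abs_quad_le _ hb hb
  · filter_upwards [ae_restrict_mem measurableSet_Ioc] with u hu
    have hstep : ∀ j, Tendsto (fun m => stepFn (fun u => ρ ᵥ* f u) (m + 1) (uniform s m) u j) atTop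
        (𝓝 ((ρ ᵥ* f u) j)) := by
      intro j
      refine Metric.tendsto_atTop'.2 fun ε hε => ?_
      obtain ⟨η, hη, h⟩ := exists_mesh hg (half_pos hε)
      obtain ⟨m, hm⟩ := eventually_atTop.1 (eventually_uniform_mesh s hη)
      exact ⟨m, fun m' hm' => (h _ _ (isPartition_uniform hs m') (hm m' hm'.le) u hu j).trans_lt
        (half_lt_self hε)⟩
    simp only [quad]
    exact tendsto_finsetSum _ fun i _ => tendsto_finsetSum _ fun j _ =>
      ((hstep i).mul (hstep j)).mul_const _

end OrthogonalIncrements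

end Orthogonal

/-! ### The noise -/

/-- The rates along the fluid limit on `[0, s]` are continuous, nonnegative and dominated by a
summable family `D`. -/
structure RateBound (c s : ℝ) (D : (Fin 4 → ℤ) → ℝ) : Prop where
  cont : ∀ l, ContinuousOn (fun q => rate l (fluid c q)) (Set.Icc 0 s)
  nonneg : ∀ l, ∀ q ∈ Set.Icc 0 s, 0 ≤ rate l (fluid c q)
  le : ∀ l, ∀ q ∈ Set.Icc 0 s, rate l (fluid c q) ≤ D l
  summable : ∀ i j, Summable fun l : Fin 4 → ℤ => D l * |(l i : ℝ) * l j|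
  summable_sqrt : ∀ i, Summable fun l : Fin 4 → ℤ => Real.sqrt (D l) * |(l i : ℝ)|

/-- The covariance density of the noise. -/
noncomputable def covDensity (c u : ℝ) : Matrix (Fin 4) (Fin 4) ℝ :=
  Matrix.of fun i j => ∑' l : Fin 4 → ℤ, rate l (fluid c u) * ((l i : ℝ) * l j)

/-- The clock of the Brownian motion `W_l`. -/
noncomputable def clock (c : ℝ) (l : Fin 4 → ℤ) (t : ℝ) : ℝ :=
  ∫ q in (0 : ℝ)..t, rate l (fluid c q)

namespace RateBound

variable {c s : ℝ} {D : (Fin 4 → ℤ) → ℝ}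

theorem D_nonneg (h : RateBound c s D) (hs : 0 ≤ s) (l : Fin 4 → ℤ) : 0 ≤ D l :=
  (h.nonneg l 0 ⟨le_rfl, hs⟩).trans (h.le l 0 ⟨le_rfl, hs⟩)

theorem integrableOn (h : RateBound c s D) (l : Fin 4 → ℤ) :
    IntegrableOn (fun q => rate l (fluid c q)) (Set.Ioc 0 s) :=
  (h.cont l).integrableOn_Icc.mono_set Set.Ioc_subset_Icc_self

theorem clock_eq {t : ℝ} (ht : t ∈ Set.Icc 0 s) (l : Fin 4 → ℤ) :
    clock c l t = ∫ q in Set.Ioc 0 s, (Set.Ioc 0 t).indicator 1 q * rate l (fluid c q) := by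
  rw [clock, intervalIntegral.integral_of_le ht.1]
  have : ∀ q, (Set.Ioc 0 t).indicator (1 : ℝ → ℝ) q * rate l (fluid c q)
      = (Set.Ioc 0 t).indicator (fun q => rate l (fluid c q)) q := by
    intro q
    by_cases hq : q ∈ Set.Ioc 0 t <;> simp [Set.indicator, hq]
  simp only [this]
  rw [setIntegral_indicator measurableSet_Ioc, Set.inter_eq_self_of_subset_right
    (Set.Ioc_subset_Ioc_right ht.2)]

theorem clock_nonneg (h : RateBound c s D) {t : ℝ} (ht : t ∈ Set.Icc 0 s) (l : Fin 4 → ℤ) :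
    0 ≤ clock c l t :=
  intervalIntegral.integral_nonneg ht.1 fun q hq => h.nonneg l q ⟨hq.1, hq.2.trans ht.2⟩

theorem intervalIntegrable (h : RateBound c s D) {a b : ℝ} (ha : a ∈ Set.Icc 0 s)
    (hb : b ∈ Set.Icc 0 s) (l : Fin 4 → ℤ) :
    IntervalIntegrable (fun q => rate l (fluid c q)) volume a b :=
  ((h.cont l).mono (Set.uIcc_subset_Icc ha hb)).intervalIntegrable

theorem clock_mono (h : RateBound c s D) {a b : ℝ} (ha : a ∈ Set.Icc 0 s) (hb : b ∈ Set.Icc 0 s)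
    (hab : a ≤ b) (l : Fin 4 → ℤ) : clock c l a ≤ clock c l b := by
  have h0 : (0 : ℝ) ∈ Set.Icc 0 s := ⟨le_rfl, ha.1.trans ha.2⟩
  have := intervalIntegral.integral_add_adjacent_intervals (h.intervalIntegrable h0 ha l)
    (h.intervalIntegrable ha hb l)
  rw [clock, clock, ← this]
  have := intervalIntegral.integral_nonneg (μ := volume) hab
    (f := fun q => rate l (fluid c q)) fun q hq =>
      h.nonneg l q ⟨ha.1.trans hq.1, hq.2.trans hb.2⟩
  linarith

theorem clock_le (h : RateBound c s D) {t : ℝ} (ht : t ∈ Set.Icc 0 s) (l : Fin 4 → ℤ) :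
    clock c l t ≤ s * D l := by
  have hs := ht.1.trans ht.2
  have h0 : (0 : ℝ) ∈ Set.Icc 0 s := ⟨le_rfl, hs⟩
  calc clock c l t ≤ ∫ _ in (0 : ℝ)..t, D l := by
        refine intervalIntegral.integral_mono_on ht.1 (h.intervalIntegrable h0 ht l)
          intervalIntegrable_const fun q hq => h.le l q ⟨hq.1, hq.2.trans ht.2⟩
    _ = t * D l := by simp
    _ ≤ s * D l := mul_le_mul_of_nonneg_right ht.2 (h.D_nonneg hs l)

theorem min_clock (h : RateBound c s D) {a b : ℝ} (ha : a ∈ Set.Icc 0 s) (hb : b ∈ Set.Icc 0 s)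
    (l : Fin 4 → ℤ) : min (clock c l a) (clock c l b) = clock c l (min a b) := by
  rcases le_total a b with hab | hab
  · rw [min_eq_left hab, min_eq_left (h.clock_mono ha hb hab l)]
  · rw [min_eq_right hab, min_eq_right (h.clock_mono hb ha hab l)]

theorem min_clock_eq (h : RateBound c s D) {a b : ℝ} (ha : a ∈ Set.Icc 0 s)
    (hb : b ∈ Set.Icc 0 s) (l : Fin 4 → ℤ) : min (clock c l a) (clock c l b)
      = ∫ q in Set.Ioc 0 s, (Set.Ioc 0 a).indicator 1 q * (Set.Ioc 0 b).indicator 1 q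
        * rate l (fluid c q) := by
  rw [h.min_clock ha hb, clock_eq ⟨le_min ha.1 hb.1, (min_le_left _ _).trans ha.2⟩]
  refine integral_congr_ae (ae_of_all _ fun q => ?_)
  simp only [Set.indicator, Set.mem_Ioc, Pi.one_apply]
  by_cases h0 : 0 < q <;> by_cases h1 : q ≤ a <;> by_cases h2 : q ≤ b <;> simp [h0, h1, h2]

theorem integrable_indicator_mul (h : RateBound c s D) (a b : ℝ) (l : Fin 4 → ℤ) :
    IntegrableOn (fun q => (Set.Ioc 0 a).indicator (1 : ℝ → ℝ) q
      * (Set.Ioc 0 b).indicator (1 : ℝ → ℝ) q * rate l (fluid c q)) (Set.Ioc 0 s) := by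
  refine (h.integrableOn l).bdd_mul (c := 1)
    (((measurable_const.indicator measurableSet_Ioc).mul
      (measurable_const.indicator measurableSet_Ioc)).aestronglyMeasurable) (ae_of_all _ fun q => ?_)
  simp only [Set.indicator, Pi.one_apply]
  split_ifs <;> simp

/-- The overlap of two intervals of clock time. -/
theorem overlap_eq (h : RateBound c s D) {a b a' b' : ℝ} (ha : a ∈ Set.Icc 0 s)
    (hb : b ∈ Set.Icc 0 s) (ha' : a' ∈ Set.Icc 0 s) (hb' : b' ∈ Set.Icc 0 s) (hab : a ≤ b)
    (hab' : a' ≤ b') (l : Fin 4 → ℤ) :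
    min (clock c l b) (clock c l b') - min (clock c l b) (clock c l a')
      - (min (clock c l a) (clock c l b') - min (clock c l a) (clock c l a'))
      = ∫ q in Set.Ioc 0 s, (Set.Ioc a b).indicator 1 q * (Set.Ioc a' b').indicator 1 q
        * rate l (fluid c q) := by
  rw [h.min_clock_eq hb hb', h.min_clock_eq hb ha', h.min_clock_eq ha hb', h.min_clock_eq ha ha',
    ← integral_sub (h.integrable_indicator_mul b b' l) (h.integrable_indicator_mul b a' l),
    ← integral_sub (h.integrable_indicator_mul a b' l) (h.integrable_indicator_mul a a' l)]
  have hi : ∀ x y, IntegrableOn (fun q => (Set.Ioc 0 x).indicator (1 : ℝ → ℝ) q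
      * (Set.Ioc 0 b').indicator (1 : ℝ → ℝ) q * rate l (fluid c q)
      - (Set.Ioc 0 x).indicator (1 : ℝ → ℝ) q
      * (Set.Ioc 0 y).indicator (1 : ℝ → ℝ) q * rate l (fluid c q)) (Set.Ioc 0 s) :=
    fun x y => (h.integrable_indicator_mul x b' l).sub (h.integrable_indicator_mul x y l)
  rw [← integral_sub (hi b a') (hi a a')]
  refine setIntegral_congr_fun measurableSet_Ioc fun q hq => ?_
  have key : ∀ x y : ℝ, x ≤ y → (Set.Ioc x y).indicator (1 : ℝ → ℝ) q
      = (Set.Ioc 0 y).indicator 1 q - (Set.Ioc 0 x).indicator 1 q := by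
    intro x y hxy
    simp only [Set.indicator, Set.mem_Ioc, hq.1, true_and, Pi.one_apply]
    by_cases h1 : q ≤ x
    · simp [h1, h1.trans hxy, not_lt.2 h1]
    · simp [h1, not_le.1 h1]
  rw [key a b hab, key a' b' hab']
  ring

theorem continuousOn_covDensity (h : RateBound c s D) (i j : Fin 4) :
    ContinuousOn (fun u => covDensity c u i j) (Set.Icc 0 s) := by
  refine continuousOn_tsum (fun l => (h.cont l).mul continuousOn_const) (h.summable i j)
    fun l q hq => ?_
  rw [norm_mul, Real.norm_eq_abs, Real.norm_eq_abs, abs_of_nonneg (h.nonneg l q hq)]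
  exact mul_le_mul_of_nonneg_right (h.le l q hq) (abs_nonneg _)

theorem summable_rate_mul (h : RateBound c s D) {q : ℝ} (hq : q ∈ Set.Icc 0 s) (i j : Fin 4) :
    Summable fun l : Fin 4 → ℤ => rate l (fluid c q) * ((l i : ℝ) * l j) := by
  refine (h.summable i j).of_norm_bounded fun l => ?_
  rw [norm_mul, Real.norm_eq_abs, Real.norm_eq_abs, abs_of_nonneg (h.nonneg l q hq)]
  exact mul_le_mul_of_nonneg_right (h.le l q hq) (abs_nonneg _)

/-- The summable family D |lᵢ lⱼ| dominates, so the sum over steps may be taken inside the integral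
over time. -/
theorem hasSum_overlap (h : RateBound c s D) (a b a' b' : ℝ) (i j : Fin 4) :
    HasSum (fun l : Fin 4 → ℤ => (∫ q in Set.Ioc 0 s, (Set.Ioc a b).indicator 1 q
        * (Set.Ioc a' b').indicator 1 q * rate l (fluid c q)) * ((l i : ℝ) * l j))
      (∫ q in Set.Ioc 0 s, (Set.Ioc a b).indicator 1 q * (Set.Ioc a' b').indicator 1 q
        * covDensity c q i j) := by
  simp only [← integral_mul_const]
  refine hasSum_integral_of_dominated_convergence (fun l _ => D l * |(l i : ℝ) * l j|)
    (fun l => ?_) (fun l => ?_) (ae_of_all _ fun _ => h.summable i j) ?_ ?_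
  · have hm := (h.integrableOn l).aestronglyMeasurable
    exact (((measurable_const.indicator measurableSet_Ioc).mul
      (measurable_const.indicator measurableSet_Ioc)).aestronglyMeasurable.mul hm).mul_const _
  · filter_upwards [ae_restrict_mem measurableSet_Ioc] with q hq
    have hq' := Set.Ioc_subset_Icc_self hq
    have h1 := h.nonneg l q hq'
    have h2 := h.le l q hq'
    rw [norm_mul, norm_mul, norm_mul, Real.norm_eq_abs (_ * _), Real.norm_eq_abs (rate _ _),
      abs_of_nonneg h1]
    refine mul_le_mul_of_nonneg_right (le_trans ?_ h2) (abs_nonneg _)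
    refine mul_le_of_le_one_left h1 ?_
    simp only [Set.indicator, Pi.one_apply]
    split_ifs <;> simp
  · exact integrableOn_const (measure_Ioc_lt_top.ne)
  · filter_upwards [ae_restrict_mem measurableSet_Ioc] with q hq
    have := (h.summable_rate_mul (Set.Ioc_subset_Icc_self hq) i j).hasSum.mul_left
      ((Set.Ioc a b).indicator 1 q * (Set.Ioc a' b').indicator 1 q)
    exact this.congr_fun fun l => by ring

end RateBound

section Noise

variable {Ω : Type*} [MeasurableSpace Ω] {P : Measure Ω}
  {c s : ℝ} {D : (Fin 4 → ℤ) → ℝ} {M : EdgeModel} {V₀ : Ω → Fin 4 → ℝ}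
  {W : (Fin 4 → ℤ) → ℝ≥0 → Ω → ℝ}

theorem IsInput.memLp (hW : IsInput c M P V₀ W) (l : Fin 4 → ℤ) (t : ℝ≥0) : MemLp (W l t) 2 P :=
  ((hW.brownian l).hasLaw_eval t).hasGaussianLaw.memLp_two

theorem IsInput.memLp_init (hW : IsInput c M P V₀ W) (i : Fin 4) :
    MemLp (fun ω => V₀ ω i) 2 P := (hW.gaussian.eval i).memLp_two

variable [IsProbabilityMeasure P]

theorem IsInput.integral_mul (hW : IsInput c M P V₀ W) (l m : Fin 4 → ℤ) (a b : ℝ≥0) :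
    ∫ ω, W l a ω * W m b ω ∂P = if l = m then min (a : ℝ) b else 0 := by
  have hcov := covariance_eq_sub (hW.memLp l a) (hW.memLp m b)
  rw [(hW.brownian l).integral_eval, (hW.brownian m).integral_eval, mul_zero, sub_zero] at hcov
  change cov[W l a, W m b; P] = ∫ ω, W l a ω * W m b ω ∂P at hcov
  rw [← hcov]
  split_ifs with hlm
  · subst hlm
    rw [(hW.brownian l).covariance_eval]
    simp
  · have hind := (hW.indep.indepFun hlm).comp (measurable_pi_apply a) (measurable_pi_apply b)
    exact IndepFun.covariance_eq_zero hind (hW.memLp l a) (hW.memLp m b)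

theorem IsInput.integral_mul_init (hW : IsInput c M P V₀ W) (l : Fin 4 → ℤ) (a : ℝ≥0) (i : Fin 4) :
    ∫ ω, W l a ω * V₀ ω i ∂P = 0 := by
  have hcov := covariance_eq_sub (hW.memLp_init i) (hW.memLp l a)
  rw [hW.mean i, zero_mul, sub_zero] at hcov
  have hind := hW.indep_init.comp (measurable_pi_apply i)
    ((measurable_pi_apply a).comp (measurable_pi_apply l))
  have h0 := IndepFun.covariance_eq_zero hind (hW.memLp_init i) (hW.memLp l a)
  have : ∫ ω, W l a ω * V₀ ω i ∂P = ∫ ω, ((fun ω => V₀ ω i) * W l a) ω ∂P :=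
    integral_congr_ae (ae_of_all _ fun ω => by simp [mul_comm])
  rw [this, ← hcov]
  exact h0

/-- The terms of the noise, as elements of `L²`. -/
noncomputable def noiseTerm (hW : IsInput c M P V₀ W) (t : ℝ) (i : Fin 4) (l : Fin 4 → ℤ) :
    Lp ℝ 2 P :=
  (l i : ℝ) • (hW.memLp l (clock c l t).toNNReal).toLp _

theorem norm_toLp_brownian (hW : IsInput c M P V₀ W) (l : Fin 4 → ℤ) (a : ℝ≥0) :
    ‖(hW.memLp l a).toLp _‖ = Real.sqrt a := by
  rw [← Real.sqrt_sq (norm_nonneg _), ← real_inner_self_eq_norm_sq, inner_toLp, hW.integral_mul]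
  simp

theorem norm_noiseTerm_le (hW : IsInput c M P V₀ W) (h : RateBound c s D) {t : ℝ}
    (ht : t ∈ Set.Icc 0 s) (i : Fin 4) (l : Fin 4 → ℤ) :
    ‖noiseTerm hW t i l‖ ≤ Real.sqrt s * (Real.sqrt (D l) * |(l i : ℝ)|) := by
  rw [noiseTerm, norm_smul, norm_toLp_brownian hW, Real.norm_eq_abs,
    Real.coe_toNNReal _ (h.clock_nonneg ht l), ← mul_assoc, ← Real.sqrt_mul (ht.1.trans ht.2),
    mul_comm]
  exact mul_le_mul_of_nonneg_right (Real.sqrt_le_sqrt (h.clock_le ht l)) (abs_nonneg _)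

theorem summable_norm_noiseTerm (hW : IsInput c M P V₀ W) (h : RateBound c s D) {t : ℝ}
    (ht : t ∈ Set.Icc 0 s) (i : Fin 4) : Summable fun l => ‖noiseTerm hW t i l‖ :=
  ((h.summable_sqrt i).mul_left _).of_nonneg_of_le (fun _ => norm_nonneg _)
    (norm_noiseTerm_le hW h ht i)

/-- `noise` is a series taken pointwise in ω. Summability of the L² norms, the purpose of
`summable_sqrt`, identifies it almost surely with the Hilbert-space sum. -/
theorem coeFn_tsum_noiseTerm (hW : IsInput c M P V₀ W) (h : RateBound c s D) {t : ℝ}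
    (ht : t ∈ Set.Icc 0 s) (i : Fin 4) :
    ⇑(∑' l, noiseTerm hW t i l) =ᵐ[P] fun ω => noise c W t ω i := by
  have hsum := summable_norm_noiseTerm hW h ht i
  have hne : ∑' l, ‖noiseTerm hW t i l‖ₑ ≠ ∞ := by
    have := hsum.tsum_ofReal_ne_top
    simpa only [ofReal_norm] using this
  have hterm : ∀ᵐ ω ∂P, ∀ l, noiseTerm hW t i l ω
      = W l (clock c l t).toNNReal ω * (l i : ℝ) := by
    rw [ae_all_iff]
    intro l
    filter_upwards [Lp.coeFn_smul (l i : ℝ) ((hW.memLp l (clock c l t).toNNReal).toLp _),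
      (hW.memLp l (clock c l t).toNNReal).coeFn_toLp] with ω h1 h2
    rw [noiseTerm, h1, Pi.smul_apply, h2, smul_eq_mul, mul_comm]
  filter_upwards [Lp.coeFn_tsum hne, hterm] with ω h1 h2
  rw [h1]
  simp only [h2]
  rfl

theorem memLp_noise (hW : IsInput c M P V₀ W) (h : RateBound c s D) {t : ℝ}
    (ht : t ∈ Set.Icc 0 s) (i : Fin 4) : MemLp (fun ω => noise c W t ω i) 2 P :=
  (memLp_congr_ae (coeFn_tsum_noiseTerm hW h ht i)).1 (Lp.memLp _)

theorem toLp_noise (hW : IsInput c M P V₀ W) (h : RateBound c s D) {t : ℝ}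
    (ht : t ∈ Set.Icc 0 s) (i : Fin 4) :
    (memLp_noise hW h ht i).toLp _ = ∑' l, noiseTerm hW t i l :=
  Lp.ext ((memLp_noise hW h ht i).coeFn_toLp.trans (coeFn_tsum_noiseTerm hW h ht i).symm)

theorem hasSum_noiseTerm (hW : IsInput c M P V₀ W) (h : RateBound c s D) {t : ℝ}
    (ht : t ∈ Set.Icc 0 s) (i : Fin 4) :
    HasSum (noiseTerm hW t i) ((memLp_noise hW h ht i).toLp _) := by
  rw [toLp_noise hW h ht]
  exact (summable_norm_noiseTerm hW h ht i).of_norm.hasSum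

/-- Inner products of series with mutually orthogonal terms. -/
theorem hasSum_inner_of_orthogonal {H ι : Type*} [NormedAddCommGroup H] [InnerProductSpace ℝ H]
    {x y : ι → H} {X Y : H} (hx : HasSum x X) (hy : HasSum y Y)
    (horth : ∀ l m, l ≠ m → inner ℝ (x l) (y m) = 0) :
    HasSum (fun l => inner ℝ (x l) (y l)) (inner ℝ X Y) := by
  have h1 : HasSum (fun m => inner ℝ X (y m)) (inner ℝ X Y) := hy.mapL (innerSL ℝ X)
  refine h1.congr_fun fun m => ?_
  have h2 : HasSum (fun l => inner ℝ (y m) (x l)) (inner ℝ (y m) X) := hx.mapL (innerSL ℝ (y m))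
  have h3 := hasSum_single (f := fun l => inner ℝ (y m) (x l)) m fun l hl => by
    rw [real_inner_comm, horth l m hl]
  rw [real_inner_comm, real_inner_comm (y m), h2.unique h3]

theorem inner_noiseTerm (hW : IsInput c M P V₀ W) (h : RateBound c s D) {t t' : ℝ}
    (ht : t ∈ Set.Icc 0 s) (ht' : t' ∈ Set.Icc 0 s) (i j : Fin 4) (l m : Fin 4 → ℤ) :
    inner ℝ (noiseTerm hW t i l) (noiseTerm hW t' j m)
      = if l = m then min (clock c l t) (clock c l t') * ((l i : ℝ) * l j) else 0 := by
  rw [noiseTerm, noiseTerm, real_inner_smul_left, real_inner_smul_right, inner_toLp,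
    hW.integral_mul]
  split_ifs with hlm
  · subst hlm
    rw [Real.coe_toNNReal _ (h.clock_nonneg ht l), Real.coe_toNNReal _ (h.clock_nonneg ht' l)]
    ring
  · ring

/-- Distinct Brownian motions are orthogonal, so only diagonal terms survive. Each contributes the
overlap of two intervals of its own clock, which is the integral of its rate over the overlap in
time. -/
theorem orthogonalIncrements_noise (hW : IsInput c M P V₀ W) (h : RateBound c s D) :
    OrthogonalIncrements P (noise c W) (covDensity c) s where
  memLp t ht i := memLp_noise hW h ht i
  integrable i j :=
    (h.continuousOn_covDensity i j).integrableOn_Icc.mono_set Set.Ioc_subset_Icc_self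
  inner_eq a ha b hb a' ha' b' hb' hab hab' i j := by
    have hx := (hasSum_noiseTerm hW h hb i).sub (hasSum_noiseTerm hW h ha i)
    have hy := (hasSum_noiseTerm hW h hb' j).sub (hasSum_noiseTerm hW h ha' j)
    have hin := hasSum_inner_of_orthogonal hx hy fun l m hlm => by
      simp only [inner_sub_left, inner_sub_right, inner_noiseTerm hW h ha ha',
        inner_noiseTerm hW h ha hb', inner_noiseTerm hW h hb ha', inner_noiseTerm hW h hb hb',
        if_neg hlm, sub_zero]
    rw [← MemLp.toLp_sub, ← MemLp.toLp_sub, inner_toLp] at hin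
    refine hin.unique ((h.hasSum_overlap a b a' b' i j).congr_fun fun l => ?_)
    simp only [inner_sub_left, inner_sub_right, inner_noiseTerm hW h ha ha',
      inner_noiseTerm hW h ha hb', inner_noiseTerm hW h hb ha', inner_noiseTerm hW h hb hb',
      if_true]
    rw [← h.overlap_eq ha hb ha' hb' hab hab']
    ring

theorem integral_noise_mul_init (hW : IsInput c M P V₀ W) (h : RateBound c s D) {t : ℝ}
    (ht : t ∈ Set.Icc 0 s) (i j : Fin 4) : ∫ ω, noise c W t ω i * V₀ ω j ∂P = 0 := by
  have h1 : HasSum (fun l => inner ℝ ((hW.memLp_init j).toLp _) (noiseTerm hW t i l)) _ :=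
    (hasSum_noiseTerm hW h ht i).mapL (innerSL ℝ ((hW.memLp_init j).toLp _))
  have h2 : ∀ l, inner ℝ ((hW.memLp_init j).toLp _) (noiseTerm hW t i l) = 0 := by
    intro l
    rw [noiseTerm, real_inner_smul_right, real_inner_comm, inner_toLp, hW.integral_mul_init,
      mul_zero]
  simp only [h2] at h1
  have h3 := h1.unique hasSum_zero
  rw [← inner_toLp (memLp_noise hW h ht i) (hW.memLp_init j), real_inner_comm]
  exact h3

/-- The factor 1 presents the mean as an inner product with a constant, the form in which
`integral_mul_eq_zero` is applied. -/
theorem integral_noise (hW : IsInput c M P V₀ W) (h : RateBound c s D) {t : ℝ}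
    (ht : t ∈ Set.Icc 0 s) (i : Fin 4) : ∫ ω, noise c W t ω i * 1 ∂P = 0 := by
  have hone : MemLp (fun _ : Ω => (1 : ℝ)) 2 P := memLp_const 1
  have h1 : HasSum (fun l => inner ℝ (hone.toLp _) (noiseTerm hW t i l)) _ :=
    (hasSum_noiseTerm hW h ht i).mapL (innerSL ℝ (hone.toLp _))
  have h2 : ∀ l, inner ℝ (hone.toLp _) (noiseTerm hW t i l) = 0 := by
    intro l
    rw [noiseTerm, real_inner_smul_right, real_inner_comm, inner_toLp]
    simp only [mul_one]
    rw [(hW.brownian l).integral_eval, mul_zero]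
  simp only [h2] at h1
  have h3 := h1.unique hasSum_zero
  rw [← inner_toLp (memLp_noise hW h ht i) hone, real_inner_comm]
  exact h3

end Noise

/-! ### Rates along the fluid limit -/

/-- The constraints satisfied by the parameters `z` and `b` along the fluid limit. -/
structure Admissible (c z b : ℝ) : Prop where
  c_pos : 0 < c
  z_pos : 0 < z
  z_le : z ≤ c
  b_pos : 0 < b
  b_le : b ≤ c
  le_b : c * betaFn c 0 ≤ b
  lt_z : b * (1 - Real.exp (-z)) < z

theorem admissible_fluid {c : ℝ} (hc : 0 < c) (hce : c ≤ Real.exp 1) {s : ℝ} (h0 : 0 ≤ s)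
    (h1 : s < timeOf c 0) : Admissible c (theta c s) (bOf c s) where
  c_pos := hc
  z_pos := theta_pos hc h0 h1
  z_le := theta_le hc h0 h1.le
  b_pos := bOf_pos hc s
  b_le := by
    have := betaFn_le_one hc (theta_le hc h0 h1.le)
    rw [bOf]
    nlinarith
  le_b := mul_le_mul_of_nonneg_left (monotone_betaFn hc (theta_pos hc h0 h1).le) hc.le
  lt_z := betaFn_mul_lt hc hce (theta_pos hc h0 h1)

/-- The rate of the step `label j` at `state c z b t`. -/
noncomputable def stateRate (z b : ℝ) (j : ℕ × ℕ × ℕ) : ℝ :=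
  if j = 0 then 1 - b / z * (1 - Real.exp (-z))
  else Real.exp (-z) * b / z * expTerm ((1 - b / z * (1 - Real.exp (-z))) * z)
    (Real.exp (-z) * b * z) (Real.exp (-z) * b * expTail z) j

theorem state_div {c z b : ℝ} (hc : 0 < c) (hz : 0 < z) (t : ℝ) :
    state c z b t 0 / (2 * state c z b t 2) = 1 - b / z * (1 - Real.exp (-z)) := by
  simp only [state]
  simp
  field_simp

theorem kappa_state {c z b : ℝ} (hc : 0 < c) (hz : 0 < z) (hb : 0 < b) (t : ℝ) :
    kappa (state c z b t) = Real.exp (-z) * b / z ^ 2 := by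
  have hf := (expTail_pos hz).ne'
  rw [kappa, zParam_state hc hz hb]
  simp only [state]
  simp
  field_simp

theorem rate_label_state {c z b : ℝ} (hc : 0 < c) (hz : 0 < z) (hb : 0 < b) (t : ℝ)
    (j : ℕ × ℕ × ℕ) : rate (label j) (state c z b t) = stateRate z b j := by
  rw [stateRate]
  split_ifs with hj
  · rw [hj, rate_label_zero, state_div hc hz]
  · rw [(regular_state hc hz hb t).rate_label hj, kappa_state hc hz hb, zParam_state hc hz hb,
      state_div hc hz]
    congr 1
    · field_simp
    · congr 1 <;> field_simp

theorem expTerm_nonneg {q₁ q₂ q₃ : ℝ} (h1 : 0 ≤ q₁) (h2 : 0 ≤ q₂) (h3 : 0 ≤ q₃)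
    (j : ℕ × ℕ × ℕ) : 0 ≤ expTerm q₁ q₂ q₃ j := by
  rw [expTerm]; positivity

theorem expTerm_mono {q₁ q₂ q₃ r₁ r₂ r₃ : ℝ} (h1 : 0 ≤ q₁) (h2 : 0 ≤ q₂) (h3 : 0 ≤ q₃)
    (h1' : q₁ ≤ r₁) (h2' : q₂ ≤ r₂) (h3' : q₃ ≤ r₃) (j : ℕ × ℕ × ℕ) :
    expTerm q₁ q₂ q₃ j ≤ expTerm r₁ r₂ r₃ j := by
  rw [expTerm, expTerm]
  have := h1.trans h1'
  have := h2.trans h2'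
  gcongr

/-- `2^{m + k₂ + k₃}`. -/
def weight (j : ℕ × ℕ × ℕ) : ℝ := 2 ^ (j.1 + j.2.1 + j.2.2)

theorem weight_pos (j : ℕ × ℕ × ℕ) : 0 < weight j := by rw [weight]; positivity

theorem expTerm_mul_weight (q₁ q₂ q₃ : ℝ) (j : ℕ × ℕ × ℕ) :
    expTerm q₁ q₂ q₃ j * weight j = expTerm (2 * q₁) (2 * q₂) (2 * q₃) j := by
  rw [expTerm, expTerm, weight, mul_pow, mul_pow, mul_pow, pow_add, pow_add]
  ring

theorem natCast_le_weight (j : ℕ × ℕ × ℕ) : (j.1 + j.2.1 + j.2.2 : ℝ) + 1 ≤ weight j := by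
  have h : j.1 + j.2.1 + j.2.2 + 1 ≤ 2 ^ (j.1 + j.2.1 + j.2.2) := Nat.lt_two_pow_self
  rw [weight]
  exact_mod_cast h

theorem abs_label_le (j : ℕ × ℕ × ℕ) (i : Fin 4) : |(label j i : ℝ)| ≤ 2 * weight j := by
  have h := natCast_le_weight j
  have h1 : (0 : ℝ) ≤ j.1 := Nat.cast_nonneg _
  have h2 : (0 : ℝ) ≤ j.2.1 := Nat.cast_nonneg _
  have h3 : (0 : ℝ) ≤ j.2.2 := Nat.cast_nonneg _
  by_cases hj : j = 0
  · subst hj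
    simp only [label_zero, weight]
    fin_cases i <;> simp
  · rw [label_of_ne hj, abs_le]
    fin_cases i <;> simp [step] <;> constructor <;> linarith

theorem Admissible.p_nonneg {c z b : ℝ} (h : Admissible c z b) :
    0 ≤ 1 - b / z * (1 - Real.exp (-z)) := by
  have := h.lt_z
  have hz := h.z_pos
  rw [div_mul_eq_mul_div, sub_nonneg, div_le_one hz]
  exact this.le

theorem Admissible.p_le {c z b : ℝ} (h : Admissible c z b) :
    1 - b / z * (1 - Real.exp (-z)) ≤ 1 := by
  have hz := h.z_pos
  have hb := h.b_pos
  have : Real.exp (-z) ≤ 1 := by rw [Real.exp_le_one_iff]; linarith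
  have : 0 ≤ b / z * (1 - Real.exp (-z)) := mul_nonneg (by positivity) (by linarith)
  linarith

/-- Each of these three nonnegative parameters is therefore at most z, hence at most c. -/
theorem Admissible.sum_eq {c z b : ℝ} (h : Admissible c z b) :
    (1 - b / z * (1 - Real.exp (-z))) * z + Real.exp (-z) * b * z
      + Real.exp (-z) * b * expTail z = z := by
  have hz := h.z_pos.ne'
  have : Real.exp (-z) * Real.exp z = 1 := by rw [← Real.exp_add]; simp
  rw [expTail]
  field_simp
  linear_combination b * this

theorem Admissible.stateRate_nonneg {c z b : ℝ} (h : Admissible c z b) (j : ℕ × ℕ × ℕ) :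
    0 ≤ stateRate z b j := by
  have hz := h.z_pos
  have hb := h.b_pos
  have hf := expTail_pos hz
  have hp := h.p_nonneg
  rw [stateRate]
  split_ifs
  · exact hp
  · exact mul_nonneg (by positivity) (expTerm_nonneg (by positivity) (by positivity)
      (by positivity) j)

theorem Admissible.exp_neg_le {c z b : ℝ} (h : Admissible c z b) : Real.exp (-z) ≤ 1 := by
  rw [Real.exp_le_one_iff]; linarith [h.z_pos]

/-- A crude bound, used only on time intervals that stay away from s*, where the factor 1/z is
harmless. -/
theorem Admissible.stateRate_le {c z b : ℝ} (h : Admissible c z b) (j : ℕ × ℕ × ℕ) :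
    stateRate z b j ≤ (1 + c / z) * expTerm c c c j := by
  have hz := h.z_pos
  have hb := h.b_pos
  have hc := h.c_pos
  have hf := expTail_pos hz
  have hp := h.p_nonneg
  have hs := h.sum_eq
  have he := Real.exp_pos (-z)
  have h1 : 0 ≤ (1 - b / z * (1 - Real.exp (-z))) * z := by positivity
  have h2 : 0 ≤ Real.exp (-z) * b * z := by positivity
  have h3 : 0 ≤ Real.exp (-z) * b * expTail z := by positivity
  have hzc := h.z_le
  rw [stateRate]
  split_ifs with hj
  · subst hj
    have : expTerm c c c 0 = 1 := by simp [expTerm]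
    rw [this, mul_one]
    have : 0 < c / z := by positivity
    linarith [h.p_le]
  · refine mul_le_mul ?_ (expTerm_mono h1 h2 h3 (by linarith) (by linarith) (by linarith) j)
      (expTerm_nonneg h1 h2 h3 j) (by positivity)
    have : Real.exp (-z) * b / z ≤ 1 * c / z := by
      have := h.exp_neg_le
      have := h.b_le
      gcongr
    rw [one_mul] at this
    linarith

theorem rate_label_fluid {c : ℝ} (hc : 0 < c) {s : ℝ} (h0 : 0 ≤ s) (h1 : s < timeOf c 0) (j : ℕ × ℕ × ℕ) :
    rate (label j) (fluid c s) = stateRate (theta c s) (bOf c s) j := by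
  rw [fluid_eq hc, rate_label_state hc (theta_pos hc h0 h1) (bOf_pos hc s)]

theorem continuousOn_stateRate {c : ℝ} (hc : 0 < c) {s : ℝ} (hs : s < timeOf c 0)
    (j : ℕ × ℕ × ℕ) :
    ContinuousOn (fun q => stateRate (theta c q) (bOf c q) j) (Set.Icc 0 s) := by
  intro q hq
  have hz := (hasDerivAt_theta' hc hq.1 (hq.2.trans_lt hs)).continuousAt
  have hb := (hasDerivAt_bOf hc hq.1 (hq.2.trans_lt hs)).continuousAt
  have hz0 := (theta_pos hc hq.1 (hq.2.trans_lt hs)).ne'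
  refine ContinuousAt.continuousWithinAt ?_
  simp only [stateRate, expTerm, expTail]
  split_ifs
  · fun_prop (disch := assumption)
  · fun_prop (disch := assumption)

/-- A dominating family for the rates on `[0, s]`. -/
noncomputable def rateDom (c s : ℝ) : (Fin 4 → ℤ) → ℝ :=
  Function.extend label (fun j => (1 + c / theta c s) * expTerm c c c j) 0

theorem rateDom_label (c s : ℝ) (j : ℕ × ℕ × ℕ) :
    rateDom c s (label j) = (1 + c / theta c s) * expTerm c c c j :=
  label_injective.extend_apply _ _ _

theorem rateDom_of_notMem (c s : ℝ) {l : Fin 4 → ℤ} (hl : l ∉ Set.range label) :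
    rateDom c s l = 0 :=
  Function.extend_apply' _ _ _ fun ⟨j, hj⟩ => hl ⟨j, hj⟩

theorem summable_inv_weight : Summable fun j => (weight j)⁻¹ := by
  have h := (hasSum_triple hasSum_geometric_two hasSum_geometric_two hasSum_geometric_two).summable
  refine h.congr fun j => ?_
  rw [weight, pow_add, pow_add]
  simp only [one_div, inv_pow, mul_inv]
  ring

/-- Coordinates of a label are at most twice its weight, and each factor of the weight is absorbed
into `expTerm` by doubling its arguments. So all polynomial moments of the dominating family
converge. -/
theorem rateBound {c : ℝ} (hc : 0 < c) (hce : c ≤ Real.exp 1) {s : ℝ} (h0 : 0 ≤ s)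
    (hs : s < timeOf c 0) : RateBound c s (rateDom c s) := by
  have hK : 0 < 1 + c / theta c s := by
    have := theta_pos hc h0 hs
    positivity
  have hsumm : ∀ g : (Fin 4 → ℤ) → ℝ, (∀ l, l ∉ Set.range label → g l = 0) →
      (Summable (fun j => g (label j)) → Summable g) :=
    fun g hg h => (label_injective.summable_iff hg).1 h
  have hexp : ∀ q : ℝ, Summable (expTerm q q q) := fun q => (hasSum_expTerm q q q).summable
  refine ⟨fun l => ?_, fun l q hq => ?_, fun l q hq => ?_, fun i i' => ?_, fun i => ?_⟩
  · by_cases hl : l ∈ Set.range label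
    · obtain ⟨j, rfl⟩ := hl
      exact (continuousOn_stateRate hc hs j).congr fun q hq =>
        rate_label_fluid hc hq.1 (hq.2.trans_lt hs) j
    · simp only [rate_of_notMem_range hl]
      exact continuousOn_const
  · by_cases hl : l ∈ Set.range label
    · obtain ⟨j, rfl⟩ := hl
      rw [rate_label_fluid hc hq.1 (hq.2.trans_lt hs)]
      exact (admissible_fluid hc hce hq.1 (hq.2.trans_lt hs)).stateRate_nonneg j
    · rw [rate_of_notMem_range hl]
  · by_cases hl : l ∈ Set.range label
    · obtain ⟨j, rfl⟩ := hl
      rw [rate_label_fluid hc hq.1 (hq.2.trans_lt hs), rateDom_label]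
      refine ((admissible_fluid hc hce hq.1 (hq.2.trans_lt hs)).stateRate_le j).trans ?_
      have h1 := theta_pos hc h0 hs
      have h2 := antitone_theta hc hq.1 hq.2 hs.le
      refine mul_le_mul_of_nonneg_right ?_ (expTerm_nonneg hc.le hc.le hc.le j)
      gcongr
    · rw [rate_of_notMem_range hl, rateDom_of_notMem c s hl]
  · refine hsumm _ (fun l hl => by rw [rateDom_of_notMem c s hl, zero_mul]) ?_
    refine ((hexp (2 * (2 * c))).mul_left ((1 + c / theta c s) * 4)).of_nonneg_of_le
      (fun j => ?_) fun j => ?_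
    · rw [rateDom_label]
      have := expTerm_nonneg hc.le hc.le hc.le j
      positivity
    · rw [rateDom_label, abs_mul, ← expTerm_mul_weight, ← expTerm_mul_weight]
      have h1 := abs_label_le j i
      have h2 := abs_label_le j i'
      have h3 := expTerm_nonneg hc.le hc.le hc.le j
      have hw := weight_pos j
      calc (1 + c / theta c s) * expTerm c c c j * (|(label j i : ℝ)| * |(label j i' : ℝ)|)
          ≤ (1 + c / theta c s) * expTerm c c c j * ((2 * weight j) * (2 * weight j)) := by gcongr
        _ = _ := by ring
  · refine hsumm _ (fun l hl => by rw [rateDom_of_notMem c s hl, Real.sqrt_zero, zero_mul]) ?_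
    refine (((hexp (2 * (2 * (2 * c)))).mul_left ((1 + c / theta c s) * 4)).add
      summable_inv_weight).of_nonneg_of_le (fun j => by positivity) fun j => ?_
    rw [rateDom_label, ← expTerm_mul_weight, ← expTerm_mul_weight, ← expTerm_mul_weight]
    have h1 := abs_label_le j i
    have h3 := expTerm_nonneg hc.le hc.le hc.le j
    have hw := weight_pos j
    set A := (1 + c / theta c s) * expTerm c c c j with hA
    have hA0 : 0 ≤ A := by positivity
    have hsq := Real.sq_sqrt hA0
    have hle : Real.sqrt A * |(label j i : ℝ)| ≤ Real.sqrt A * (2 * weight j) := by gcongr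
    refine hle.trans ?_
    -- With w the weight, expanding w⁻¹(√A w² − 1)² ≥ 0 trades the square root for A w³, still an
    -- exponential series, plus the summable w⁻¹.
    have hamgm : Real.sqrt A * (2 * weight j) ≤ A * weight j ^ 3 + (weight j)⁻¹ := by
      have h4 : (weight j)⁻¹ * weight j = 1 := inv_mul_cancel₀ hw.ne'
      have h5 : 0 ≤ (weight j)⁻¹ * (Real.sqrt A * weight j ^ 2 - 1) ^ 2 := by positivity
      have h6 : (weight j)⁻¹ * (Real.sqrt A * weight j ^ 2 - 1) ^ 2
          = A * weight j ^ 3 + (weight j)⁻¹ - Real.sqrt A * (2 * weight j) := by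
        field_simp
        linear_combination weight j ^ 4 * hsq
      linarith
    refine hamgm.trans ?_
    have : A * weight j ^ 3 ≤ 4 * (A * weight j ^ 3) := by
      have : 0 ≤ A * weight j ^ 3 := by positivity
      linarith
    have e : (1 + c / theta c s) * 4 * (expTerm c c c j * weight j * weight j * weight j)
      = 4 * (A * weight j ^ 3) := by rw [hA]; ring
    rw [e]
    linarith

/-! ### The covariance matrix at the stopping time -/

section Variance

variable {Ω : Type*} [MeasurableSpace Ω] {P : Measure Ω}
  {c s : ℝ} {M : EdgeModel} {V₀ : Ω → Fin 4 → ℝ} {W : (Fin 4 → ℤ) → ℝ≥0 → Ω → ℝ}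

/-- The linear functional of the process that gives a coordinate of the stopped vector. -/
noncomputable def stopRow (c s : ℝ) (j : Fin 4) : Fin 4 → ℝ :=
  Pi.single j 1 - (drift (fluid c s) j / drift (fluid c s) 2) • Pi.single 2 1

theorem stoppedVector_eq (δ : ℝ) (ω : Ω) (j : Fin 4) :
    stoppedVector c P V₀ W δ ω j
      = ∑ i, stopRow c (sDelta c δ) j i * gaussianProcess c P V₀ W (sDelta c δ) ω i := by
  have h : ∀ v : Fin 4 → ℝ, ∑ i, stopRow c (sDelta c δ) j i * v i
      = v j - drift (fluid c (sDelta c δ)) j / drift (fluid c (sDelta c δ)) 2 * v 2 := by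
    intro v
    simp [stopRow, sub_mul, Finset.sum_sub_distrib, Pi.single_apply]
  rw [h, stoppedVector, Pi.sub_apply, Pi.smul_apply, smul_eq_mul]
  ring

variable [IsProbabilityMeasure P]

theorem IsInput.integral_mul_init_init (hW : IsInput c M P V₀ W) (i j : Fin 4) :
    ∫ ω, V₀ ω i * V₀ ω j ∂P = initCov c M i j := by
  have hcov := covariance_eq_sub (hW.memLp_init i) (hW.memLp_init j)
  rw [hW.mean i, zero_mul, sub_zero, hW.covariance] at hcov
  exact hcov.symm

theorem IsInput.integral_init_sq (hW : IsInput c M P V₀ W) (w : Fin 4 → ℝ) :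
    ∫ ω, (∑ i, w i * V₀ ω i) ^ 2 ∂P = quad (initCov c M) w w := by
  have e : ∀ ω, (∑ i, w i * V₀ ω i) ^ 2 = ∑ i, ∑ j, w i * w j * (V₀ ω i * V₀ ω j) := by
    intro ω
    rw [sq, Finset.sum_mul_sum]
    exact Finset.sum_congr rfl fun i _ => Finset.sum_congr rfl fun j _ => by ring
  have hI : ∀ i j, Integrable (fun ω => w i * w j * (V₀ ω i * V₀ ω j)) P := fun i j =>
    ((hW.memLp_init i).integrable_mul (hW.memLp_init j)).const_mul _
  simp only [e, quad]
  rw [integral_finsetSum _ fun i _ => integrable_finsetSum _ fun j _ => hI i j]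
  refine Finset.sum_congr rfl fun i _ => ?_
  rw [integral_finsetSum _ fun j _ => hI i j]
  refine Finset.sum_congr rfl fun j _ => ?_
  rw [integral_const_mul, hW.integral_mul_init_init]

/-- The second moments of the Gaussian process. -/
theorem variance_gaussianProcess (hW : IsInput c M P V₀ W) (hc : 0 < c) (hce : c ≤ Real.exp 1)
    (h0 : 0 ≤ s) (hs : s < timeOf c 0) (ρ : Fin 4 → ℝ) :
    cov[fun ω => ∑ i, ρ i * gaussianProcess c P V₀ W s ω i,
        fun ω => ∑ i, ρ i * gaussianProcess c P V₀ W s ω i; P]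
      = quad (initCov c M) (ρ ᵥ* corr c s 0) (ρ ᵥ* corr c s 0)
        + ∫ u in Set.Ioc 0 s, quad (covDensity c u) (ρ ᵥ* corr c s u) (ρ ᵥ* corr c s u) := by
  have hB := rateBound hc hce h0 hs
  have hN := orthogonalIncrements_noise hW hB
  have hf := continuousOn_corr hc hce hs
  have hex := hN.exists_isStochIntegral h0 hf
  have hY : IsStochIntegral P (fun u => corr c s u) (noise c W) s
      (stochIntegral P (fun u => corr c s u) (noise c W) s) := by
    rw [stochIntegral, dif_pos hex]
    exact hex.choose_spec
  set Y := stochIntegral P (fun u => corr c s u) (noise c W) s with hYdef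
  have e : ∀ ω, ∑ i, ρ i * gaussianProcess c P V₀ W s ω i
      = ∑ i, (ρ ᵥ* corr c s 0) i * V₀ ω i + ∑ i, ρ i * Y ω i := by
    intro ω
    have h1 : ∑ i, (ρ ᵥ* corr c s 0) i * V₀ ω i = ∑ i, ρ i * (corr c s 0 *ᵥ V₀ ω) i := by
      have := Matrix.dotProduct_mulVec ρ (corr c s 0) (V₀ ω)
      exact this.symm
    rw [h1, ← Finset.sum_add_distrib]
    refine Finset.sum_congr rfl fun i _ => ?_
    rw [gaussianProcess, Pi.add_apply, mul_add]
  simp only [e]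
  set X : Ω → ℝ := fun ω => ∑ i, (ρ ᵥ* corr c s 0) i * V₀ ω i with hXdef
  have hX2 : MemLp X 2 P := OrthogonalIncrements.memLp_sum_mul hW.memLp_init _
  have hY2 : MemLp (fun ω => ∑ i, ρ i * Y ω i) 2 P := OrthogonalIncrements.memLp_sum_mul hY.1 ρ
  have hX1 : ∫ ω, X ω ∂P = 0 := by
    rw [hXdef, integral_finsetSum _ fun i _ =>
      ((hW.memLp_init i).integrable (by norm_num)).const_mul _]
    refine Finset.sum_eq_zero fun i _ => ?_
    rw [integral_const_mul, hW.mean, mul_zero]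
  have hY1 : ∫ ω, ∑ i, ρ i * Y ω i ∂P = 0 := by
    have := hN.integral_mul_eq_zero h0 hY ρ (memLp_const 1)
      fun t ht i => integral_noise hW hB ht i
    simpa using this
  have hXY : ∫ ω, (∑ i, ρ i * Y ω i) * X ω ∂P = 0 := by
    refine hN.integral_mul_eq_zero h0 hY ρ hX2 fun t ht i => ?_
    simp only [hXdef, Finset.mul_sum]
    rw [integral_finsetSum]
    · refine Finset.sum_eq_zero fun j _ => ?_
      have : ∀ ω, noise c W t ω i * ((ρ ᵥ* corr c s 0) j * V₀ ω j)
          = (ρ ᵥ* corr c s 0) j * (noise c W t ω i * V₀ ω j) := fun ω => by ring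
      simp only [this]
      rw [integral_const_mul, integral_noise_mul_init hW hB ht, mul_zero]
    · exact fun j _ => (hN.memLp t ht i).integrable_mul ((hW.memLp_init j).const_mul _)
  have hS2 : MemLp (fun ω => X ω + ∑ i, ρ i * Y ω i) 2 P := hX2.add hY2
  have hcov := covariance_eq_sub hS2 hS2
  have hmean : ∫ ω, (X ω + ∑ i, ρ i * Y ω i) ∂P = 0 := by
    rw [integral_add (hX2.integrable (by norm_num)) (hY2.integrable (by norm_num)), hX1, hY1,
      add_zero]
  rw [hcov, hmean, mul_zero, sub_zero, ← hW.integral_init_sq, ← hN.integral_sq h0 hf hY]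
  have hsq : ∀ ω, ((fun ω => X ω + ∑ i, ρ i * Y ω i) * fun ω => X ω + ∑ i, ρ i * Y ω i) ω
      = X ω ^ 2 + (∑ i, ρ i * Y ω i) ^ 2 + 2 * ((∑ i, ρ i * Y ω i) * X ω) := by
    intro ω
    simp only [Pi.mul_apply]
    ring
  have hI1 : Integrable (fun ω => X ω ^ 2 + (∑ i, ρ i * Y ω i) ^ 2) P :=
    hX2.integrable_sq.add hY2.integrable_sq
  have hI2 : Integrable (fun ω => 2 * ((∑ i, ρ i * Y ω i) * X ω)) P :=
    (hY2.integrable_mul hX2).const_mul 2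
  simp only [hsq]
  rw [integral_add hI1 hI2, integral_const_mul, hXY, mul_zero, add_zero,
    integral_add hX2.integrable_sq hY2.integrable_sq]

theorem stoppedCov_eq (hW : IsInput c M P V₀ W) (hc : 0 < c) (hce : c ≤ Real.exp 1) {δ : ℝ}
    (h0 : 0 ≤ sDelta c δ) (hs : sDelta c δ < timeOf c 0) (j : Fin 4) :
    stoppedCov c P V₀ W δ j j
      = quad (initCov c M) (stopRow c (sDelta c δ) j ᵥ* corr c (sDelta c δ) 0)
          (stopRow c (sDelta c δ) j ᵥ* corr c (sDelta c δ) 0)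
        + ∫ u in Set.Ioc 0 (sDelta c δ),
          quad (covDensity c u) (stopRow c (sDelta c δ) j ᵥ* corr c (sDelta c δ) u)
            (stopRow c (sDelta c δ) j ᵥ* corr c (sDelta c δ) u) := by
  rw [stoppedCov, Matrix.of_apply, ← variance_gaussianProcess hW hc hce h0 hs]
  simp only [stoppedVector_eq]

theorem IsInput.quad_initCov_nonneg (hW : IsInput c M P V₀ W) (w : Fin 4 → ℝ) :
    0 ≤ quad (initCov c M) w w := by
  rw [← hW.integral_init_sq]
  exact integral_nonneg fun ω => sq_nonneg _

end Variance

/-! ### The quadratic form of the covariance density -/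

/-- The density is a sum of rank-one matrices, so its quadratic form can be estimated from above or
below step by step. -/
theorem RateBound.hasSum_quad {c s : ℝ} {D : (Fin 4 → ℤ) → ℝ} (h : RateBound c s D) {u : ℝ}
    (hu : u ∈ Set.Icc 0 s) (v : Fin 4 → ℝ) :
    HasSum (fun l : Fin 4 → ℤ => rate l (fluid c u) * (∑ i, v i * (l i : ℝ)) ^ 2)
      (quad (covDensity c u) v v) := by
  have h1 : HasSum (fun l : Fin 4 → ℤ => ∑ i, ∑ j, v i * v j * (rate l (fluid c u)
      * ((l i : ℝ) * l j))) (quad (covDensity c u) v v) :=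
    hasSum_sum fun i _ => hasSum_sum fun j _ => (h.summable_rate_mul hu i j).hasSum.mul_left _
  refine h1.congr_fun fun l => ?_
  rw [sq, Finset.sum_mul_sum, Finset.mul_sum]
  refine Finset.sum_congr rfl fun i _ => ?_
  rw [Finset.mul_sum]
  exact Finset.sum_congr rfl fun j _ => by ring

theorem hasSum_quad_label {c : ℝ} (hc : 0 < c) (hce : c ≤ Real.exp 1) {u : ℝ} (h0 : 0 ≤ u)
    (hu : u < timeOf c 0) (v : Fin 4 → ℝ) :
    HasSum (fun j => stateRate (theta c u) (bOf c u) j * (∑ i, v i * (label j i : ℝ)) ^ 2)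
      (quad (covDensity c u) v v) := by
  have h := (rateBound hc hce h0 hu).hasSum_quad ⟨h0, le_rfl⟩ v
  rw [← hasSum_rate_iff] at h
  exact h.congr_fun fun j => by rw [rate_label_fluid hc h0 hu]

theorem quad_covDensity_nonneg {c : ℝ} (hc : 0 < c) (hce : c ≤ Real.exp 1) {u : ℝ} (h0 : 0 ≤ u)
    (hu : u < timeOf c 0) (v : Fin 4 → ℝ) : 0 ≤ quad (covDensity c u) v v :=
  (hasSum_quad_label hc hce h0 hu v).nonneg fun j =>
    mul_nonneg ((admissible_fluid hc hce h0 hu).stateRate_nonneg j) (sq_nonneg _)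

/-! ### Bounds near the end of the process -/

theorem exp_sub_one_le {z : ℝ} : Real.exp z - 1 ≤ z * Real.exp z := by
  have h1 := Real.add_one_le_exp (-z)
  have h2 : Real.exp (-z) * Real.exp z = 1 := by rw [← Real.exp_add]; simp
  nlinarith [Real.exp_pos z]

theorem expTail_le {z : ℝ} (hz : 0 ≤ z) : expTail z ≤ z ^ 2 * Real.exp z := by
  have h := exp_sub_one_le (z := z)
  rw [expTail]
  nlinarith [mul_le_mul_of_nonneg_left h hz]

theorem le_expTail {z : ℝ} (hz : 0 ≤ z) : z ^ 2 / 2 ≤ expTail z := by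
  have := Real.quadratic_le_exp_of_nonneg hz
  rw [expTail]
  linarith

theorem exp_neg_mul_expTail_le {z : ℝ} (hz : 0 ≤ z) : Real.exp (-z) * expTail z ≤ z ^ 2 := by
  have h2 : Real.exp (-z) * Real.exp z = 1 := by rw [← Real.exp_add]; simp
  have := mul_le_mul_of_nonneg_left (expTail_le hz) (Real.exp_pos (-z)).le
  linear_combination this + z ^ 2 * h2

/-- The quadratic terms cancel. The sign is that of `two_lt_truncMean`, so only one inequality has
to be estimated. -/
theorem abs_two_expTail_sub_le {z : ℝ} (hz : 0 < z) :
    |2 * expTail z - z * (Real.exp z - 1)| ≤ z ^ 3 * Real.exp z := by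
  have h1 := two_lt_truncMean hz
  rw [truncMean, if_neg hz.ne', lt_div_iff₀ (expTail_pos hz)] at h1
  have h2 := le_expTail hz.le
  have h3 := mul_le_mul_of_nonneg_left (exp_sub_one_le (z := z)) hz.le
  have h4 := mul_le_mul_of_nonneg_left (exp_sub_one_le (z := z)) (sq_nonneg z)
  rw [abs_of_nonpos (by linarith)]
  rw [expTail] at *
  nlinarith

/-- A seminorm that controls the differentials of the first integrals near the end of the
process. -/
noncomputable def defect (z : ℝ) (v : Fin 4 → ℝ) : ℝ :=
  |2 * v 2 - v 0 - 2 * v 1| + z * (|v 1| + |v 2|)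

namespace Admissible

variable {c z b : ℝ}

theorem betaFn_pos' (h : Admissible c z b) : 0 < c * betaFn c 0 :=
  mul_pos h.c_pos (betaFn_pos h.c_pos 0)

theorem exp_div_discr_le (h : Admissible c z b) :
    Real.exp z / discr z ≤ 12 * Real.exp c / z ^ 4 := by
  have hz := h.z_pos
  have hD := discr_pos hz
  have h1 := discr_lower hz.le
  have h2 := Real.exp_le_exp.2 h.z_le
  have h3 := Real.exp_pos z
  rw [div_le_div_iff₀ hD (by positivity)]
  have : z ^ 4 ≤ 12 * discr z := by linarith
  calc Real.exp z * z ^ 4 ≤ Real.exp c * (12 * discr z) := by gcongr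
    _ = _ := by ring

/-- Written in terms of `2 * v 2 - v 0 - 2 * v 1` and `v 1`, the numerator has coefficients O(z²)
and O(z³): together O(z²) times the defect, to be divided by a discriminant of order z⁴. -/
theorem abs_coZ_le (h : Admissible c z b) (v : Fin 4 → ℝ) :
    z ^ 2 * |coZ c z b v|
      ≤ 12 * Real.exp c ^ 2 * (c / (c * betaFn c 0)) * defect z v := by
  have hz := h.z_pos
  have hb := h.b_pos
  have hc := h.c_pos
  have hb0 := h.betaFn_pos'
  have hbb := h.le_b
  have hD := discr_pos hz
  have he := h.exp_div_discr_le
  have hE := Real.exp_le_exp.2 h.z_le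
  have hEp := Real.exp_pos z
  have hcp := Real.exp_pos c
  have e : coZ c z b v = Real.exp z / discr z * (c / b) * (expTail z * (2 * v 2 - v 0 - 2 * v 1)
      + (2 * expTail z - z * (Real.exp z - 1)) * v 1) := by
    rw [coZ]
    field_simp
    ring
  have hnum : |expTail z * (2 * v 2 - v 0 - 2 * v 1)
      + (2 * expTail z - z * (Real.exp z - 1)) * v 1| ≤ z ^ 2 * Real.exp c * defect z v := by
    refine (abs_add_le _ _).trans ?_
    rw [abs_mul, abs_mul, abs_of_pos (expTail_pos hz)]
    have h1 := expTail_le hz.le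
    have h2 := abs_two_expTail_sub_le hz
    have h3 : |v 1| ≤ |v 1| + |v 2| := le_add_of_nonneg_right (abs_nonneg _)
    calc expTail z * |2 * v 2 - v 0 - 2 * v 1| + |2 * expTail z - z * (Real.exp z - 1)| * |v 1|
        ≤ z ^ 2 * Real.exp c * |2 * v 2 - v 0 - 2 * v 1|
          + z ^ 3 * Real.exp c * (|v 1| + |v 2|) := by
          gcongr
          · exact h1.trans (by gcongr)
          · exact h2.trans (by gcongr)
      _ = _ := by rw [defect]; ring
  have hq : Real.exp z / discr z * (c / b) ≤ 12 * Real.exp c / z ^ 4 * (c / (c * betaFn c 0)) := by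
    gcongr
  rw [e, abs_mul, abs_of_pos (by positivity : 0 < Real.exp z / discr z * (c / b))]
  calc z ^ 2 * (Real.exp z / discr z * (c / b) * _)
      ≤ z ^ 2 * (12 * Real.exp c / z ^ 4 * (c / (c * betaFn c 0))
        * (z ^ 2 * Real.exp c * defect z v)) := by gcongr
    _ = _ := by field_simp

/-- Here the combination `2 * v 2 - v 0 - 2 * v 1` has coefficient of order z only, which costs one
more power of z than δz does. -/
theorem abs_coB_le (h : Admissible c z b) (v : Fin 4 → ℝ) :
    z ^ 3 * |coB z v| ≤ 12 * Real.exp c ^ 2 * defect z v := by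
  have hz := h.z_pos
  have hD := discr_pos hz
  have he := h.exp_div_discr_le
  have hE := Real.exp_le_exp.2 h.z_le
  have hEp := Real.exp_pos z
  have hcp := Real.exp_pos c
  have hc1 : 1 ≤ Real.exp c := Real.one_le_exp h.c_pos.le
  have e : coB z v = Real.exp z / discr z * (expTail z * v 1
      - z * (2 * v 2 - v 0 - 2 * v 1)) := by
    rw [coB, expTail]
    ring
  have hnum : |expTail z * v 1 - z * (2 * v 2 - v 0 - 2 * v 1)| ≤ z * Real.exp c * defect z v := by
    refine (abs_sub _ _).trans ?_
    rw [abs_mul, abs_mul, abs_of_pos (expTail_pos hz), abs_of_pos hz]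
    have h1 := expTail_le hz.le
    have h3 : |v 1| ≤ |v 1| + |v 2| := le_add_of_nonneg_right (abs_nonneg _)
    calc expTail z * |v 1| + z * |2 * v 2 - v 0 - 2 * v 1|
        ≤ z ^ 2 * Real.exp c * (|v 1| + |v 2|)
          + z * Real.exp c * |2 * v 2 - v 0 - 2 * v 1| := by
          gcongr
          · exact h1.trans (by gcongr)
          · exact le_mul_of_one_le_right hz.le hc1
      _ = _ := by rw [defect]; ring
  rw [e, abs_mul, abs_of_pos (by positivity : 0 < Real.exp z / discr z)]
  calc z ^ 3 * (Real.exp z / discr z * _)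
      ≤ z ^ 3 * (12 * Real.exp c / z ^ 4 * (z * Real.exp c * defect z v)) := by gcongr
    _ = _ := by field_simp

theorem defect_nonneg (h : Admissible c z b) (v : Fin 4 → ℝ) : 0 ≤ defect z v := by
  have := h.z_pos
  rw [defect]
  positivity

end Admissible

/-- The differentials of the first integrals grow at most like `z⁻³`, up to the defect. -/
theorem exists_abs_row_le (c : ℝ) : ∃ K : ℝ, 0 ≤ K ∧ ∀ z b, Admissible c z b →
    ∀ v, z ^ 3 * |rowA c z b v| ≤ K * defect z v ∧ z ^ 3 * |rowC c z b v| ≤ K * defect z v := by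
  -- Positivity of c is read off an admissible pair; without one the claim is vacuous.
  by_cases hne : ∃ z b, Admissible c z b
  swap
  · exact ⟨0, le_rfl, fun z b h => absurd ⟨z, b, h⟩ hne⟩
  obtain ⟨z₀, b₀, h₀⟩ := hne
  have hc := h₀.c_pos
  have hb0 := h₀.betaFn_pos'
  set K₁ := 12 * Real.exp c ^ 2 * (c / (c * betaFn c 0)) with hK₁
  set K₂ := 12 * Real.exp c ^ 2 with hK₂
  have hK₁0 : 0 ≤ K₁ := by positivity
  have hK₂0 : 0 ≤ K₂ := by positivity
  set K₃ := 2 * c * K₁ + 2 * c ^ 2 with hK₃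
  have hK₃0 : 0 ≤ K₃ := by positivity
  set K₄ := c * (1 + c) / (c * betaFn c 0) * K₂ + K₃ + c * K₁ with hK₄
  have hK₄0 : 0 ≤ K₄ := by positivity
  refine ⟨K₃ + K₄, by positivity, fun z b h v => ?_⟩
  have hz := h.z_pos
  have hb := h.b_pos
  have hbb := h.le_b
  have hbc := h.b_le
  have hzc := h.z_le
  have hd := h.defect_nonneg v
  have hZ := h.abs_coZ_le v
  have hB := h.abs_coB_le v
  have hv2 : z * |v 2| ≤ defect z v := by
    rw [defect]
    have := abs_nonneg (2 * v 2 - v 0 - 2 * v 1)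
    have := mul_nonneg hz.le (abs_nonneg (v 1))
    linarith
  have hC : z ^ 3 * |rowC c z b v| ≤ K₃ * defect z v := by
    have h1 : |rowC c z b v| ≤ 2 * c / z * |coZ c z b v| + 2 * c ^ 2 / z ^ 2 * |v 2| := by
      rw [rowC]
      refine (abs_sub _ _).trans_eq ?_
      rw [abs_mul, abs_mul, abs_of_pos (by positivity : 0 < 2 * c / z),
        abs_of_pos (by positivity : 0 < 2 * c ^ 2 / z ^ 2)]
    calc z ^ 3 * |rowC c z b v|
        ≤ z ^ 3 * (2 * c / z * |coZ c z b v| + 2 * c ^ 2 / z ^ 2 * |v 2|) := by gcongr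
      _ = 2 * c * (z ^ 2 * |coZ c z b v|) + 2 * c ^ 2 * (z * |v 2|) := by field_simp
      _ ≤ 2 * c * (K₁ * defect z v) + 2 * c ^ 2 * defect z v := by gcongr
      _ = _ := by rw [hK₃]; ring
  have hA : z ^ 3 * |rowA c z b v| ≤ K₄ * defect z v := by
    have h1 : |rowA c z b v| ≤ c * (1 + b) / b * |coB z v| + b / c * |rowC c z b v|
        + |coZ c z b v| := by
      rw [rowA]
      refine (abs_sub _ _).trans ?_
      gcongr
      refine (abs_add_le _ _).trans_eq ?_
      rw [abs_mul, abs_mul, abs_of_pos (by positivity : 0 < c * (1 + b) / b),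
        abs_of_pos (by positivity : 0 < b / c)]
    have h2 : b / c ≤ 1 := (div_le_one hc).2 hbc
    calc z ^ 3 * |rowA c z b v|
        ≤ z ^ 3 * (c * (1 + b) / b * |coB z v| + b / c * |rowC c z b v| + |coZ c z b v|) := by
          gcongr
      _ = c * (1 + b) / b * (z ^ 3 * |coB z v|) + b / c * (z ^ 3 * |rowC c z b v|)
          + z * (z ^ 2 * |coZ c z b v|) := by ring
      _ ≤ c * (1 + c) / (c * betaFn c 0) * (K₂ * defect z v) + 1 * (K₃ * defect z v)
          + c * (K₁ * defect z v) := by gcongr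
      _ = _ := by rw [hK₄]; ring
  exact ⟨hA.trans (by gcongr; linarith), hC.trans (by gcongr; linarith)⟩

/-! ### Bounds for the rates -/

/-- A dominating family for the rates that does not depend on `z`. -/
noncomputable def rateEnvelope (c : ℝ) (j : ℕ × ℕ × ℕ) : ℝ :=
  expTerm ((1 + c) ^ 2) ((1 + c) ^ 2) ((1 + c) ^ 3) j

namespace Admissible

variable {c z b : ℝ}

theorem rateEnvelope_nonneg (h : Admissible c z b) (j : ℕ × ℕ × ℕ) : 0 ≤ rateEnvelope c j := by
  have := h.c_pos
  exact expTerm_nonneg (by positivity) (by positivity) (by positivity) j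

/-- The three exponential parameters are O(z), O(z) and O(z²), and the prefactor is O(1/z). Surplus
powers of z are bounded by powers of 1 + c and go into the envelope. -/
theorem stateRate_le_pow (h : Admissible c z b) {j : ℕ × ℕ × ℕ} (hj : j ≠ 0) (r : ℕ)
    (hr : r ≤ j.1 + j.2.1 + 2 * j.2.2) :
    stateRate z b j ≤ c / z * z ^ r * rateEnvelope c j := by
  have hz := h.z_pos
  have hb := h.b_pos
  have hc := h.c_pos
  have hf := expTail_pos hz
  have hp := h.p_nonneg
  have hp1 := h.p_le
  have he := Real.exp_pos (-z)
  have he1 := h.exp_neg_le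
  have hbc := h.b_le
  have hzc := h.z_le
  have h1 : 0 ≤ (1 - b / z * (1 - Real.exp (-z))) * z := by positivity
  have h2 : 0 ≤ Real.exp (-z) * b * z := by positivity
  have h3 : 0 ≤ Real.exp (-z) * b * expTail z := by positivity
  have h1' : (1 - b / z * (1 - Real.exp (-z))) * z ≤ (1 + c) * z := by gcongr; linarith
  have h2' : Real.exp (-z) * b * z ≤ (1 + c) * z := by
    gcongr
    nlinarith
  have h3' : Real.exp (-z) * b * expTail z ≤ (1 + c) * z ^ 2 := by
    have := exp_neg_mul_expTail_le hz.le
    calc Real.exp (-z) * b * expTail z = b * (Real.exp (-z) * expTail z) := by ring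
      _ ≤ (1 + c) * z ^ 2 := by gcongr; linarith
  rw [stateRate, if_neg hj]
  have hfac : Real.exp (-z) * b / z ≤ c / z := by
    gcongr
    nlinarith
  rw [mul_assoc (c / z)]
  refine mul_le_mul hfac ((expTerm_mono h1 h2 h3 h1' h2' h3' j).trans ?_)
    (expTerm_nonneg h1 h2 h3 j) (by positivity)
  have hz1 : z ≤ 1 + c := by linarith
  have hzpow : z ^ (j.1 + j.2.1 + 2 * j.2.2) ≤ z ^ r * (1 + c) ^ (j.1 + j.2.1 + 2 * j.2.2) := by
    obtain ⟨n, hn⟩ := Nat.exists_eq_add_of_le hr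
    rw [hn, pow_add]
    gcongr ?_ * ?_
    calc z ^ n ≤ (1 + c) ^ n := by gcongr
      _ ≤ (1 + c) ^ (r + n) := pow_le_pow_right₀ (by linarith) (by omega)
  have e1 : expTerm ((1 + c) * z) ((1 + c) * z) ((1 + c) * z ^ 2) j
      = z ^ (j.1 + j.2.1 + 2 * j.2.2) * expTerm (1 + c) (1 + c) (1 + c) j := by
    rw [expTerm, expTerm, mul_pow, mul_pow, mul_pow, pow_add, pow_add, pow_mul]
    ring
  have e2 : rateEnvelope c j
      = (1 + c) ^ (j.1 + j.2.1 + 2 * j.2.2) * expTerm (1 + c) (1 + c) (1 + c) j := by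
    rw [rateEnvelope, expTerm, expTerm, pow_add, pow_add, pow_mul (1 + c) 2 j.2.2]
    have : ((1 + c) ^ 3) ^ j.2.2 = ((1 + c) ^ 2) ^ j.2.2 * (1 + c) ^ j.2.2 := by
      rw [← mul_pow, ← pow_succ]
    rw [this, ← pow_mul (1 + c) 2 j.1, ← pow_mul (1 + c) 2 j.2.1]
    ring
  rw [e1, e2, ← mul_assoc]
  exact mul_le_mul_of_nonneg_right hzpow
    (expTerm_nonneg (by positivity) (by positivity) (by positivity) j)

theorem stateRate_le_envelope (h : Admissible c z b) (j : ℕ × ℕ × ℕ) :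
    stateRate z b j ≤ (1 + c) * rateEnvelope c j := by
  have hz := h.z_pos
  have hc := h.c_pos
  by_cases hj : j = 0
  · subst hj
    have : rateEnvelope c 0 = 1 := by simp [rateEnvelope, expTerm]
    rw [this, stateRate, if_pos rfl]
    linarith [h.p_le]
  · have h1 : 1 ≤ j.1 + j.2.1 + 2 * j.2.2 := by
      obtain ⟨a, b, d⟩ := j
      simp only [Prod.mk_eq_zero] at hj ⊢
      omega
    refine (h.stateRate_le_pow hj 1 h1).trans ?_
    have : c / z * z ^ 1 = c := by field_simp
    rw [this]
    exact mul_le_mul_of_nonneg_right (by linarith) (h.rateEnvelope_nonneg j)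

/-- With n = m + k₂ + 2k₃, the step with label (m, k₂, k₃) ≠ 0 changes 2x₃ − x₁ − 2x₂ by 1 − n, and
its rate is O(z^{n−1}). For n = 1, and for the special step, the change is 0; all other steps have
rate O(z). This cancellation gains the decisive factor z. -/
theorem stateRate_mul_defect_sq_le (h : Admissible c z b) (j : ℕ × ℕ × ℕ) :
    stateRate z b j * (2 * (label j 2 : ℝ) - label j 0 - 2 * label j 1) ^ 2
      ≤ 4 * (1 + c) * z * (rateEnvelope c j * weight j ^ 2) := by
  have hz := h.z_pos
  have hc := h.c_pos
  have hw := weight_pos j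
  have hG := h.rateEnvelope_nonneg j
  by_cases hj : j = 0
  · subst hj
    have : (2 * (label 0 2 : ℝ) - label 0 0 - 2 * label 0 1) = 0 := by
      simp [label_zero]
    rw [this]
    simp only [ne_eq, OfNat.ofNat_ne_zero, not_false_eq_true, zero_pow, mul_zero]
    positivity
  have e : 2 * (label j 2 : ℝ) - label j 0 - 2 * label j 1
      = 1 - (j.1 + j.2.1 + 2 * j.2.2 : ℝ) := by
    rw [label_of_ne hj]
    simp [step]
    ring
  rw [e]
  have h1 : 1 ≤ j.1 + j.2.1 + 2 * j.2.2 := by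
    obtain ⟨a, b, d⟩ := j
    simp only [Prod.mk_eq_zero] at hj ⊢
    omega
  rcases h1.eq_or_lt with h1 | h1
  · have : (j.1 + j.2.1 + 2 * j.2.2 : ℝ) = 1 := by exact_mod_cast h1.symm
    rw [this]
    simp only [sub_self, ne_eq, OfNat.ofNat_ne_zero, not_false_eq_true, zero_pow, mul_zero]
    positivity
  · have hr := h.stateRate_le_pow hj 2 h1
    have hr' : stateRate z b j ≤ (1 + c) * z * rateEnvelope c j := by
      refine hr.trans ?_
      have : c / z * z ^ 2 = c * z := by field_simp
      rw [this]
      gcongr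
      linarith
    have hsq : (1 - (j.1 + j.2.1 + 2 * j.2.2 : ℝ)) ^ 2 ≤ (2 * weight j) ^ 2 := by
      have h2 := natCast_le_weight j
      have h3 : (0 : ℝ) ≤ j.1 := Nat.cast_nonneg _
      have h4 : (0 : ℝ) ≤ j.2.1 := Nat.cast_nonneg _
      have h5 : (0 : ℝ) ≤ j.2.2 := Nat.cast_nonneg _
      rw [sq_le_sq, abs_of_pos (by positivity : 0 < 2 * weight j), abs_le]
      constructor <;> linarith
    calc _ ≤ (1 + c) * z * rateEnvelope c j * (2 * weight j) ^ 2 := by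
          gcongr
      _ = _ := by ring

theorem stateRate_mul_defect_le (h : Admissible c z b) (j : ℕ × ℕ × ℕ) :
    stateRate z b j * defect z (fun i => (label j i : ℝ)) ^ 2
      ≤ 40 * (1 + c) ^ 2 * z * (rateEnvelope c j * weight j ^ 2) := by
  have hz := h.z_pos
  have hc := h.c_pos
  have hw := weight_pos j
  have hG := h.rateEnvelope_nonneg j
  have hr := h.stateRate_nonneg j
  have h1 := h.stateRate_mul_defect_sq_le j
  have h2 := h.stateRate_le_envelope j
  have h3 : (|(label j 1 : ℝ)| + |(label j 2 : ℝ)|) ^ 2 ≤ (4 * weight j) ^ 2 := by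
    have := abs_label_le j 1
    have := abs_label_le j 2
    gcongr
    linarith
  have h4 : defect z (fun i => (label j i : ℝ)) ^ 2
      ≤ 2 * (2 * (label j 2 : ℝ) - label j 0 - 2 * label j 1) ^ 2
        + 2 * (z ^ 2 * (4 * weight j) ^ 2) := by
    have h5 : z ^ 2 * (|(label j 1 : ℝ)| + |(label j 2 : ℝ)|) ^ 2
        ≤ z ^ 2 * (4 * weight j) ^ 2 := by gcongr
    rw [defect]
    have := add_sq_le (a := |2 * (label j 2 : ℝ) - label j 0 - 2 * label j 1|)
      (b := z * (|(label j 1 : ℝ)| + |(label j 2 : ℝ)|))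
    rw [sq_abs, mul_pow] at this
    linarith
  have h6 : stateRate z b j * z ^ 2 ≤ (1 + c) * c * z * rateEnvelope c j := by
    have : z ^ 2 ≤ c * z := by nlinarith [h.z_le]
    calc stateRate z b j * z ^ 2 ≤ ((1 + c) * rateEnvelope c j) * (c * z) := by gcongr
      _ = _ := by ring
  calc _ ≤ stateRate z b j * (2 * (2 * (label j 2 : ℝ) - label j 0 - 2 * label j 1) ^ 2
        + 2 * (z ^ 2 * (4 * weight j) ^ 2)) := by gcongr
    _ = 2 * (stateRate z b j * (2 * (label j 2 : ℝ) - label j 0 - 2 * label j 1) ^ 2)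
        + 32 * (stateRate z b j * z ^ 2) * weight j ^ 2 := by ring
    _ ≤ 2 * (4 * (1 + c) * z * (rateEnvelope c j * weight j ^ 2))
        + 32 * ((1 + c) * c * z * rateEnvelope c j) * weight j ^ 2 := by gcongr
    _ = (8 * (1 + c) + 32 * (1 + c) * c) * z * (rateEnvelope c j * weight j ^ 2) := by ring
    _ ≤ _ := by
      gcongr
      nlinarith

end Admissible

theorem summable_rateEnvelope_mul (c : ℝ) :
    Summable fun j => rateEnvelope c j * weight j ^ 2 := by
  have h := (hasSum_expTerm (2 * (2 * (1 + c) ^ 2)) (2 * (2 * (1 + c) ^ 2))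
    (2 * (2 * (1 + c) ^ 3))).summable
  refine h.congr fun j => ?_
  rw [← expTerm_mul_weight, ← expTerm_mul_weight, rateEnvelope]
  ring

/-- The intensity of the noise in the directions of the first integrals. -/
theorem exists_quad_le {c : ℝ} (hc : 0 < c) (hce : c ≤ Real.exp 1) : ∃ K : ℝ, 0 ≤ K ∧
    ∀ u, 0 ≤ u → u < timeOf c 0 → ∀ (α γ : ℝ) (v : Fin 4 → ℝ),
      (∀ i, v i = α * rowA c (theta c u) (bOf c u) (Pi.single i 1)
        + γ * rowC c (theta c u) (bOf c u) (Pi.single i 1)) →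
      quad (covDensity c u) v v ≤ K * (|α| + |γ|) ^ 2 * (theta c u ^ 5)⁻¹ := by
  obtain ⟨K, hK0, hK⟩ := exists_abs_row_le c
  have hS := summable_rateEnvelope_mul c
  refine ⟨K ^ 2 * (40 * (1 + c) ^ 2) * |∑' j, rateEnvelope c j * weight j ^ 2|, by positivity,
    fun u h0 hu α γ v hv => ?_⟩
  have h := admissible_fluid hc hce h0 hu
  set z := theta c u
  set b := bOf c u
  have hz := h.z_pos
  have hsum := hasSum_quad_label hc hce h0 hu v
  -- The factor z⁻⁶ is the squared growth of the rows, and the last z is the mean square of the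
  -- defect.
  have hdom := hS.hasSum.mul_left (K ^ 2 * (|α| + |γ|) ^ 2 * (z ^ 6)⁻¹ * (40 * (1 + c) ^ 2 * z))
  have hle := hasSum_le (fun j => ?_) hsum hdom
  · refine hle.trans ?_
    calc _ ≤ K ^ 2 * (|α| + |γ|) ^ 2 * (z ^ 6)⁻¹ * (40 * (1 + c) ^ 2 * z)
          * |∑' j, rateEnvelope c j * weight j ^ 2| := by
          gcongr
          exact le_abs_self _
      _ = _ := by field_simp
  · have hrow : ∑ i, v i * (label j i : ℝ)
        = α * rowA c z b (fun i => (label j i : ℝ)) + γ * rowC c z b (fun i => (label j i : ℝ)) := by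
      rw [← rowA_sum, ← rowC_sum, Finset.mul_sum, Finset.mul_sum, ← Finset.sum_add_distrib]
      exact Finset.sum_congr rfl fun i _ => by rw [hv]; ring
    set d := defect z (fun i => (label j i : ℝ)) with hd
    obtain ⟨hA, hC⟩ := hK z b h (fun i => (label j i : ℝ))
    have hd0 : 0 ≤ d := h.defect_nonneg _
    have habs : z ^ 3 * |∑ i, v i * (label j i : ℝ)| ≤ (|α| + |γ|) * (K * d) := by
      rw [hrow]
      calc z ^ 3 * |α * rowA c z b (fun i => (label j i : ℝ))
              + γ * rowC c z b (fun i => (label j i : ℝ))|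
          ≤ z ^ 3 * (|α| * |rowA c z b (fun i => (label j i : ℝ))|
              + |γ| * |rowC c z b (fun i => (label j i : ℝ))|) := by
            rw [← abs_mul, ← abs_mul]
            gcongr
            exact abs_add_le _ _
        _ = |α| * (z ^ 3 * |rowA c z b (fun i => (label j i : ℝ))|)
              + |γ| * (z ^ 3 * |rowC c z b (fun i => (label j i : ℝ))|) := by ring
        _ ≤ |α| * (K * d) + |γ| * (K * d) := by gcongr
        _ = _ := by ring
    have hsq : (∑ i, v i * (label j i : ℝ)) ^ 2 ≤ (|α| + |γ|) ^ 2 * K ^ 2 * d ^ 2 * (z ^ 6)⁻¹ := by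
      have h1 : (z ^ 3 * |∑ i, v i * (label j i : ℝ)|) ^ 2 ≤ ((|α| + |γ|) * (K * d)) ^ 2 := by
        gcongr
      rw [mul_pow, sq_abs] at h1
      rw [← div_eq_mul_inv, le_div_iff₀ (by positivity)]
      calc (∑ i, v i * (label j i : ℝ)) ^ 2 * z ^ 6
          = (z ^ 3) ^ 2 * (∑ i, v i * (label j i : ℝ)) ^ 2 := by ring
        _ ≤ _ := h1
        _ = _ := by ring
    have hr := h.stateRate_nonneg j
    have hrd := h.stateRate_mul_defect_le j
    calc stateRate z b j * (∑ i, v i * (label j i : ℝ)) ^ 2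
        ≤ stateRate z b j * ((|α| + |γ|) ^ 2 * K ^ 2 * d ^ 2 * (z ^ 6)⁻¹) := by gcongr
      _ = (|α| + |γ|) ^ 2 * K ^ 2 * (z ^ 6)⁻¹ * (stateRate z b j * d ^ 2) := by ring
      _ ≤ (|α| + |γ|) ^ 2 * K ^ 2 * (z ^ 6)⁻¹
          * (40 * (1 + c) ^ 2 * z * (rateEnvelope c j * weight j ^ 2)) := by gcongr
      _ = _ := by ring

/-! ### The rows of the stopped process -/

section Rows

variable {c : ℝ}

theorem drift_fluid (hc : 0 < c) {s : ℝ} (h0 : 0 ≤ s) (hs : s < timeOf c 0) :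
    drift (fluid c s) = driftForm (theta c s) (bOf c s / theta c s) := by
  have hz := theta_pos hc h0 hs
  have hb := bOf_pos hc s
  rw [fluid_eq hc, (regular_state hc hz hb s).drift_eq, zParam_state hc hz hb, aOf_state hc hz hb]

theorem stopRow_vecMul (s : ℝ) (j : Fin 4) (A : Matrix (Fin 4) (Fin 4) ℝ) (k : Fin 4) :
    (stopRow c s j ᵥ* A) k = A j k - drift (fluid c s) j / drift (fluid c s) 2 * A 2 k := by
  simp [stopRow, Matrix.sub_vecMul, Matrix.smul_vecMul]

/-- Stopping projects along F, whose first three coordinates form the first column; hence the first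
zero. The projection also annihilates the third coordinate, so the other two columns become tangent
vectors with δY = 0. Their δB is bounded and their δz is 0 or O(z). -/
theorem stopRow_vecMul_fundMat (hc : 0 < c) {s : ℝ} (h0 : 0 ≤ s) (hs : s < timeOf c 0) {j : Fin 4}
    (hj : j ≠ 3) :
    stopRow c s j ᵥ* fundMat c (theta c s) (bOf c s)
      = ![0, tangent c (theta c s) (bOf c s) 0 (bOf c s / (c * (1 + bOf c s))) 0 j,
        tangent c (theta c s) (bOf c s) (theta c s / (2 * c))
          ((theta c s / (2 * c) - bOf c s / c) * (bOf c s / (c * (1 + bOf c s)))) 0 j, 0] := by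
  have hz := theta_pos hc h0 hs
  have hb := bOf_pos hc s
  have hb1 : 0 < 1 + bOf c s := by linarith
  have h2 : -1 - bOf c s ≠ 0 := by linarith
  ext k
  rw [stopRow_vecMul, drift_fluid hc h0 hs]
  generalize theta c s = z at *
  generalize bOf c s = b at *
  have h3 : driftForm z (b / z) 2 = -(1 + b) := by
    simp only [driftForm]
    simp
    field_simp
    ring
  rw [h3, div_neg]
  have hE := (Real.exp_pos z).ne'
  fin_cases j
  · fin_cases k <;> simp [fundMat, fundCol, tangent, driftForm] <;> field_simp <;> ring
  · fin_cases k <;> simp [fundMat, fundCol, tangent, driftForm] <;> field_simp <;> ring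
  · fin_cases k <;> simp [fundMat, fundCol, tangent, driftForm] <;> field_simp <;> ring
  · exact absurd rfl hj

theorem stopRow_vecMul_corr (hc : 0 < c) (hce : c ≤ Real.exp 1) {s u : ℝ} (h0 : 0 ≤ u)
    (hus : u ≤ s) (hs : s < timeOf c 0) (j : Fin 4) (i : Fin 4) :
    (stopRow c s j ᵥ* corr c s u) i
      = ∑ k, (stopRow c s j ᵥ* fundMat c (theta c s) (bOf c s)) k
        * fundRow c (theta c u) (bOf c u) (Pi.single i 1) k := by
  rw [corr_eq hc hce h0 hus hs, ← Matrix.vecMul_vecMul]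
  rfl

/-- The fourth unit vector is preserved by the linearised flow, and stopping subtracts only a
multiple of the third row, whose last entry is 0. -/
theorem stopRow_three_vecMul_corr (hc : 0 < c) (hce : c ≤ Real.exp 1) {s u : ℝ} (h0 : 0 ≤ u)
    (hus : u ≤ s) (hs : s < timeOf c 0) : (stopRow c s 3 ᵥ* corr c s u) 3 = 1 := by
  rw [stopRow_vecMul_corr hc hce h0 hus hs, Fin.sum_univ_four, stopRow_vecMul s 3 _ 3]
  simp [fundRow, rowT, rowA, rowC, coZ, coB, fundMat, fundCol, tangent]

theorem Admissible.abs_tangent_le {z b : ℝ} (h : Admissible c z b) (n₁ n₂ : ℝ) (j : Fin 4) :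
    |tangent c z b n₁ n₂ 0 j| ≤ 2 * z * |n₁| + z ^ 2 * |n₂| := by
  have hz := h.z_pos
  have hb := h.b_pos
  have hc := h.c_pos
  have hbc : b / c ≤ 1 := (div_le_one hc).2 h.b_le
  have hbc0 : 0 ≤ b / c := by positivity
  have he := Real.exp_pos (-z)
  have he1 := h.exp_neg_le
  have he2 := Real.add_one_le_exp (-z)
  have h1 := abs_nonneg n₁
  have h2 := abs_nonneg n₂
  have h3 : |1 - Real.exp (-z) - z * Real.exp (-z)| ≤ z ^ 2 := by
    have e : 1 - Real.exp (-z) - z * Real.exp (-z) = Real.exp (-z) * expTail z := by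
      have : Real.exp (-z) * Real.exp z = 1 := by rw [← Real.exp_add]; simp
      rw [expTail]
      linear_combination -this
    rw [e, abs_of_nonneg (mul_nonneg he.le (expTail_pos hz).le)]
    exact exp_neg_mul_expTail_le hz.le
  fin_cases j
  · have e : tangent c z b n₁ n₂ 0 0 = -(b / c * (1 - Real.exp (-z) + z * Real.exp (-z)) * n₁)
        + -(z * (1 - Real.exp (-z)) * n₂) := by
      simp [tangent]
      ring
    change |tangent c z b n₁ n₂ 0 0| ≤ _
    rw [e]
    refine (abs_add_le _ _).trans ?_
    rw [abs_neg, abs_neg, abs_mul, abs_mul (z * _)]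
    have h4 : |b / c * (1 - Real.exp (-z) + z * Real.exp (-z))| ≤ 2 * z := by
      have hnn : 0 ≤ 1 - Real.exp (-z) + z * Real.exp (-z) := by
        have := mul_pos hz he
        linarith
      rw [abs_of_nonneg (mul_nonneg hbc0 hnn)]
      calc b / c * (1 - Real.exp (-z) + z * Real.exp (-z))
          ≤ 1 * (z + z * 1) := by
            gcongr
            linarith
        _ = 2 * z := by ring
    have h5 : |z * (1 - Real.exp (-z))| ≤ z ^ 2 := by
      rw [abs_of_nonneg (mul_nonneg hz.le (by linarith)), sq]
      gcongr
      linarith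
    gcongr
  · have e : tangent c z b n₁ n₂ 0 1 = b / c * z * Real.exp (-z) * n₁
        + (1 - Real.exp (-z) - z * Real.exp (-z)) * n₂ := rfl
    change |tangent c z b n₁ n₂ 0 1| ≤ _
    rw [e]
    refine (abs_add_le _ _).trans ?_
    rw [abs_mul, abs_mul _ n₂]
    have h4 : |b / c * z * Real.exp (-z)| ≤ 2 * z := by
      rw [abs_of_nonneg (by positivity)]
      calc b / c * z * Real.exp (-z) ≤ 1 * z * 1 := by gcongr
        _ ≤ 2 * z := by linarith
    gcongr
  · have e : tangent c z b n₁ n₂ 0 2 = 0 := by simp [tangent]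
    change |tangent c z b n₁ n₂ 0 2| ≤ _
    rw [e, abs_zero]
    positivity
  · have e : tangent c z b n₁ n₂ 0 3 = 0 := by simp [tangent]
    change |tangent c z b n₁ n₂ 0 3| ≤ _
    rw [e, abs_zero]
    positivity

/-- In the directions of the stopped vector, the fundamental solution only involves the two first
integrals, with coefficients that are quadratically small. -/
theorem exists_stopRow_vecMul_corr (hc : 0 < c) (hce : c ≤ Real.exp 1) {s : ℝ} (h0 : 0 ≤ s)
    (hs : s < timeOf c 0) {j : Fin 4} (hj : j ≠ 3) :
    ∃ α γ : ℝ, |α| + |γ| ≤ (3 + 1 / c) * theta c s ^ 2 ∧ ∀ u, 0 ≤ u → u ≤ s → ∀ i,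
      (stopRow c s j ᵥ* corr c s u) i = α * rowA c (theta c u) (bOf c u) (Pi.single i 1)
        + γ * rowC c (theta c u) (bOf c u) (Pi.single i 1) := by
  have h := admissible_fluid hc hce h0 hs
  refine ⟨tangent c (theta c s) (bOf c s) 0 (bOf c s / (c * (1 + bOf c s))) 0 j,
    tangent c (theta c s) (bOf c s) (theta c s / (2 * c))
      ((theta c s / (2 * c) - bOf c s / c) * (bOf c s / (c * (1 + bOf c s)))) 0 j,
    ?_, fun u hu hus i => ?_⟩
  rotate_left
  · rw [stopRow_vecMul_corr hc hce hu hus hs, stopRow_vecMul_fundMat hc h0 hs hj,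
      Fin.sum_univ_four]
    simp [fundRow]
  · set z := theta c s
    set b := bOf c s
    have hz := h.z_pos
    have hb := h.b_pos
    have hbc := h.b_le
    have hzc := h.z_le
    have h1 : b / (c * (1 + b)) ≤ 1 := by
      rw [div_le_one (by positivity)]
      nlinarith
    have h1' : 0 ≤ b / (c * (1 + b)) := by positivity
    have h2 : |z / (2 * c) - b / c| ≤ 1 := by
      have h3 : z / (2 * c) ≤ 1 := by rw [div_le_one (by positivity)]; linarith
      have h4 : b / c ≤ 1 := (div_le_one hc).2 hbc
      have h5 : 0 ≤ z / (2 * c) := by positivity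
      have h6 : 0 ≤ b / c := by positivity
      rw [abs_le]
      constructor <;> linarith
    have hA := h.abs_tangent_le 0 (b / (c * (1 + b))) j
    have hC := h.abs_tangent_le (z / (2 * c)) ((z / (2 * c) - b / c) * (b / (c * (1 + b)))) j
    rw [abs_zero, mul_zero, zero_add, abs_of_nonneg h1'] at hA
    rw [abs_of_nonneg (by positivity : 0 ≤ z / (2 * c)), abs_mul, abs_of_nonneg h1'] at hC
    have hA' := hA.trans (mul_le_mul_of_nonneg_left h1 (sq_nonneg z))
    have hC' := hC.trans (add_le_add_right (mul_le_mul_of_nonneg_left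
      (mul_le_mul h2 h1 h1' zero_le_one) (sq_nonneg z)) _)
    refine (add_le_add hA' hC').trans ?_
    -- The δz part contributes z²/c and each of the two δB parts at most z².
    have e : 2 * z * (z / (2 * c)) = 1 / c * z ^ 2 := by field_simp
    rw [e]
    nlinarith [sq_nonneg z]

/-- The derivative of ϑ⁻³ is 3c(1 + b)ϑ⁻⁵ ≥ 3cϑ⁻⁵, so ϑ⁻³/(3c) controls the integral; its value at
time 0 is dropped. -/
theorem integral_inv_theta_pow_le (hc : 0 < c) {s : ℝ} (h0 : 0 ≤ s) (hs : s < timeOf c 0) :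
    IntegrableOn (fun u => (theta c u ^ 5)⁻¹) (Set.Ioc 0 s) ∧
      ∫ u in Set.Ioc 0 s, (theta c u ^ 5)⁻¹ ≤ (3 * c)⁻¹ * (theta c s ^ 3)⁻¹ := by
  have hpos : ∀ u ∈ Set.Icc 0 s, 0 < theta c u := fun u hu => theta_pos hc hu.1 (hu.2.trans_lt hs)
  have hcont : ContinuousOn (theta c) (Set.Icc 0 s) := fun u hu =>
    (hasDerivAt_theta' hc hu.1 (hu.2.trans_lt hs)).continuousAt.continuousWithinAt
  have hbcont : ContinuousOn (bOf c) (Set.Icc 0 s) := fun u hu =>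
    (hasDerivAt_bOf hc hu.1 (hu.2.trans_lt hs)).continuousAt.continuousWithinAt
  have hc5 : ContinuousOn (fun u => (theta c u ^ 5)⁻¹) (Set.Icc 0 s) :=
    (hcont.pow 5).inv₀ fun u hu => (pow_pos (hpos u hu) 5).ne'
  have hg : ContinuousOn (fun u => 3 * c * (1 + bOf c u) * (theta c u ^ 5)⁻¹) (Set.Icc 0 s) :=
    (continuousOn_const.mul (continuousOn_const.add hbcont)).mul hc5
  have hderiv : ∀ u ∈ Set.uIcc 0 s, HasDerivAt (fun u => (theta c u ^ 3)⁻¹)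
      (3 * c * (1 + bOf c u) * (theta c u ^ 5)⁻¹) u := by
    intro u hu
    rw [Set.uIcc_of_le h0] at hu
    have hz := hpos u hu
    refine (((hasDerivAt_theta' hc hu.1 (hu.2.trans_lt hs)).pow 3).inv
      (pow_pos hz 3).ne').congr_deriv ?_
    simp only [Pi.pow_apply]
    field_simp
    simp only [Nat.cast_ofNat, Nat.add_one_sub_one]
    ring
  have hint := intervalIntegral.integral_eq_sub_of_hasDerivAt hderiv
    ((Set.uIcc_of_le h0).symm ▸ hg).intervalIntegrable
  have hi5 : IntegrableOn (fun u => (theta c u ^ 5)⁻¹) (Set.Ioc 0 s) :=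
    hc5.integrableOn_Icc.mono_set Set.Ioc_subset_Icc_self
  refine ⟨hi5, ?_⟩
  rw [intervalIntegral.integral_of_le h0] at hint
  have hmono : ∫ u in Set.Ioc 0 s, 3 * c * (theta c u ^ 5)⁻¹
      ≤ ∫ u in Set.Ioc 0 s, 3 * c * (1 + bOf c u) * (theta c u ^ 5)⁻¹ := by
    refine setIntegral_mono_on (hi5.const_mul _)
      (hg.integrableOn_Icc.mono_set Set.Ioc_subset_Icc_self) measurableSet_Ioc fun u hu => ?_
    have hz := hpos u (Set.Ioc_subset_Icc_self hu)
    have hb := bOf_pos hc u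
    refine mul_le_mul_of_nonneg_right ?_ (by positivity)
    nlinarith [mul_pos hc hb]
  rw [integral_const_mul, hint] at hmono
  have h00 : 0 < (theta c 0 ^ 3)⁻¹ := by
    have := hpos 0 ⟨le_rfl, h0⟩
    positivity
  rw [← div_eq_inv_mul, le_div_iff₀ (by positivity)]
  linarith

theorem continuousOn_quad_corr (hc : 0 < c) (hce : c ≤ Real.exp 1) {s : ℝ} (h0 : 0 ≤ s)
    (hs : s < timeOf c 0) (ρ : Fin 4 → ℝ) :
    ContinuousOn (fun u => quad (covDensity c u) (ρ ᵥ* corr c s u) (ρ ᵥ* corr c s u))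
      (Set.Icc 0 s) := by
  have hQ := (rateBound hc hce h0 hs).continuousOn_covDensity
  have hf : ∀ i, ContinuousOn (fun u => (ρ ᵥ* corr c s u) i) (Set.Icc 0 s) := fun i => by
    simp only [Matrix.vecMul, dotProduct]
    exact continuousOn_finsetSum _ fun k _ =>
      continuousOn_const.mul (continuousOn_corr hc hce hs k i)
  simp only [quad]
  exact continuousOn_finsetSum _ fun i _ => continuousOn_finsetSum _ fun j _ =>
    ((hf i).mul (hf j)).mul (hQ i j)

end Rows

/-! ### The last coordinate -/

theorem Admissible.stateRate_pos {c z b : ℝ} (h : Admissible c z b) (j : ℕ × ℕ × ℕ) :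
    0 < stateRate z b j := by
  have hz := h.z_pos
  have hb := h.b_pos
  have hf := expTail_pos hz
  have hp : 0 < 1 - b / z * (1 - Real.exp (-z)) := by
    rw [div_mul_eq_mul_div, sub_pos, div_lt_one hz]
    exact h.lt_z
  rw [stateRate, expTerm]
  split_ifs
  · exact hp
  · positivity

/-- Three steps span the fourth unit vector, and their rates are continuous and positive, hence
bounded below on a compact time interval. The bound needs nothing about the first three entries of
v. -/
theorem exists_quad_ge {c : ℝ} (hc : 0 < c) (hce : c ≤ Real.exp 1) {s : ℝ} (h0 : 0 ≤ s)
    (hs : s < timeOf c 0) : ∃ κ : ℝ, 0 < κ ∧ ∀ u ∈ Set.Icc 0 s, ∀ v : Fin 4 → ℝ, v 3 = 1 →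
      κ ≤ quad (covDensity c u) v v := by
  have hmin : ∀ j : ℕ × ℕ × ℕ, ∃ κ : ℝ, 0 < κ ∧ ∀ u ∈ Set.Icc 0 s,
      κ ≤ stateRate (theta c u) (bOf c u) j := by
    intro j
    obtain ⟨u₀, hu₀, hle⟩ := isCompact_Icc.exists_isMinOn (Set.nonempty_Icc.2 h0)
      (continuousOn_stateRate hc hs j)
    exact ⟨_, (admissible_fluid hc hce hu₀.1 (hu₀.2.trans_lt hs)).stateRate_pos j,
      fun u hu => hle hu⟩
  choose κ hκ0 hκ using hmin
  set m := min (κ 0) (min (κ (0, 0, 1)) (κ (2, 0, 0))) with hm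
  have hm0 : 0 < m := lt_min (hκ0 _) (lt_min (hκ0 _) (hκ0 _))
  refine ⟨m / 3, by positivity, fun u hu v hv => ?_⟩
  have hu1 := hu.2.trans_lt hs
  have hsum := hasSum_quad_label hc hce hu.1 hu1 v
  have hle := sum_le_hasSum {(0 : ℕ × ℕ × ℕ), (0, 0, 1), (2, 0, 0)} (fun j _ =>
    mul_nonneg ((admissible_fluid hc hce hu.1 hu1).stateRate_nonneg j) (sq_nonneg _)) hsum
  rw [Finset.sum_insert (by decide), Finset.sum_insert (by decide), Finset.sum_singleton] at hle
  have h1 : m ≤ stateRate (theta c u) (bOf c u) 0 := (min_le_left _ _).trans (hκ _ u hu)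
  have h2 : m ≤ stateRate (theta c u) (bOf c u) (0, 0, 1) :=
    ((min_le_right _ _).trans (min_le_left _ _)).trans (hκ _ u hu)
  have h3 : m ≤ stateRate (theta c u) (bOf c u) (2, 0, 0) :=
    ((min_le_right _ _).trans (min_le_right _ _)).trans (hκ _ u hu)
  set x := ∑ i, v i * (label 0 i : ℝ) with hx
  set y := ∑ i, v i * (label (0, 0, 1) i : ℝ) with hy
  set w := ∑ i, v i * (label (2, 0, 0) i : ℝ) with hw
  -- (−2, 0, −1, 1) + (−1, −1, −2, 1) − (−3, −1, −3, 1) = (0, 0, 0, 1).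
  have hxyw : x + y - w = 1 := by
    rw [hx, hy, hw, label_zero, label_of_ne (by decide), label_of_ne (by decide)]
    simp [Fin.sum_univ_four, step, hv]
    ring
  -- Cauchy–Schwarz for x + y − w = 1.
  have hsq : 1 ≤ 3 * (x ^ 2 + y ^ 2 + w ^ 2) := by
    nlinarith [sq_nonneg (x - y), sq_nonneg (x + w), sq_nonneg (y + w)]
  have e1 := mul_le_mul_of_nonneg_right h1 (sq_nonneg x)
  have e2 := mul_le_mul_of_nonneg_right h2 (sq_nonneg y)
  have e3 := mul_le_mul_of_nonneg_right h3 (sq_nonneg w)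
  nlinarith

/-! ### The stopping time -/

section Stopping

variable {c : ℝ}

theorem eventually_stopping (hc : 0 < c) : ∀ᶠ δ in 𝓝[>] (0 : ℝ), 0 < δ ∧ 0 ≤ sDelta c δ ∧
    timeOf c 0 / 2 ≤ sDelta c δ ∧ sDelta c δ < timeOf c 0 ∧
    theta c (sDelta c δ) = Real.sqrt (2 * c) * Real.sqrt δ := by
  have hT := timeOf_zero_pos hc
  have hlim : Tendsto (fun δ => timeOf c (Real.sqrt (2 * c * δ))) (𝓝 0) (𝓝 (timeOf c 0)) := by
    have hcont : Continuous fun δ => timeOf c (Real.sqrt (2 * c * δ)) :=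
      (continuous_timeOf hc).comp (Real.continuous_sqrt.comp (continuous_const.mul continuous_id))
    simpa using hcont.tendsto 0
  filter_upwards [self_mem_nhdsWithin, nhdsWithin_le_nhds (Iio_mem_nhds (half_pos hc)),
    nhdsWithin_le_nhds (hlim.eventually (Ici_mem_nhds (half_lt_self hT)))] with δ h1 h2 h3
  have hδ : 0 < δ := h1
  have hδc : δ < c / 2 := h2
  have hs := Real.sqrt_pos.2 (by positivity : 0 < 2 * c * δ)
  rw [sDelta_eq hc hδ.le (by linarith)]
  exact ⟨hδ, (half_pos hT).le.trans h3, h3, strictAntiOn_timeOf hc Set.self_mem_Ici hs.le hs,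
    by rw [theta_timeOf hc hs.le, Real.sqrt_mul (by positivity)]⟩

theorem tendsto_theta_sDelta (hc : 0 < c) :
    Tendsto (fun δ => theta c (sDelta c δ)) (𝓝[>] 0) (𝓝 0) := by
  have hcont : Continuous fun δ => Real.sqrt (2 * c) * Real.sqrt δ :=
    continuous_const.mul Real.continuous_sqrt
  have hlim : Tendsto (fun δ => Real.sqrt (2 * c) * Real.sqrt δ) (𝓝[>] 0) (𝓝 0) := by
    simpa using (hcont.tendsto 0).mono_left nhdsWithin_le_nhds
  refine hlim.congr' ?_
  filter_upwards [eventually_stopping hc] with δ h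
  exact h.2.2.2.2.symm

theorem sq_theta_sDelta (hc : 0 < c) {δ : ℝ} (hδ : 0 < δ)
    (h : theta c (sDelta c δ) = Real.sqrt (2 * c) * Real.sqrt δ) :
    theta c (sDelta c δ) ^ 2 = 2 * c * δ := by
  rw [h, mul_pow, Real.sq_sqrt (by positivity), Real.sq_sqrt hδ.le]

/-- Dropping the subtracted nonnegative term leaves ϑ²/c = 2δ. -/
theorem isBigO_fluid_zero (hc : 0 < c) (hce : c ≤ Real.exp 1) :
    (fun δ => fluid c (sDelta c δ) 0) =O[𝓝[>] (0 : ℝ)] fun δ : ℝ => δ := by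
  refine IsBigO.of_bound 2 ?_
  filter_upwards [eventually_stopping hc] with δ ⟨hδ, h0, _, hs, hth⟩
  have hpos := fluid_zero_pos hc hce h0 hs
  have hz := theta_pos hc h0 hs
  have hb := betaFn_pos hc (theta c (sDelta c δ))
  have hsq := sq_theta_sDelta hc hδ hth
  rw [Real.norm_of_nonneg hpos.le, Real.norm_of_nonneg hδ.le, fluid_zero, hsq]
  have he := (admissible_fluid hc hce h0 hs).exp_neg_le
  have h1 : 0 ≤ theta c (sDelta c δ) * c * betaFn c (theta c (sDelta c δ))
      * (1 - Real.exp (-theta c (sDelta c δ))) :=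
    mul_nonneg (by positivity) (by linarith)
  calc 1 / c * (2 * c * δ - theta c (sDelta c δ) * c * betaFn c (theta c (sDelta c δ))
        * (1 - Real.exp (-theta c (sDelta c δ)))) ≤ 1 / c * (2 * c * δ) := by
        gcongr
        linarith
    _ = 2 * δ := by field_simp

theorem IsBigTheta.of_bounds {l : Filter ℝ} {f g : ℝ → ℝ} {a K : ℝ} (ha : 0 < a)
    (h : ∀ᶠ x in l, 0 ≤ g x ∧ a * g x ≤ f x ∧ f x ≤ K * g x) : IsBigTheta l f g := by
  refine ⟨IsBigO.of_bound K ?_, a, ha, ?_⟩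
  · filter_upwards [h] with x ⟨h0, h1, h2⟩
    rwa [Real.norm_of_nonneg h0, Real.norm_of_nonneg ((mul_nonneg ha.le h0).trans h1)]
  · filter_upwards [h] with x ⟨h0, h1, h2⟩
    rwa [abs_of_nonneg h0]

theorem isBigTheta_fluid_one (hc : 0 < c) :
    IsBigTheta (𝓝[>] 0) (fun δ => fluid c (sDelta c δ) 1) fun δ => δ := by
  have hb0 := betaFn_pos hc 0
  refine IsBigTheta.of_bounds (a := Real.exp (-c) * c * betaFn c 0) (K := 2 * c) (by positivity) ?_
  filter_upwards [eventually_stopping hc] with δ ⟨hδ, h0, _, hs, hth⟩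
  have hz := theta_pos hc h0 hs
  have hzc := theta_le hc h0 hs.le
  have hsq := sq_theta_sDelta hc hδ hth
  have hb1 := betaFn_le_one hc hzc
  have hbm := monotone_betaFn hc hz.le
  rw [fluid_one]
  set z := theta c (sDelta c δ)
  have hb := betaFn_pos hc z
  refine ⟨hδ.le, ?_, ?_⟩
  · have h1 := le_expTail hz.le
    rw [hsq] at h1
    have h3 := (expTail_pos hz).le
    have h2 : Real.exp (-c) ≤ Real.exp (-z) := Real.exp_le_exp.2 (by linarith)
    calc Real.exp (-c) * c * betaFn c 0 * δ = Real.exp (-c) * (2 * c * δ / 2) * betaFn c 0 := by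
          ring
      _ ≤ Real.exp (-z) * expTail z * betaFn c z := by gcongr
  · have h1 := exp_neg_mul_expTail_le hz.le
    have h2 := (expTail_pos hz).le
    calc Real.exp (-z) * expTail z * betaFn c z ≤ z ^ 2 * 1 := by gcongr
      _ = 2 * c * δ := by rw [hsq, mul_one]

theorem isBigTheta_fluid_two (hc : 0 < c) :
    IsBigTheta (𝓝[>] 0) (fun δ => fluid c (sDelta c δ) 2) fun δ => δ := by
  refine IsBigTheta.of_bounds (a := 1) (K := 1) one_pos ?_
  filter_upwards [eventually_stopping hc] with δ ⟨hδ, h0, _, hs, hth⟩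
  have h : fluid c (sDelta c δ) 2 = δ := by
    rw [fluid_two, sq_theta_sDelta hc hδ hth]
    field_simp
  rw [h, one_mul]
  exact ⟨hδ.le, le_rfl, le_rfl⟩

theorem isBigTheta_zParam (hc : 0 < c) :
    IsBigTheta (𝓝[>] 0) (fun δ => zParam (fluid c (sDelta c δ))) fun δ => Real.sqrt δ := by
  refine IsBigTheta.of_bounds (a := Real.sqrt (2 * c)) (K := Real.sqrt (2 * c)) (by positivity) ?_
  filter_upwards [eventually_stopping hc] with δ ⟨hδ, h0, _, hs, hth⟩
  rw [fluid_eq hc, zParam_state hc (theta_pos hc h0 hs) (bOf_pos hc _), hth]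
  exact ⟨Real.sqrt_nonneg δ, le_rfl, le_rfl⟩

end Stopping

/-! ### The limits of the stopped covariance -/

section Limits

variable {Ω : Type*} [MeasurableSpace Ω] {P : Measure Ω} [IsProbabilityMeasure P]
  {c : ℝ} {M : EdgeModel} {V₀ : Ω → Fin 4 → ℝ} {W : (Fin 4 → ℤ) → ℝ≥0 → Ω → ℝ}

/-- The squared coefficients of the first integrals are O(ϑ⁴) at the stopping time. Against the
fixed initial covariance this gives O(ϑ⁴), and against the integrated noise, which is O(ϑ⁻³), it
gives O(ϑ). -/
theorem tendsto_stoppedCov (hW : IsInput c M P V₀ W) (hc : 0 < c) (hce : c ≤ Real.exp 1)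
    {j : Fin 4} (hj : j ≠ 3) :
    Tendsto (fun δ => stoppedCov c P V₀ W δ j j) (𝓝[>] 0) (𝓝 0) := by
  obtain ⟨K, hK0, hK⟩ := exists_quad_le hc hce
  set L := 3 + 1 / c with hL
  have hL0 : 0 < L := by positivity
  set R := ∑ i, (|rowA c (theta c 0) (bOf c 0) (Pi.single i 1)|
    + |rowC c (theta c 0) (bOf c 0) (Pi.single i 1)|) with hR
  set S := ∑ i, ∑ k, |initCov c M i k| with hS
  have hS0 : 0 ≤ S := Finset.sum_nonneg fun i _ => Finset.sum_nonneg fun k _ => abs_nonneg _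
  have hth := tendsto_theta_sDelta hc
  have hlim : Tendsto (fun δ => (L * R) ^ 2 * S * theta c (sDelta c δ) ^ 4
      + K * L ^ 2 * (3 * c)⁻¹ * theta c (sDelta c δ)) (𝓝[>] 0) (𝓝 0) := by
    simpa using ((hth.pow 4).const_mul ((L * R) ^ 2 * S)).add
      (hth.const_mul (K * L ^ 2 * (3 * c)⁻¹))
  refine squeeze_zero' ?_ ?_ hlim
  · filter_upwards [eventually_stopping hc] with δ ⟨hδ, h0, _, hs, _⟩
    rw [stoppedCov_eq hW hc hce h0 hs]
    exact add_nonneg (hW.quad_initCov_nonneg _) (setIntegral_nonneg measurableSet_Ioc fun u hu =>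
      quad_covDensity_nonneg hc hce hu.1.le (hu.2.trans_lt hs) _)
  · filter_upwards [eventually_stopping hc] with δ ⟨hδ, h0, _, hs, _⟩
    rw [stoppedCov_eq hW hc hce h0 hs]
    obtain ⟨α, γ, hαγ, hrow⟩ := exists_stopRow_vecMul_corr hc hce h0 hs hj
    set s := sDelta c δ
    have hz := theta_pos hc h0 hs
    refine add_le_add ?_ ?_
    · have hb : ∀ i, |(stopRow c s j ᵥ* corr c s 0) i| ≤ L * theta c s ^ 2 * R := by
        intro i
        rw [hrow 0 le_rfl h0]
        set x := rowA c (theta c 0) (bOf c 0) (Pi.single i 1) with hx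
        set y := rowC c (theta c 0) (bOf c 0) (Pi.single i 1) with hy
        have hxy : |x| + |y| ≤ R :=
          Finset.single_le_sum (f := fun i => |rowA c (theta c 0) (bOf c 0) (Pi.single i 1)|
            + |rowC c (theta c 0) (bOf c 0) (Pi.single i 1)|)
            (fun i _ => by positivity) (Finset.mem_univ i)
        have h1 := abs_nonneg x
        have h2 := abs_nonneg y
        have h3 := abs_nonneg α
        have h4 := abs_nonneg γ
        calc |α * x + γ * y| ≤ |α| * |x| + |γ| * |y| := by
              rw [← abs_mul, ← abs_mul]
              exact abs_add_le _ _
          _ ≤ (|α| + |γ|) * (|x| + |y|) := by nlinarith [mul_nonneg h3 h2, mul_nonneg h4 h1]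
          _ ≤ L * theta c s ^ 2 * R := by gcongr
      refine (le_abs_self _).trans ((abs_quad_le _ hb hb).trans_eq ?_)
      rw [← hS]
      ring
    · obtain ⟨hi, hle⟩ := integral_inv_theta_pow_le hc h0 hs
      have hc2 := (continuousOn_quad_corr hc hce h0 hs (stopRow c s j)).integrableOn_Icc (μ := volume)
        |>.mono_set Set.Ioc_subset_Icc_self
      calc ∫ u in Set.Ioc 0 s, quad (covDensity c u) (stopRow c s j ᵥ* corr c s u)
            (stopRow c s j ᵥ* corr c s u)
          ≤ ∫ u in Set.Ioc 0 s, K * (L * theta c s ^ 2) ^ 2 * (theta c u ^ 5)⁻¹ := by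
            refine setIntegral_mono_on hc2 (hi.const_mul _) measurableSet_Ioc fun u hu => ?_
            have hu' := theta_pos hc hu.1.le (hu.2.trans_lt hs)
            refine (hK u hu.1.le (hu.2.trans_lt hs) α γ _ (hrow u hu.1.le hu.2)).trans ?_
            gcongr
        _ = K * (L * theta c s ^ 2) ^ 2 * ∫ u in Set.Ioc 0 s, (theta c u ^ 5)⁻¹ :=
            integral_const_mul _ _
        _ ≤ K * (L * theta c s ^ 2) ^ 2 * ((3 * c)⁻¹ * (theta c s ^ 3)⁻¹) := by gcongr
        _ = _ := by field_simp

/-- The initial part and the noise after half the total time contribute nonnegatively and are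
discarded; on the first half the lower bound κ does not depend on δ. -/
theorem liminf_stoppedCov_pos (hW : IsInput c M P V₀ W) (hc : 0 < c) (hce : c ≤ Real.exp 1) :
    0 < liminf (fun δ => ((stoppedCov c P V₀ W δ 3 3 : ℝ) : EReal)) (𝓝[>] 0) := by
  have hT := timeOf_zero_pos hc
  obtain ⟨κ, hκ0, hκ⟩ := exists_quad_ge hc hce (half_pos hT).le (half_lt_self hT)
  have hpos : 0 < κ * (timeOf c 0 / 2) := by positivity
  -- In `EReal` the lower limit exists without any boundedness of the variance, so an eventual lower
  -- bound suffices.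
  refine lt_of_lt_of_le (EReal.coe_pos.2 hpos) (le_liminf_of_le (by isBoundedDefault) ?_)
  filter_upwards [eventually_stopping hc] with δ ⟨hδ, h0, hge, hs, _⟩
  rw [EReal.coe_le_coe_iff, stoppedCov_eq hW hc hce h0 hs]
  refine le_add_of_nonneg_of_le (hW.quad_initCov_nonneg _) ?_
  set s := sDelta c δ
  have hc2 := (continuousOn_quad_corr hc hce h0 hs (stopRow c s 3)).integrableOn_Icc (μ := volume)
    |>.mono_set Set.Ioc_subset_Icc_self
  have hsub : Set.Ioc 0 (timeOf c 0 / 2) ⊆ Set.Ioc 0 s := Set.Ioc_subset_Ioc_right hge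
  calc κ * (timeOf c 0 / 2) = ∫ _ in Set.Ioc 0 (timeOf c 0 / 2), κ := by
        rw [setIntegral_const]
        simp only [Real.volume_real_Ioc_of_le (half_pos hT).le, sub_zero, smul_eq_mul, mul_comm]
    _ ≤ ∫ u in Set.Ioc 0 (timeOf c 0 / 2), quad (covDensity c u) (stopRow c s 3 ᵥ* corr c s u)
            (stopRow c s 3 ᵥ* corr c s u) := by
        refine setIntegral_mono_on (integrableOn_const measure_Ioc_lt_top.ne) (hc2.mono_set hsub)
          measurableSet_Ioc fun u hu => ?_
        exact hκ u (Set.Ioc_subset_Icc_self hu) _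
          (stopRow_three_vecMul_corr hc hce hu.1.le (hu.2.trans hge) hs)
    _ ≤ ∫ u in Set.Ioc 0 s, quad (covDensity c u) (stopRow c s 3 ᵥ* corr c s u)
            (stopRow c s 3 ᵥ* corr c s u) := by
        refine setIntegral_mono_set hc2 ?_ hsub.eventuallyLE
        filter_upwards [ae_restrict_mem measurableSet_Ioc] with u hu
        exact quad_covDensity_nonneg hc hce hu.1.le (hu.2.trans_lt hs) _

end Limits

end KarpSipser

theorem lemma6p1 (c : ℝ) (hc : 0 < c) (hce : c ≤ Real.exp 1) :
    ((fun δ => KarpSipser.fluid c (KarpSipser.sDelta c δ) 0) =O[𝓝[>] (0 : ℝ)] (fun δ : ℝ => δ) ∧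
      KarpSipser.IsBigTheta (𝓝[>] 0)
        (fun δ => KarpSipser.fluid c (KarpSipser.sDelta c δ) 1) (fun δ => δ) ∧
      KarpSipser.IsBigTheta (𝓝[>] 0)
        (fun δ => KarpSipser.fluid c (KarpSipser.sDelta c δ) 2) (fun δ => δ)) ∧
    KarpSipser.IsBigTheta (𝓝[>] 0)
      (fun δ => KarpSipser.zParam (KarpSipser.fluid c (KarpSipser.sDelta c δ)))
      (fun δ => Real.sqrt δ) ∧
    ∀ (M : KarpSipser.EdgeModel) {Ω : Type*} [MeasurableSpace Ω] (P : Measure Ω)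
      [IsProbabilityMeasure P] (V₀ : Ω → Fin 4 → ℝ) (W : (Fin 4 → ℤ) → ℝ≥0 → Ω → ℝ),
      KarpSipser.IsInput c M P V₀ W →
        (∀ j : Fin 4, j = 0 ∨ j = 1 ∨ j = 2 →
          Tendsto (fun δ => KarpSipser.stoppedCov c P V₀ W δ j j) (𝓝[>] 0) (𝓝 0)) ∧
        0 < liminf (fun δ => ((KarpSipser.stoppedCov c P V₀ W δ 3 3 : ℝ) : EReal)) (𝓝[>] 0) := by
  refine ⟨⟨KarpSipser.isBigO_fluid_zero hc hce, KarpSipser.isBigTheta_fluid_one hc,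
    KarpSipser.isBigTheta_fluid_two hc⟩, KarpSipser.isBigTheta_zParam hc, ?_⟩
  intro M Ω _ P _ V₀ W hW
  refine ⟨fun j hj => KarpSipser.tendsto_stoppedCov hW hc hce ?_,
    KarpSipser.liminf_stoppedCov_pos hW hc hce⟩
  rintro rfl
  revert hj
  decide
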